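/- Let $\varepsilon,\mu:\mathbf R\to(0,\infty)$ be piecewise continuous (finitely many discontinuities per period, finite one-sided limits), $1$-periodic and even, and let $$\mathcal L\psi=-\frac1{\varepsilon}\frac{d}{dx}\Big(\frac1\mu\frac{d\psi}{dx}\Big),\qquad (u,v)_X=\int_0^1\varepsilon\,u\,\bar v\,dx ,$$ where solutions $\psi$ of $\mathcal L\psi=E\psi$ and their fluxes $\frac1\mu\psi'$ are required to be continuous. *Bands.* For real $k$ let $E_1(k)\le E_2(k)\le\cdots$ be the eigenvalues, counted with multiplicity, of $\mathcal L\psi=E\psi$, $\psi(x+1)=e^{ik}\psi(x)$; nonzero solutions are called Bloch modes at $(k,E)$. Put $E_j^-=\min_{[-\pi,\pi]}E_j$ and $E_j^+=\max_{[-\pi,\pi]}E_j$. A pair $(k^*,E^*)$ is a Dirac point if the space of solutions at $(k^*,E^*)$ has dimension two and, for some $n\ge1$ and $\alpha>0$, $E_n(k^*)=E_{n+1}(k^*)=E^*$, $E_n(k)=E^*-\alpha|k-k^*|+O((k-k^*)^2)$ and $E_{n+1}(k)=E^*+\alpha|k-k^*|+O((k-k^*)^2)$ as $k\to k^*$. *Zak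 phase.* Let $\psi_{E,1},\psi_{E,2}$ be the solutions of $\mathcal L\psi=E\psi$ with $(\psi,\frac1\mu\psi')(0)=(1,0)$ and $(0,1)$ respectively. For $0<k<\pi$ and $E=E_m(k)$ put $\phi_{m,k}=\psi_{E,2}(1)\psi_{E,1}+(e^{ik}-\psi_{E,1}(1))\psi_{E,2}$ and $\varphi_{m,k}=\phi_{m,k}/\|\phi_{m,k}\|_X$; put $\varphi_{m,k}(x)=\varphi_{m,-k}(-x)$ for $-\pi<k<0$, and $u_{m,k}(x)=e^{-ikx}\varphi_{m,k}(x)$. Let $\varphi_{m,0^\pm}$, $\varphi_{m,\pi^-}$ and $\varphi_{m,(-\pi)^+}$ be the pointwise one-sided limits of $\varphi_{m,k}$ in $k$. The Zak phase of the $m$-th band is $$\theta_m=i\int_{-\pi}^0(\partial_ku_{m,k},u_{m,k})_X\,dk+i\int_0^\pi(\partial_ku_{m,k},u_{m,k})_X\,dk-\operatorname{Im}\ln(\varphi_{m,0^+},\varphi_{m,0^-})_X-\operatorname{Im}\ln(\varphi_{m,(-\pi)^+},\varphi_{m,\pi^-})_X\pmod{2\pi},$$ with the convention $\operatorname{Im}\ln0=0$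 (an overlap that vanishes, as happens at a Dirac point, contributes no phase). **Theorem.** Let $j\ge1$ and suppose that the $j$-th band does not cross the next one: $E_j(k)\ne E_{j+1}(k)$ for all $k\in[-\pi,\pi]$. Let $\ell$ be the number of Dirac points $(k^*,E^*)$ with $k^*\in(-\pi,\pi]$ that lie below the $j$-th band, that is, $E^*\le E_j^-$ (a Dirac point at the lower edge of the band is counted). Then $\ell$ is finite; for every $m\le j$ the Zak phase $\theta_m$ is well defined (for $0<|k|<\pi$ and every $x$ the function $k\mapsto u_{m,k}(x)$ is differentiable, the integrals converge absolutely, the one-sided limits exist, and the value is real); and the upper band edge is attained, $E_j(k)=E_j^+$, for $k=0$ or $k=\pi$, with a Bloch mode there. The bulk topological index $$\gamma_j=(-1)^{j+\ell-1}\exp\Big(i\sum_{m=1}^j\theta_m\Big)$$ takes only the values $1$ and $-1$. Moreover, for every $k\in[-\pi,\pi]$ with $E_j(k)=E_j^+$ and every Bloch mode $\psi$ at $(k,E_j^+)$, $\gamma_j=1$ if and only if $\psi$ is even, and $\gamma_j=-1$ if and only if $\psi$ is odd. -/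

import Mathlib

open Filter Topology

noncomputable section

namespace Photonic

/-- A positive, piecewise continuous, `1`-periodic coefficient: finitely many discontinuities per
period, and finite one-sided limits at every point. -/
structure IsCoefficient (f : ℝ → ℝ) : Prop where
  pos : ∀ x, 0 < f x
  periodic : Function.Periodic f 1
  finite_disc : {x ∈ Set.Icc (0 : ℝ) 1 | ¬ ContinuousAt f x}.Finite
  left_lim : ∀ x, ∃ l, Tendsto f (𝓝[<] x) (𝓝 l)
  right_lim : ∀ x, ∃ l, Tendsto f (𝓝[>] x) (𝓝 l)

/-- `ψ` solves `-(1/ε) ((1/μ) ψ')' = E ψ` on `ℝ`, and `q` is its flux `(1/μ) ψ'`. Both `ψ` and `q`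
are continuous everywhere; the equations `ψ' = μ q` and `q' = -E ε ψ` hold off the
discontinuities of the coefficients. -/
def IsSolution (ε μ : ℝ → ℝ) (E : ℝ) (ψ q : ℝ → ℂ) : Prop :=
  Continuous ψ ∧ Continuous q ∧
  (∀ x, ContinuousAt μ x → HasDerivAt ψ ((μ x : ℂ) * q x) x) ∧
  (∀ x, ContinuousAt ε x → HasDerivAt q (-((E : ℂ) * (ε x : ℂ) * ψ x)) x)

/-- The space of Bloch modes of wavenumber `k` and energy `E` (together with `0`): solutions of
`𝓛 ψ = E ψ` with `ψ (x + 1) = e^{ik} ψ x`. -/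
def blochSpace (ε μ : ℝ → ℝ) (k E : ℝ) : Submodule ℂ (ℝ → ℂ) where
  carrier := {ψ | (∃ q, IsSolution ε μ E ψ q) ∧
    ∀ x, ψ (x + 1) = Complex.exp (Complex.I * k) * ψ x}
  add_mem' := by
    rintro f g ⟨⟨p, hf, hp, hf', hp'⟩, hfq⟩ ⟨⟨q, hg, hq, hg', hq'⟩, hgq⟩
    refine ⟨⟨p + q, hf.add hg, hp.add hq, fun x hx => ?_, fun x hx => ?_⟩, fun x => ?_⟩
    · exact ((hf' x hx).add (hg' x hx)).congr_deriv (by simp only [Pi.add_apply]; ring)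
    · exact ((hp' x hx).add (hq' x hx)).congr_deriv (by simp only [Pi.add_apply]; ring)
    · simp only [Pi.add_apply, hfq x, hgq x]; ring
  zero_mem' := by
    refine ⟨⟨0, continuous_const, continuous_const, fun x _ => ?_, fun x _ => ?_⟩, fun x => ?_⟩
    · simp
    · simp
    · simp
  smul_mem' := by
    rintro c f ⟨⟨p, hf, hp, hf', hp'⟩, hfq⟩
    refine ⟨⟨c • p, hf.const_smul c, hp.const_smul c, fun x hx => ?_, fun x hx => ?_⟩,
      fun x => ?_⟩
    · exact ((hf' x hx).const_smul c).congr_deriv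
        (by simp only [Pi.smul_apply, smul_eq_mul]; ring)
    · exact ((hp' x hx).const_smul c).congr_deriv
        (by simp only [Pi.smul_apply, smul_eq_mul]; ring)
    · simp only [Pi.smul_apply, hfq x, smul_eq_mul]; ring

/-- `E_j(k)`, `j ≥ 1`: the `j`-th eigenvalue, counted with multiplicity, of the Floquet-Bloch
problem at wavenumber `k`, that is, the least energy `E` such that there are `j` linearly
independent Bloch modes of energies at most `E`. -/
def bandFn (ε μ : ℝ → ℝ) (j : ℕ) (k : ℝ) : ℝ :=
  sInf {E : ℝ | ∃ f : Fin j → ℝ → ℂ, LinearIndependent ℂ f ∧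
    ∀ i, ∃ E' ≤ E, f i ∈ blochSpace ε μ k E'}

/-- `E_j^-`, the minimum of `E_j` over the Brillouin zone. -/
def bandBottom (ε μ : ℝ → ℝ) (j : ℕ) : ℝ :=
  sInf (bandFn ε μ j '' Set.Icc (-Real.pi) Real.pi)

/-- `E_j^+`, the maximum of `E_j` over the Brillouin zone. -/
def bandTop (ε μ : ℝ → ℝ) (j : ℕ) : ℝ :=
  sSup (bandFn ε μ j '' Set.Icc (-Real.pi) Real.pi)

/-- `(k₀, E₀)` is a Dirac point: two consecutive bands touch there with opposite nonzero slopes,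
and the eigenvalue has multiplicity two. -/
def IsDiracPoint (ε μ : ℝ → ℝ) (k₀ E₀ : ℝ) : Prop :=
  (∃ n : ℕ, 1 ≤ n ∧ bandFn ε μ n k₀ = E₀ ∧ bandFn ε μ (n + 1) k₀ = E₀ ∧
    ∃ α : ℝ, 0 < α ∧
      ((fun k => bandFn ε μ n k - (E₀ - α * |k - k₀|)) =O[𝓝 k₀] fun k => (k - k₀) ^ 2) ∧
      ((fun k => bandFn ε μ (n + 1) k - (E₀ + α * |k - k₀|)) =O[𝓝 k₀] fun k => (k - k₀) ^ 2)) ∧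
  Module.finrank ℂ (blochSpace ε μ k₀ E₀) = 2

/-- The Dirac points below the `j`-th band. Wavenumbers `π` and `-π` are identified; a Dirac point
at the bottom edge of the band counts as below it. -/
def diracBelow (ε μ : ℝ → ℝ) (j : ℕ) : Set (ℝ × ℝ) :=
  {p | p.1 ∈ Set.Ioc (-Real.pi) Real.pi ∧ IsDiracPoint ε μ p.1 p.2 ∧ p.2 ≤ bandBottom ε μ j}

/-- The unique solution of `𝓛 ψ = E ψ` with `ψ 0 = a` and flux `((1/μ) ψ') 0 = b`. -/
def ivpSol (ε μ : ℝ → ℝ) (E : ℝ) (a b : ℂ) : ℝ → ℂ :=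
  Classical.epsilon fun ψ => ∃ q, IsSolution ε μ E ψ q ∧ ψ 0 = a ∧ q 0 = b

/-- `ψ_{E,1}`. -/
def fundSol₁ (ε μ : ℝ → ℝ) (E : ℝ) : ℝ → ℂ := ivpSol ε μ E 1 0

/-- `ψ_{E,2}`. -/
def fundSol₂ (ε μ : ℝ → ℝ) (E : ℝ) : ℝ → ℂ := ivpSol ε μ E 0 1

/-- The inner product `(f, g)_X = ∫₀¹ ε f ḡ`. -/
def innerX (ε : ℝ → ℝ) (f g : ℝ → ℂ) : ℂ :=
  ∫ x in (0 : ℝ)..1, (ε x : ℂ) * f x * (starRingEnd ℂ) (g x)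

/-- The norm of `X`. -/
def normX (ε : ℝ → ℝ) (f : ℝ → ℂ) : ℝ :=
  Real.sqrt (∫ x in (0 : ℝ)..1, ε x * ‖f x‖ ^ 2)

/-- The Bloch mode `φ_{j,k} = ψ_{E,2}(1) ψ_{E,1} + (e^{ik} - ψ_{E,1}(1)) ψ_{E,2}`, `E = E_j(k)`. -/
def rawMode (ε μ : ℝ → ℝ) (j : ℕ) (k x : ℝ) : ℂ :=
  fundSol₂ ε μ (bandFn ε μ j k) 1 * fundSol₁ ε μ (bandFn ε μ j k) x +
    (Complex.exp (Complex.I * k) - fundSol₁ ε μ (bandFn ε μ j k) 1) *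
      fundSol₂ ε μ (bandFn ε μ j k) x

/-- The normalized Bloch mode on the open half-zones `(0, π)` and `(-π, 0)`, extended from the
former to the latter by reflection. The values at the ends of the half-zones
are taken as one-sided limits, see `IsZakPhase`. -/
def blochMode (ε μ : ℝ → ℝ) (j : ℕ) (k x : ℝ) : ℂ :=
  if 0 ≤ k then rawMode ε μ j k x / (normX ε (rawMode ε μ j k) : ℂ)
  else rawMode ε μ j (-k) (-x) / (normX ε (rawMode ε μ j (-k)) : ℂ)

/-- The periodic part `u_{j,k}(x) = e^{-ikx} φ_{j,k}(x)` of the normalized Bloch mode. -/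
def periodicPart (ε μ : ℝ → ℝ) (j : ℕ) (k x : ℝ) : ℂ :=
  Complex.exp (-(Complex.I * k * x)) * blochMode ε μ j k x

/-- The integrand `(∂u_{j,k}/∂k, u_{j,k})_X`. -/
def berryConnection (ε μ : ℝ → ℝ) (j : ℕ) (k : ℝ) : ℂ :=
  innerX ε (fun x => deriv (fun k' : ℝ => periodicPart ε μ j k' x) k) (periodicPart ε μ j k)

/-- `θ` is the Zak phase (modulo `2π`) of the `j`-th band: the integral of the Berry connection
over the two half-zones, plus the phase jumps of the Bloch mode at `k = 0` and at the zone
boundary `k = ±π`. The functions `p₀, m₀, pπ, mπ` are the limits of the mode at `0⁺, 0⁻, π⁻, (-π)⁺`.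
A vanishing overlap contributes no phase (`Complex.log 0 = 0`); with inversion symmetry this occurs
exactly at Dirac points, where the limits from the two sides are orthogonal. -/
def IsZakPhase (ε μ : ℝ → ℝ) (j : ℕ) (θ : ℝ) : Prop :=
  (∀ x, ∀ k ∈ Set.Ioo (-Real.pi) 0 ∪ Set.Ioo 0 Real.pi,
    DifferentiableAt ℝ (fun k' : ℝ => periodicPart ε μ j k' x) k) ∧
  IntervalIntegrable (berryConnection ε μ j) MeasureTheory.volume (-Real.pi) 0 ∧
  IntervalIntegrable (berryConnection ε μ j) MeasureTheory.volume 0 Real.pi ∧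
  ∃ p₀ m₀ pπ mπ : ℝ → ℂ,
    (∀ x, Tendsto (fun k => blochMode ε μ j k x) (𝓝[>] 0) (𝓝 (p₀ x))) ∧
    (∀ x, Tendsto (fun k => blochMode ε μ j k x) (𝓝[<] 0) (𝓝 (m₀ x))) ∧
    (∀ x, Tendsto (fun k => blochMode ε μ j k x) (𝓝[<] Real.pi) (𝓝 (pπ x))) ∧
    (∀ x, Tendsto (fun k => blochMode ε μ j k x) (𝓝[>] (-Real.pi)) (𝓝 (mπ x))) ∧
    ∃ n : ℤ, (θ : ℂ) =
      Complex.I * (∫ k in (-Real.pi)..0, berryConnection ε μ j k) +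
      Complex.I * (∫ k in (0 : ℝ)..Real.pi, berryConnection ε μ j k) -
      ((Complex.log (innerX ε p₀ m₀)).im : ℂ) - ((Complex.log (innerX ε mπ pπ)).im : ℂ) +
      2 * Real.pi * n

/-- The bulk topological index `γ_j`, given the Zak phases `θ_m` of the bands. -/
def bulkIndex (ε μ : ℝ → ℝ) (j : ℕ) (θ : ℕ → ℝ) : ℂ :=
  (-1) ^ (j + (diracBelow ε μ j).ncard - 1) *
    Complex.exp (Complex.I * ((∑ m ∈ Finset.Icc 1 j, θ m : ℝ) : ℂ))

end Photonic

end

/-! Because the medium is even, everything is read off the transfer matrix over half a period, with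
entries `a`, `b`, `c`, `d` (values and fluxes of the two fundamental solutions at 1/2) and `ad - bc
= 1`. The monodromy over a full period has both diagonal entries `A = ad + bc` and off-diagonal
entries `2τ = 2bd` and `-2t = 2ac`, so `A² = 1 - 4tτ`, and Bloch modes exist at `(k, E)` exactly
when `A(E) = cos k`.

Let `α` and `β` be the angles of the plane vectors `(a, -c)` and `(d, b)`. By Lagrange's identity
both increase strictly with the energy; as the two vectors have inner product 1, the angles stay
within `π/2` of each other; a Prüfer estimate shows that they are unbounded. The band with index
`n`, counted from 0, is the set of energies where both angles lie in `[nπ/2, (n+1)π/2]`. There `t`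
and `τ` share the sign `(-1)^n`, which makes `A` strictly monotone. A band edge is reached when `α`
is a multiple of `π/2` (then `t = 0`, and the even solution is a Bloch mode) or when `β` is (then `τ
= 0`, odd solution). The two edges of one gap are the energies where the two angles pass the same
multiple. Hence either the gap is open and its edges have opposite parity, or it is closed, `t = τ =
0`, and the bands cross in a Dirac cone.

For `0 < k < π` the normalized mode is `f ψ₁ + i g ψ₂` with `f` and `g` real, so reflection in `x`
is complex conjugation. The real part of the Berry connection vanishes by normalization and the
imaginary part by oddness. Only the phase jumps at the zone edges remain: the overlap there is `1`
at an even edge, `-1` at an odd edge and `0` at a Dirac point. Thus `exp(iθ)` is the product of the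
signs of the two edges of the band, a Dirac point having sign `1`.

In the product over all bands up to the given one, the lowest edge has sign `1` (the constant mode
at energy 0), each open gap contributes `-1` and each closed gap `1`. The prefactor of the index
cancels the signs of the open gaps, and what is left is the parity of the mode at the upper edge.
The argument is carried by `bandFn_succ`, `gap_types`, `berryConnection_eq_zero`,
`exists_weight_limits` and `exp_sum_zak`. -/

noncomputable section

namespace Photonic

open MeasureTheory Set

/-! ### Piecewise continuous periodic weights: bounds, measurability, integrals with a parameter. -/

namespace IsCoefficient

variable {f g : ℝ → ℝ}

lemma continuousAt_add_int (hf : IsCoefficient f) (n : ℤ) {x : ℝ} (h : ContinuousAt f (x + n)) :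
    ContinuousAt f x := by
  have h1 : f = fun y => f (y + n) := by
    funext y
    simpa using ((hf.periodic.int_mul n) y).symm
  rw [h1]
  exact ContinuousAt.comp (f := fun y : ℝ => y + n) (g := f) h (by fun_prop)

lemma continuousAt_add_one (hf : IsCoefficient f) {x : ℝ} :
    ContinuousAt f (x + 1) ↔ ContinuousAt f x := by
  constructor
  · intro h
    exact hf.continuousAt_add_int 1 (by simpa using h)
  · intro h
    refine hf.continuousAt_add_int (-1) ?_
    simpa using h

/-- Integer translates of the finitely many jumps in one period. Countability is what the
fundamental theorem of calculus with exceptional points asks for. -/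
lemma countable_disc (hf : IsCoefficient f) : {x | ¬ ContinuousAt f x}.Countable := by
  have h : {x | ¬ ContinuousAt f x} ⊆
      ⋃ n : ℤ, (fun x => x + (n : ℝ)) '' {x ∈ Icc (0 : ℝ) 1 | ¬ ContinuousAt f x} := by
    intro x hx
    refine mem_iUnion.2 ⟨⌊x⌋, Int.fract x, ⟨⟨Int.fract_nonneg x, (Int.fract_lt_one x).le⟩, ?_⟩, ?_⟩
    · intro h
      apply hx
      refine hf.continuousAt_add_int (-⌊x⌋) ?_
      simpa [Int.fract, sub_eq_add_neg] using h
    · simp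
  exact (countable_iUnion fun n => (hf.finite_disc.countable.image _)).mono h

/-- One-sided limits bound `f` near each point, compactness makes the bound uniform on a period, and
periodicity extends it. There is no positive lower bound in general, since a one-sided limit may be
0. -/
lemma exists_bound (hf : IsCoefficient f) : ∃ K, 0 < K ∧ ∀ x, f x ≤ K := by
  have hloc : ∀ x, ∃ U ∈ 𝓝 x, ∃ K, ∀ y ∈ U, f y ≤ K := by
    intro x
    obtain ⟨l, hl⟩ := hf.left_lim x
    obtain ⟨r, hr⟩ := hf.right_lim x
    have h1 := hl.eventually_le_const (lt_add_one l)
    have h2 := hr.eventually_le_const (lt_add_one r)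
    rw [eventually_nhdsWithin_iff] at h1 h2
    refine ⟨_, h1.and h2, max (f x) (max (l + 1) (r + 1)), fun y hy => ?_⟩
    rcases lt_trichotomy y x with h | h | h
    · exact (hy.1 h).trans (by simp)
    · simp [h]
    · exact (hy.2 h).trans (by simp)
  have hc : ∃ K, ∀ y ∈ Icc (0 : ℝ) 1, f y ≤ K := by
    refine isCompact_Icc.induction_on (p := fun s => ∃ K, ∀ y ∈ s, f y ≤ K) ⟨0, by simp⟩ ?_ ?_ ?_
    · rintro s t hst ⟨K, hK⟩
      exact ⟨K, fun y hy => hK y (hst hy)⟩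
    · rintro s t ⟨K, hK⟩ ⟨L, hL⟩
      refine ⟨max K L, fun y hy => ?_⟩
      rcases hy with hy | hy
      · exact (hK y hy).trans (le_max_left _ _)
      · exact (hL y hy).trans (le_max_right _ _)
    · intro x _
      obtain ⟨U, hU, K, hK⟩ := hloc x
      exact ⟨U, mem_nhdsWithin_of_mem_nhds hU, K, hK⟩
  obtain ⟨K, hK⟩ := hc
  refine ⟨K, (hf.pos 0).trans_le (hK 0 (by simp)), fun x => ?_⟩
  have h1 : f (Int.fract x) = f x := by
    have := (hf.periodic.sub_int_mul_eq (x := x) ⌊x⌋)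
    rwa [mul_one] at this
  rw [← h1]
  exact hK _ ⟨Int.fract_nonneg x, (Int.fract_lt_one x).le⟩

lemma aestronglyMeasurable (hf : IsCoefficient f) : AEStronglyMeasurable f volume := by
  have hm : MeasurableSet {x | ContinuousAt f x} := by
    have := hf.countable_disc.measurableSet.compl
    convert this using 1
    ext x
    simp
  have h1 : AEStronglyMeasurable f (volume.restrict {x | ContinuousAt f x}) :=
    ContinuousOn.aestronglyMeasurable
      (fun x hx => ContinuousAt.continuousWithinAt hx) hm
  have h2 : volume.restrict {x | ContinuousAt f x} = (volume : Measure ℝ) := by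
    rw [Measure.restrict_eq_self_of_ae_mem]
    rw [ae_iff]
    exact hf.countable_disc.measure_zero _
  rwa [h2] at h1

lemma norm_eq (hf : IsCoefficient f) (x : ℝ) : ‖f x‖ = f x := Real.norm_of_nonneg (hf.pos x).le

lemma intervalIntegrable (hf : IsCoefficient f) (a b : ℝ) :
    IntervalIntegrable f volume a b := by
  obtain ⟨K, -, hK⟩ := hf.exists_bound
  refine (intervalIntegrable_const (c := K)).mono_fun' hf.aestronglyMeasurable.restrict ?_
  exact Eventually.of_forall fun x => (hf.norm_eq x).trans_le (hK x)

lemma intervalIntegrable_mul (hf : IsCoefficient f) (hg : Continuous g) (a b : ℝ) :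
    IntervalIntegrable (fun x => f x * g x) volume a b :=
  (hf.intervalIntegrable a b).mul_continuousOn hg.continuousOn

lemma continuous_integral (hf : IsCoefficient f) (hg : Continuous g) :
    Continuous fun x => ∫ t in (0 : ℝ)..x, f t * g t :=
  intervalIntegral.continuous_primitive (fun a b => hf.intervalIntegrable_mul hg a b) 0

lemma hasDerivAt_integral (hf : IsCoefficient f) (hg : Continuous g) {x : ℝ}
    (hx : ContinuousAt f x) :
    HasDerivAt (fun x => ∫ t in (0 : ℝ)..x, f t * g t) (f x * g x) x := by
  refine intervalIntegral.integral_hasDerivAt_right (hf.intervalIntegrable_mul hg 0 x) ?_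
    (hx.mul hg.continuousAt)
  exact (hf.aestronglyMeasurable.mul hg.aestronglyMeasurable).stronglyMeasurableAtFilter

lemma exists_continuousAt (hf : IsCoefficient f) {a b : ℝ} (hab : a < b) :
    ∃ x ∈ Ioo a b, ContinuousAt f x := by
  by_contra! h
  have h1 : (Ioo a b).Countable := hf.countable_disc.mono fun x hx => h x hx
  have h2 := h1.measure_zero volume
  simp only [Real.volume_Ioo, ENNReal.ofReal_eq_zero] at h2
  linarith

/-- Continuity of an integral with a piecewise continuous weight in a parameter. -/
lemma continuous_param (hf : IsCoefficient f) {G : ℝ → ℝ → ℝ}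
    (hG : Continuous fun p : ℝ × ℝ => G p.1 p.2) (a b : ℝ) :
    Continuous fun E => ∫ x in a..b, f x * G E x := by
  obtain ⟨K, hK0, hK⟩ := hf.exists_bound
  rw [continuous_iff_continuousAt]
  intro E
  obtain ⟨M, hM⟩ := ((isCompact_Icc (a := E - 1) (b := E + 1)).prod
    (isCompact_uIcc (a := a) (b := b))).exists_bound_of_continuousOn hG.continuousOn
  refine intervalIntegral.continuousAt_of_dominated_interval (bound := fun _ => K * M) ?_ ?_ ?_ ?_
  · refine Eventually.of_forall fun F => (hf.aestronglyMeasurable.mul ?_).restrict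
    exact (hG.comp (by fun_prop : Continuous fun x : ℝ => (F, x))).aestronglyMeasurable
  · filter_upwards [Icc_mem_nhds (by linarith : E - 1 < E) (by linarith : E < E + 1)] with F hF
    refine Eventually.of_forall fun x hx => ?_
    rw [norm_mul, hf.norm_eq]
    exact mul_le_mul (hK x) (hM (F, x) ⟨hF, uIoc_subset_uIcc hx⟩) (norm_nonneg _) hK0.le
  · simp
  · refine Eventually.of_forall fun x _ => ?_
    exact (continuous_const.mul
      (hG.comp (by fun_prop : Continuous fun F : ℝ => (F, x)))).continuousAt

/-- Differentiation under an integral with a piecewise continuous weight. -/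
lemma hasDerivAt_param (hf : IsCoefficient f) {G G' : ℝ → ℝ → ℝ}
    (hG : Continuous fun p : ℝ × ℝ => G p.1 p.2)
    (hG' : Continuous fun p : ℝ × ℝ => G' p.1 p.2)
    (hd : ∀ E x, HasDerivAt (fun F => G F x) (G' E x) E) (a b E : ℝ) :
    HasDerivAt (fun E => ∫ x in a..b, f x * G E x) (∫ x in a..b, f x * G' E x) E := by
  obtain ⟨K, hK0, hK⟩ := hf.exists_bound
  obtain ⟨M, hM⟩ := ((isCompact_Icc (a := E - 1) (b := E + 1)).prod
    (isCompact_uIcc (a := a) (b := b))).exists_bound_of_continuousOn hG'.continuousOn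
  refine (intervalIntegral.hasDerivAt_integral_of_dominated_loc_of_deriv_le
    (F := fun E x => f x * G E x) (F' := fun E x => f x * G' E x) (bound := fun _ => K * M)
    (Icc_mem_nhds (by linarith : E - 1 < E) (by linarith : E < E + 1)) ?_ ?_ ?_ ?_ ?_ ?_).2
  · refine Eventually.of_forall fun F => (hf.aestronglyMeasurable.mul ?_).restrict
    exact (hG.comp (by fun_prop : Continuous fun x : ℝ => (F, x))).aestronglyMeasurable
  · exact hf.intervalIntegrable_mul (hG.comp (by fun_prop : Continuous fun x : ℝ => (E, x))) a b
  · refine (hf.aestronglyMeasurable.mul ?_).restrict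
    exact (hG'.comp (by fun_prop : Continuous fun x : ℝ => (E, x))).aestronglyMeasurable
  · refine Eventually.of_forall fun x hx F hF => ?_
    rw [norm_mul, hf.norm_eq]
    exact mul_le_mul (hK x) (hM (F, x) ⟨hF, uIoc_subset_uIcc hx⟩) (norm_nonneg _) hK0.le
  · simp
  · exact Eventually.of_forall fun x _ F _ => (hd F x).const_mul _

end IsCoefficient

end Photonic

end

/-! ### Fundamental solutions as Volterra series. -/

noncomputable section

namespace Photonic

open MeasureTheory Set
open scoped Interval

/-- Iterated integrals `∫ f ∫ g ∫ f ⋯ 1` from `0`, with `n` integrations. -/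
def iterInt : (ℝ → ℝ) → (ℝ → ℝ) → ℕ → ℝ → ℝ
  | _, _, 0, _ => 1
  | f, g, n + 1, x => ∫ t in (0 : ℝ)..x, f t * iterInt g f n t

lemma iterInt_zero (f g : ℝ → ℝ) : iterInt f g 0 = fun _ => 1 := by
  funext x; simp [iterInt]

lemma iterInt_succ (f g : ℝ → ℝ) (n : ℕ) :
    iterInt f g (n + 1) = fun x => ∫ t in (0 : ℝ)..x, f t * iterInt g f n t := by
  funext x; simp [iterInt]

/-- The even part `∑ (-E)^n W_{2n}` of the Volterra series. -/
def cosSeries (f g : ℝ → ℝ) (E x : ℝ) : ℝ := ∑' n : ℕ, (-E) ^ n * iterInt f g (2 * n) x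

/-- The odd part `∑ (-E)^n W_{2n+1}` of the Volterra series. -/
def sinSeries (f g : ℝ → ℝ) (E x : ℝ) : ℝ := ∑' n : ℕ, (-E) ^ n * iterInt f g (2 * n + 1) x

section Series

variable {f g : ℝ → ℝ}

lemma continuous_iterInt (hf : IsCoefficient f) (hg : IsCoefficient g) (n : ℕ) :
    Continuous (iterInt f g n) := by
  induction n generalizing f g with
  | zero => rw [iterInt_zero]; exact continuous_const
  | succ n ih => rw [iterInt_succ]; exact hf.continuous_integral (ih hg hf)

lemma abs_iterInt_le (hf : IsCoefficient f) (hg : IsCoefficient g) {K : ℝ}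
    (hfK : ∀ x, f x ≤ K) (hgK : ∀ x, g x ≤ K) (n : ℕ) (x : ℝ) :
    |iterInt f g n x| ≤ (K * |x|) ^ n / n.factorial := by
  have hK0 : 0 < K := (hf.pos 0).trans_le (hfK 0)
  induction n generalizing f g x with
  | zero => simp [iterInt_zero]
  | succ n ih =>
    rw [iterInt_succ]
    have h1 : |∫ t in (0 : ℝ)..x, f t * iterInt g f n t| ≤
        |∫ t in Ι (0 : ℝ) x, K * (K ^ n / n.factorial * |t - 0| ^ n)| := by
      rw [← Real.norm_eq_abs, intervalIntegral.norm_intervalIntegral_eq]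
      refine (norm_integral_le_of_norm_le (μ := volume.restrict (Ι (0 : ℝ) x))
        (g := fun t => K * (K ^ n / n.factorial * |t - 0| ^ n)) ?_ ?_).trans (le_abs_self _)
      · have : Continuous fun t : ℝ => K * (K ^ n / n.factorial * |t - 0| ^ n) := by fun_prop
        exact (this.intervalIntegrable 0 x).def'
      · refine Eventually.of_forall fun t => ?_
        rw [norm_mul, hf.norm_eq]
        refine mul_le_mul (hfK t) ?_ (norm_nonneg _) hK0.le
        have := ih hg hf hgK hfK t
        rw [Real.norm_eq_abs]
        calc _ ≤ _ := this
          _ = _ := by rw [mul_pow, sub_zero]; ring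
    refine h1.trans (le_of_eq ?_)
    rw [integral_const_mul, integral_const_mul, integral_pow_abs_sub_uIoc,
      abs_of_nonneg (by positivity), Nat.factorial_succ, sub_zero]
    push_cast
    field_simp
    ring

/-- Weakening `(2n)!` to `n!` leaves the terms of an exponential series, a summable majorant uniform
in `|E|, |x| ≤ R`. -/
lemma abs_iterInt_two_mul_le (hf : IsCoefficient f) (hg : IsCoefficient g) {K : ℝ}
    (hfK : ∀ x, f x ≤ K) (hgK : ∀ x, g x ≤ K) {E R x : ℝ} (hE : |E| ≤ R) (hx : |x| ≤ R) (n : ℕ) :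
    ‖(-E) ^ n * iterInt f g (2 * n) x‖ ≤ (R * (K * R) ^ 2) ^ n / n.factorial := by
  have hK0 : 0 < K := (hf.pos 0).trans_le (hfK 0)
  have hR : 0 ≤ R := (abs_nonneg _).trans hE
  rw [norm_mul, norm_pow, norm_neg, Real.norm_eq_abs, Real.norm_eq_abs, mul_pow _ _ n, mul_div_assoc]
  refine mul_le_mul (by gcongr) ?_ (abs_nonneg _) (by positivity)
  refine (abs_iterInt_le hf hg hfK hgK _ x).trans ?_
  rw [← pow_mul]
  gcongr
  omega

lemma abs_iterInt_two_mul_add_one_le (hf : IsCoefficient f) (hg : IsCoefficient g) {K : ℝ}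
    (hfK : ∀ x, f x ≤ K) (hgK : ∀ x, g x ≤ K) {E R x : ℝ} (hE : |E| ≤ R) (hx : |x| ≤ R) (n : ℕ) :
    ‖(-E) ^ n * iterInt f g (2 * n + 1) x‖ ≤ (K * R) * ((R * (K * R) ^ 2) ^ n / n.factorial) := by
  have hK0 : 0 < K := (hf.pos 0).trans_le (hfK 0)
  have hR : 0 ≤ R := (abs_nonneg _).trans hE
  rw [norm_mul, norm_pow, norm_neg, Real.norm_eq_abs, Real.norm_eq_abs, mul_pow _ _ n,
    mul_div_assoc, mul_left_comm]
  refine mul_le_mul (by gcongr) ?_ (abs_nonneg _) (by positivity)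
  refine (abs_iterInt_le hf hg hfK hgK _ x).trans ?_
  rw [← pow_mul, ← mul_div_assoc, ← pow_succ']
  gcongr
  omega

lemma continuous_tsum_of_local_bound {F : ℕ → ℝ × ℝ → ℝ} {u : ℝ → ℕ → ℝ}
    (hF : ∀ n, Continuous (F n)) (hu : ∀ R, Summable (u R))
    (h : ∀ R n p, |p.1| ≤ R → |p.2| ≤ R → ‖F n p‖ ≤ u R n) :
    Continuous fun p => ∑' n, F n p := by
  rw [continuous_iff_continuousAt]
  intro p
  have ho : {q : ℝ × ℝ | |q.1| ≤ ‖p‖ + 1 ∧ |q.2| ≤ ‖p‖ + 1} ∈ 𝓝 p := by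
    refine mem_of_superset (Metric.ball_mem_nhds p one_pos) fun q hq => ?_
    have h1 : ‖q‖ ≤ ‖p‖ + 1 := by
      have := norm_sub_norm_le q p
      have h2 : ‖q - p‖ < 1 := by simpa [dist_eq_norm] using hq
      linarith
    exact ⟨(norm_fst_le q).trans h1, (norm_snd_le q).trans h1⟩
  refine ContinuousOn.continuousAt ?_ ho
  exact continuousOn_tsum (fun n => (hF n).continuousOn) (hu (‖p‖ + 1))
    (fun n q hq => h _ n q hq.1 hq.2)

lemma exists_common_bound (hf : IsCoefficient f) (hg : IsCoefficient g) :
    ∃ K, 0 < K ∧ (∀ x, f x ≤ K) ∧ ∀ x, g x ≤ K := by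
  obtain ⟨K, hK, h⟩ := hf.exists_bound
  obtain ⟨L, hL, h'⟩ := hg.exists_bound
  exact ⟨max K L, hK.trans_le (le_max_left _ _), fun x => (h x).trans (le_max_left _ _),
    fun x => (h' x).trans (le_max_right _ _)⟩

lemma continuous_cosSeries (hf : IsCoefficient f) (hg : IsCoefficient g) :
    Continuous fun p : ℝ × ℝ => cosSeries f g p.1 p.2 := by
  obtain ⟨K, hK, hfK, hgK⟩ := exists_common_bound hf hg
  refine continuous_tsum_of_local_bound
    (u := fun R n => (R * (K * R) ^ 2) ^ n / n.factorial) (fun n => ?_)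
    (fun R => Real.summable_pow_div_factorial _)
    (fun R n p h1 h2 => abs_iterInt_two_mul_le hf hg hfK hgK h1 h2 n)
  have := continuous_iterInt hf hg (2 * n)
  fun_prop

lemma continuous_sinSeries (hf : IsCoefficient f) (hg : IsCoefficient g) :
    Continuous fun p : ℝ × ℝ => sinSeries f g p.1 p.2 := by
  obtain ⟨K, hK, hfK, hgK⟩ := exists_common_bound hf hg
  refine continuous_tsum_of_local_bound
    (u := fun R n => (K * R) * ((R * (K * R) ^ 2) ^ n / n.factorial)) (fun n => ?_)
    (fun R => (Real.summable_pow_div_factorial _).mul_left _)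
    (fun R n p h1 h2 => abs_iterInt_two_mul_add_one_le hf hg hfK hgK h1 h2 n)
  have := continuous_iterInt hf hg (2 * n + 1)
  fun_prop

lemma summable_cosSeries (hf : IsCoefficient f) (hg : IsCoefficient g) (E x : ℝ) :
    Summable fun n : ℕ => (-E) ^ n * iterInt f g (2 * n) x := by
  obtain ⟨K, hK, hfK, hgK⟩ := exists_common_bound hf hg
  exact Summable.of_norm_bounded (Real.summable_pow_div_factorial _)
    (abs_iterInt_two_mul_le hf hg hfK hgK (le_max_left |E| |x|) (le_max_right |E| |x|))

lemma summable_sinSeries (hf : IsCoefficient f) (hg : IsCoefficient g) (E x : ℝ) :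
    Summable fun n : ℕ => (-E) ^ n * iterInt f g (2 * n + 1) x := by
  obtain ⟨K, hK, hfK, hgK⟩ := exists_common_bound hf hg
  exact Summable.of_norm_bounded ((Real.summable_pow_div_factorial _).mul_left _)
    (abs_iterInt_two_mul_add_one_le hf hg hfK hgK (le_max_left |E| |x|) (le_max_right |E| |x|))

lemma hasSum_integral_mul {h : ℝ → ℝ} (hf : IsCoefficient f) {F : ℕ → ℝ → ℝ} {u : ℕ → ℝ} {x : ℝ}
    (hF : ∀ n, Continuous (F n)) (hu : Summable u) (hb : ∀ n t, |t| ≤ |x| → ‖F n t‖ ≤ u n)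
    (hs : ∀ t, HasSum (fun n => F n t) (h t)) :
    HasSum (fun n => ∫ t in (0 : ℝ)..x, f t * F n t) (∫ t in (0 : ℝ)..x, f t * h t) := by
  obtain ⟨K, hK0, hK⟩ := hf.exists_bound
  refine intervalIntegral.hasSum_integral_of_dominated_convergence (fun n _ => K * u n)
    (fun n => (hf.aestronglyMeasurable.mul (hF n).aestronglyMeasurable).restrict)
    (fun n => Eventually.of_forall fun t ht => ?_)
    (Eventually.of_forall fun _ _ => hu.mul_left _) (by simp)
    (Eventually.of_forall fun t _ => (hs t).mul_left _)
  rw [norm_mul, hf.norm_eq]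
  refine mul_le_mul (hK t) (hb n t ?_) (norm_nonneg _) hK0.le
  have h := uIoc_subset_uIcc ht
  simpa using abs_sub_left_of_mem_uIcc h

/-- Termwise integration. Each integration exchanges the roles of the two weights; together with
`cosSeries_eq` this is the integral form of the first-order system for a solution and its flux. -/
lemma sinSeries_eq (hf : IsCoefficient f) (hg : IsCoefficient g) (E x : ℝ) :
    sinSeries f g E x = ∫ t in (0 : ℝ)..x, f t * cosSeries g f E t := by
  obtain ⟨K, hK, hfK, hgK⟩ := exists_common_bound hf hg
  have h := hasSum_integral_mul (x := x) hf
    (fun n => continuous_const.mul (continuous_iterInt hg hf (2 * n)))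
    (Real.summable_pow_div_factorial _) (fun n t ht =>
      abs_iterInt_two_mul_le hg hf hgK hfK (le_max_left |E| |x|) (ht.trans (le_max_right |E| |x|)) n)
    (fun t => (summable_cosSeries hg hf E t).hasSum)
  unfold cosSeries
  rw [← h.tsum_eq]
  unfold sinSeries
  congr 1
  funext n
  rw [iterInt_succ, ← intervalIntegral.integral_const_mul]
  congr 1
  funext t
  simp only [Pi.mul_apply]
  ring

lemma cosSeries_eq (hf : IsCoefficient f) (hg : IsCoefficient g) (E x : ℝ) :
    cosSeries f g E x = 1 - E * ∫ t in (0 : ℝ)..x, f t * sinSeries g f E t := by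
  obtain ⟨K, hK, hfK, hgK⟩ := exists_common_bound hf hg
  have h := hasSum_integral_mul (x := x) hf
    (fun n => continuous_const.mul (continuous_iterInt hg hf (2 * n + 1)))
    ((Real.summable_pow_div_factorial _).mul_left _) (fun n t ht =>
      abs_iterInt_two_mul_add_one_le hg hf hgK hfK (le_max_left |E| |x|)
        (ht.trans (le_max_right |E| |x|)) n)
    (fun t => (summable_sinSeries hg hf E t).hasSum)
  unfold sinSeries
  rw [← h.tsum_eq, ← tsum_mul_left]
  unfold cosSeries
  rw [(summable_cosSeries hf hg E x).tsum_eq_zero_add, sub_eq_add_neg, ← tsum_neg]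
  congr 1
  · simp [iterInt_zero]
  · congr 1
    funext n
    rw [show 2 * (n + 1) = 2 * n + 1 + 1 by ring, iterInt_succ, ← intervalIntegral.integral_const_mul,
      ← intervalIntegral.integral_const_mul, ← intervalIntegral.integral_neg]
    congr 1
    funext t
    simp only [Pi.mul_apply]
    ring

lemma hasDerivAt_sinSeries (hf : IsCoefficient f) (hg : IsCoefficient g) {E x : ℝ}
    (hx : ContinuousAt f x) : HasDerivAt (sinSeries f g E) (f x * cosSeries g f E x) x := by
  have h1 : sinSeries f g E = fun x => ∫ t in (0 : ℝ)..x, f t * cosSeries g f E t :=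
    funext fun x => sinSeries_eq hf hg E x
  rw [h1]
  exact hf.hasDerivAt_integral ((continuous_cosSeries hg hf).comp (Continuous.prodMk_right E)) hx

lemma hasDerivAt_cosSeries (hf : IsCoefficient f) (hg : IsCoefficient g) {E x : ℝ}
    (hx : ContinuousAt f x) : HasDerivAt (cosSeries f g E) (-E * (f x * sinSeries g f E x)) x := by
  have h1 : cosSeries f g E = fun x => 1 - E * ∫ t in (0 : ℝ)..x, f t * sinSeries g f E t :=
    funext fun x => cosSeries_eq hf hg E x
  rw [h1]
  have := (hf.hasDerivAt_integral
    ((continuous_sinSeries hg hf).comp (Continuous.prodMk_right E)) hx).const_mul E |>.const_sub 1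
  exact this.congr_deriv (by simp)

lemma iterInt_neg (hf : ∀ x, f (-x) = f x) (hg : ∀ x, g (-x) = g x) (n : ℕ) (x : ℝ) :
    iterInt f g n (-x) = (-1) ^ n * iterInt f g n x := by
  induction n generalizing f g x with
  | zero => simp [iterInt_zero]
  | succ n ih =>
    rw [iterInt_succ]
    have := intervalIntegral.integral_comp_neg (a := 0) (b := x)
      (f := fun t => f t * iterInt g f n t)
    simp only [neg_zero] at this
    beta_reduce
    rw [intervalIntegral.integral_symm, ← this, ← intervalIntegral.integral_neg,
      ← intervalIntegral.integral_const_mul]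
    congr 1
    funext t
    rw [ih hg hf, hf]
    ring

lemma cosSeries_neg (hf : ∀ x, f (-x) = f x) (hg : ∀ x, g (-x) = g x) (E x : ℝ) :
    cosSeries f g E (-x) = cosSeries f g E x := by
  unfold cosSeries
  simp [iterInt_neg hf hg]

lemma sinSeries_neg (hf : ∀ x, f (-x) = f x) (hg : ∀ x, g (-x) = g x) (E x : ℝ) :
    sinSeries f g E (-x) = -sinSeries f g E x := by
  unfold sinSeries
  rw [← tsum_neg]
  simp [iterInt_neg hf hg, pow_add]

end Series

/-! ### Even media: real solutions, Lagrange's identity, uniqueness, translation. -/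

/-- A pair of even coefficients. -/
structure IsEvenMedium (ε μ : ℝ → ℝ) : Prop where
  ε_coef : IsCoefficient ε
  μ_coef : IsCoefficient μ
  ε_even : ∀ x, ε (-x) = ε x
  μ_even : ∀ x, μ (-x) = μ x

/-- The real solution with initial data `(1, 0)`. -/
def sol₁ (ε μ : ℝ → ℝ) (E x : ℝ) : ℝ := cosSeries μ ε E x
/-- The flux of the real solution with initial data `(1, 0)`. -/
def flux₁ (ε μ : ℝ → ℝ) (E x : ℝ) : ℝ := -E * sinSeries ε μ E x
/-- The real solution with initial data `(0, 1)`. -/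
def sol₂ (ε μ : ℝ → ℝ) (E x : ℝ) : ℝ := sinSeries μ ε E x
/-- The flux of the real solution with initial data `(0, 1)`. -/
def flux₂ (ε μ : ℝ → ℝ) (E x : ℝ) : ℝ := cosSeries ε μ E x

/-- Real-valued solutions of `𝓛 ψ = E ψ`, with flux `q`. -/
structure IsRealSolution (ε μ : ℝ → ℝ) (E : ℝ) (ψ q : ℝ → ℝ) : Prop where
  continuous_sol : Continuous ψ
  continuous_flux : Continuous q
  deriv_sol : ∀ x, ContinuousAt μ x → HasDerivAt ψ (μ x * q x) x
  deriv_flux : ∀ x, ContinuousAt ε x → HasDerivAt q (-(E * ε x * ψ x)) x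

lemma IsRealSolution.isSolution {ε μ : ℝ → ℝ} {E : ℝ} {ψ q : ℝ → ℝ}
    (h : IsRealSolution ε μ E ψ q) :
    IsSolution ε μ E (fun x => (ψ x : ℂ)) (fun x => (q x : ℂ)) := by
  refine ⟨Complex.continuous_ofReal.comp h.continuous_sol,
    Complex.continuous_ofReal.comp h.continuous_flux, fun x hx => ?_, fun x hx => ?_⟩
  · exact (h.deriv_sol x hx).ofReal_comp.congr_deriv (by push_cast; ring)
  · exact (h.deriv_flux x hx).ofReal_comp.congr_deriv (by push_cast; ring)

lemma eq_of_hasDerivAt_zero_off_countable {V : Type*} [NormedAddCommGroup V] [NormedSpace ℝ V]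
    [CompleteSpace V] {f : ℝ → V} {s : Set ℝ} (hs : s.Countable) (hf : Continuous f)
    (hd : ∀ x, x ∉ s → HasDerivAt f 0 x) (x y : ℝ) : f x = f y := by
  have := integral_eq_of_hasDerivAt_off_countable f (fun _ => 0) hs (a := y) (b := x)
    hf.continuousOn (fun z hz => hd z hz.2) (by simp)
  simpa [sub_eq_zero, eq_comm] using this

/-- Carathéodory's form of differentiability. It is fed with exact difference formulas in the
energy, so neither the series nor the equation is differentiated in `E`. -/
lemma hasDerivAt_of_sub_eq_mul {f g : ℝ → ℝ} {x : ℝ} (h : ∀ y, f y - f x = (y - x) * g y)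
    (hg : ContinuousAt g x) : HasDerivAt f (g x) x := by
  rw [hasDerivAt_iff_tendsto_slope]
  refine (hg.tendsto.mono_left nhdsWithin_le_nhds).congr' ?_
  filter_upwards [self_mem_nhdsWithin] with y hy
  rw [slope_def_field, h y]
  have : y - x ≠ 0 := sub_ne_zero.2 hy
  field_simp

namespace IsEvenMedium

variable {ε μ : ℝ → ℝ}

lemma countable_disc (h : IsEvenMedium ε μ) :
    {x | ¬ ContinuousAt μ x ∨ ¬ ContinuousAt ε x}.Countable :=
  h.μ_coef.countable_disc.union h.ε_coef.countable_disc

lemma isRealSolution₁ (h : IsEvenMedium ε μ) (E : ℝ) :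
    IsRealSolution ε μ E (sol₁ ε μ E) (flux₁ ε μ E) where
  continuous_sol := (continuous_cosSeries h.μ_coef h.ε_coef).comp (Continuous.prodMk_right E)
  continuous_flux := continuous_const.mul
    ((continuous_sinSeries h.ε_coef h.μ_coef).comp (Continuous.prodMk_right E))
  deriv_sol x hx := (hasDerivAt_cosSeries h.μ_coef h.ε_coef hx).congr_deriv
    (by simp only [flux₁]; ring)
  deriv_flux x hx := ((hasDerivAt_sinSeries h.ε_coef h.μ_coef hx).const_mul (-E)).congr_deriv
    (by simp only [sol₁]; ring)

lemma isRealSolution₂ (h : IsEvenMedium ε μ) (E : ℝ) :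
    IsRealSolution ε μ E (sol₂ ε μ E) (flux₂ ε μ E) where
  continuous_sol := (continuous_sinSeries h.μ_coef h.ε_coef).comp (Continuous.prodMk_right E)
  continuous_flux := (continuous_cosSeries h.ε_coef h.μ_coef).comp (Continuous.prodMk_right E)
  deriv_sol x hx := (hasDerivAt_sinSeries h.μ_coef h.ε_coef hx).congr_deriv
    (by simp only [flux₂])
  deriv_flux x hx := (hasDerivAt_cosSeries h.ε_coef h.μ_coef hx).congr_deriv
    (by simp only [sol₂]; ring)

lemma continuous_sol₁ (h : IsEvenMedium ε μ) : Continuous fun p : ℝ × ℝ => sol₁ ε μ p.1 p.2 :=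
  continuous_cosSeries h.μ_coef h.ε_coef

lemma continuous_sol₂ (h : IsEvenMedium ε μ) : Continuous fun p : ℝ × ℝ => sol₂ ε μ p.1 p.2 :=
  continuous_sinSeries h.μ_coef h.ε_coef

lemma continuous_flux₁ (h : IsEvenMedium ε μ) : Continuous fun p : ℝ × ℝ => flux₁ ε μ p.1 p.2 :=
  continuous_fst.neg.mul (continuous_sinSeries h.ε_coef h.μ_coef)

lemma sol₁_zero (h : IsEvenMedium ε μ) (E : ℝ) : sol₁ ε μ E 0 = 1 := by
  simp [sol₁, cosSeries_eq h.μ_coef h.ε_coef]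

lemma sol₂_zero (h : IsEvenMedium ε μ) (E : ℝ) : sol₂ ε μ E 0 = 0 := by
  simp [sol₂, sinSeries_eq h.μ_coef h.ε_coef]

lemma flux₁_zero (h : IsEvenMedium ε μ) (E : ℝ) : flux₁ ε μ E 0 = 0 := by
  simp [flux₁, sinSeries_eq h.ε_coef h.μ_coef]

lemma flux₂_zero (h : IsEvenMedium ε μ) (E : ℝ) : flux₂ ε μ E 0 = 1 := by
  simp [flux₂, cosSeries_eq h.ε_coef h.μ_coef]

lemma sol₁_neg (h : IsEvenMedium ε μ) (E x : ℝ) : sol₁ ε μ E (-x) = sol₁ ε μ E x :=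
  cosSeries_neg h.μ_even h.ε_even E x

lemma sol₂_neg (h : IsEvenMedium ε μ) (E x : ℝ) : sol₂ ε μ E (-x) = -sol₂ ε μ E x :=
  sinSeries_neg h.μ_even h.ε_even E x

lemma flux₁_neg (h : IsEvenMedium ε μ) (E x : ℝ) : flux₁ ε μ E (-x) = -flux₁ ε μ E x := by
  simp [flux₁, sinSeries_neg h.ε_even h.μ_even E x]

lemma flux₂_neg (h : IsEvenMedium ε μ) (E x : ℝ) : flux₂ ε μ E (-x) = flux₂ ε μ E x :=
  cosSeries_neg h.ε_even h.μ_even E x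

/-- Lagrange's identity for two energies. -/
lemma lagrange (h : IsEvenMedium ε μ) {E F : ℝ} {ψ q φ p : ℝ → ℝ}
    (hψ : IsRealSolution ε μ E ψ q) (hφ : IsRealSolution ε μ F φ p) (x : ℝ) :
    ψ x * p x - q x * φ x =
      ψ 0 * p 0 - q 0 * φ 0 + (E - F) * ∫ t in (0 : ℝ)..x, ε t * (ψ t * φ t) := by
  have h1 := hψ.continuous_sol
  have h2 := hψ.continuous_flux
  have h3 := hφ.continuous_sol
  have h4 := hφ.continuous_flux
  have := integral_eq_of_hasDerivAt_off_countable (fun t => ψ t * p t - q t * φ t)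
    (fun t => (E - F) * (ε t * (ψ t * φ t))) h.countable_disc (a := 0) (b := x)
    (by fun_prop) (fun t ht => ?_)
    ((h.ε_coef.intervalIntegrable_mul (h1.mul h3) 0 x).const_mul _)
  · rw [intervalIntegral.integral_const_mul] at this
    linarith
  · have hm : ContinuousAt μ t := by by_contra hc; exact ht.2 (Or.inl hc)
    have he : ContinuousAt ε t := by by_contra hc; exact ht.2 (Or.inr hc)
    exact (((hψ.deriv_sol t hm).mul (hφ.deriv_flux t he)).sub
      ((hψ.deriv_flux t he).mul (hφ.deriv_sol t hm))).congr_deriv (by ring)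

lemma wronskian_complex (h : IsEvenMedium ε μ) {E : ℝ} {ψ q φ p : ℝ → ℂ}
    (hψ : IsSolution ε μ E ψ q) (hφ : IsSolution ε μ E φ p) (x : ℝ) :
    ψ x * p x - q x * φ x = ψ 0 * p 0 - q 0 * φ 0 := by
  obtain ⟨h1, h2, hd1, hd2⟩ := hψ
  obtain ⟨h3, h4, hd3, hd4⟩ := hφ
  refine eq_of_hasDerivAt_zero_off_countable (f := fun t => ψ t * p t - q t * φ t)
    h.countable_disc (by fun_prop) (fun t ht => ?_) x 0
  have hm : ContinuousAt μ t := by by_contra hc; exact ht (Or.inl hc)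
  have he : ContinuousAt ε t := by by_contra hc; exact ht (Or.inr hc)
  exact (((hd1 t hm).mul (hd4 t he)).sub ((hd2 t he).mul (hd3 t hm))).congr_deriv (by ring)

lemma det_eq_one (h : IsEvenMedium ε μ) (E x : ℝ) :
    sol₁ ε μ E x * flux₂ ε μ E x - flux₁ ε μ E x * sol₂ ε μ E x = 1 := by
  rw [h.lagrange (h.isRealSolution₁ E) (h.isRealSolution₂ E) x]
  simp [h.sol₁_zero, h.flux₁_zero, h.flux₂_zero]

/-- Every solution is the combination of the fundamental solutions with the same initial data. -/
lemma isSolution_eq (h : IsEvenMedium ε μ) {E : ℝ} {ψ q : ℝ → ℂ}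
    (hψ : IsSolution ε μ E ψ q) (x : ℝ) :
    ψ x = ψ 0 * sol₁ ε μ E x + q 0 * sol₂ ε μ E x ∧
    q x = ψ 0 * flux₁ ε μ E x + q 0 * flux₂ ε μ E x := by
  have h1 := h.wronskian_complex hψ (h.isRealSolution₁ E).isSolution x
  have h2 := h.wronskian_complex hψ (h.isRealSolution₂ E).isSolution x
  simp only [h.sol₁_zero, h.flux₁_zero, h.sol₂_zero, h.flux₂_zero] at h1 h2
  have hd : (sol₁ ε μ E x * flux₂ ε μ E x - flux₁ ε μ E x * sol₂ ε μ E x : ℂ) = 1 := by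
    exact_mod_cast h.det_eq_one E x
  push_cast at h1 h2
  constructor
  · linear_combination (-ψ x) * hd + (-sol₂ ε μ E x : ℂ) * h1 + (sol₁ ε μ E x : ℂ) * h2
  · linear_combination (-q x) * hd + (-flux₂ ε μ E x : ℂ) * h1 + (flux₁ ε μ E x : ℂ) * h2

lemma isSolution_comb (h : IsEvenMedium ε μ) (E : ℝ) (a b : ℂ) :
    IsSolution ε μ E (fun x => a * sol₁ ε μ E x + b * sol₂ ε μ E x)
      (fun x => a * flux₁ ε μ E x + b * flux₂ ε μ E x) := by
  obtain ⟨h1, h2, hd1, hd2⟩ := (h.isRealSolution₁ E).isSolution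
  obtain ⟨h3, h4, hd3, hd4⟩ := (h.isRealSolution₂ E).isSolution
  refine ⟨by fun_prop, by fun_prop, fun x hx => ?_, fun x hx => ?_⟩
  · exact (((hd1 x hx).const_mul a).add ((hd3 x hx).const_mul b)).congr_deriv (by ring)
  · exact (((hd2 x hx).const_mul a).add ((hd4 x hx).const_mul b)).congr_deriv (by ring)

lemma ivpSol_eq (h : IsEvenMedium ε μ) (E : ℝ) (a b : ℂ) :
    ivpSol ε μ E a b = fun x => a * sol₁ ε μ E x + b * sol₂ ε μ E x := by
  have hex : ∃ ψ : ℝ → ℂ, ∃ q, IsSolution ε μ E ψ q ∧ ψ 0 = a ∧ q 0 = b :=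
    ⟨_, _, h.isSolution_comb E a b, by simp [h.sol₁_zero, h.sol₂_zero],
      by simp [h.flux₁_zero, h.flux₂_zero]⟩
  obtain ⟨q, hs, ha, hb⟩ := Classical.epsilon_spec hex
  funext x
  have := (h.isSolution_eq hs x).1
  rw [ha, hb] at this
  exact this

lemma fundSol₁_eq (h : IsEvenMedium ε μ) (E x : ℝ) : fundSol₁ ε μ E x = sol₁ ε μ E x := by
  simp [fundSol₁, h.ivpSol_eq]

lemma fundSol₂_eq (h : IsEvenMedium ε μ) (E x : ℝ) : fundSol₂ ε μ E x = sol₂ ε μ E x := by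
  simp [fundSol₂, h.ivpSol_eq]

lemma isSolution_translate (h : IsEvenMedium ε μ) {E : ℝ} {ψ q : ℝ → ℂ}
    (hψ : IsSolution ε μ E ψ q) :
    IsSolution ε μ E (fun x => ψ (x + 1)) (fun x => q (x + 1)) := by
  obtain ⟨h1, h2, hd1, hd2⟩ := hψ
  refine ⟨by fun_prop, by fun_prop, fun x hx => ?_, fun x hx => ?_⟩
  · have := hd1 (x + 1) (h.μ_coef.continuousAt_add_one.2 hx)
    rw [h.μ_coef.periodic x] at this
    exact this.comp_add_const x 1
  · have := hd2 (x + 1) (h.ε_coef.continuousAt_add_one.2 hx)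
    rw [h.ε_coef.periodic x] at this
    exact this.comp_add_const x 1

/-! ### Dependence of the solutions on the energy. -/

section Difference

variable (ε μ) in
/-- `∫₀ˣ ε ψ_{E,1} ψ_{F,1}`. -/
def cross₁₁ (E F x : ℝ) : ℝ := ∫ t in (0 : ℝ)..x, ε t * (sol₁ ε μ E t * sol₁ ε μ F t)
variable (ε μ) in
/-- `∫₀ˣ ε ψ_{E,1} ψ_{F,2}`. -/
def cross₁₂ (E F x : ℝ) : ℝ := ∫ t in (0 : ℝ)..x, ε t * (sol₁ ε μ E t * sol₂ ε μ F t)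
variable (ε μ) in
/-- `∫₀ˣ ε ψ_{E,2} ψ_{F,2}`. -/
def cross₂₂ (E F x : ℝ) : ℝ := ∫ t in (0 : ℝ)..x, ε t * (sol₂ ε μ E t * sol₂ ε μ F t)

lemma cross₂₁_eq (E F x : ℝ) :
    ∫ t in (0 : ℝ)..x, ε t * (sol₂ ε μ E t * sol₁ ε μ F t) = cross₁₂ ε μ F E x := by
  unfold cross₁₂
  congr 1
  funext t
  ring

/-- Lagrange's identity against the two fundamental solutions at `F` gives two linear equations for
the solution at `E` and its flux; their determinant is 1, and Cramer's rule solves them exactly. The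
three companion formulas arise in the same way. -/
lemma sol₁_sub (h : IsEvenMedium ε μ) (E F x : ℝ) :
    sol₁ ε μ E x - sol₁ ε μ F x =
      (E - F) * (sol₁ ε μ F x * cross₁₂ ε μ E F x - sol₂ ε μ F x * cross₁₁ ε μ E F x) := by
  have h1 := h.lagrange (h.isRealSolution₁ E) (h.isRealSolution₁ F) x
  have h2 := h.lagrange (h.isRealSolution₁ E) (h.isRealSolution₂ F) x
  have hd := h.det_eq_one F x
  simp only [h.sol₁_zero, h.flux₁_zero, h.sol₂_zero, h.flux₂_zero] at h1 h2
  unfold cross₁₁ cross₁₂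
  linear_combination (-sol₁ ε μ E x) * hd - sol₂ ε μ F x * h1 + sol₁ ε μ F x * h2

lemma flux₁_sub (h : IsEvenMedium ε μ) (E F x : ℝ) :
    flux₁ ε μ E x - flux₁ ε μ F x =
      (E - F) * (flux₁ ε μ F x * cross₁₂ ε μ E F x - flux₂ ε μ F x * cross₁₁ ε μ E F x) := by
  have h1 := h.lagrange (h.isRealSolution₁ E) (h.isRealSolution₁ F) x
  have h2 := h.lagrange (h.isRealSolution₁ E) (h.isRealSolution₂ F) x
  have hd := h.det_eq_one F x
  simp only [h.sol₁_zero, h.flux₁_zero, h.sol₂_zero, h.flux₂_zero] at h1 h2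
  unfold cross₁₁ cross₁₂
  linear_combination (-flux₁ ε μ E x) * hd - flux₂ ε μ F x * h1 + flux₁ ε μ F x * h2

lemma sol₂_sub (h : IsEvenMedium ε μ) (E F x : ℝ) :
    sol₂ ε μ E x - sol₂ ε μ F x =
      (E - F) * (sol₁ ε μ F x * cross₂₂ ε μ E F x - sol₂ ε μ F x * cross₁₂ ε μ F E x) := by
  have h1 := h.lagrange (h.isRealSolution₂ E) (h.isRealSolution₁ F) x
  have h2 := h.lagrange (h.isRealSolution₂ E) (h.isRealSolution₂ F) x
  have hd := h.det_eq_one F x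
  simp only [h.sol₁_zero, h.flux₁_zero, h.sol₂_zero, h.flux₂_zero, cross₂₁_eq] at h1 h2
  unfold cross₂₂
  linear_combination (-sol₂ ε μ E x) * hd - sol₂ ε μ F x * h1 + sol₁ ε μ F x * h2

lemma flux₂_sub (h : IsEvenMedium ε μ) (E F x : ℝ) :
    flux₂ ε μ E x - flux₂ ε μ F x =
      (E - F) * (flux₁ ε μ F x * cross₂₂ ε μ E F x - flux₂ ε μ F x * cross₁₂ ε μ F E x) := by
  have h1 := h.lagrange (h.isRealSolution₂ E) (h.isRealSolution₁ F) x
  have h2 := h.lagrange (h.isRealSolution₂ E) (h.isRealSolution₂ F) x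
  have hd := h.det_eq_one F x
  simp only [h.sol₁_zero, h.flux₁_zero, h.sol₂_zero, h.flux₂_zero, cross₂₁_eq] at h1 h2
  unfold cross₂₂
  linear_combination (-flux₂ ε μ E x) * hd - flux₂ ε μ F x * h1 + flux₁ ε μ F x * h2

/-- Joint continuity of a primitive depending on a parameter. -/
lemma _root_.Photonic.IsCoefficient.continuous_primitive_param {f : ℝ → ℝ} (hf : IsCoefficient f)
    {G : ℝ → ℝ → ℝ} (hG : Continuous fun p : ℝ × ℝ => G p.1 p.2) :
    Continuous fun p : ℝ × ℝ => ∫ t in (0 : ℝ)..p.2, f t * G p.1 t := by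
  obtain ⟨K, hK0, hK⟩ := hf.exists_bound
  rw [continuous_iff_continuousAt]
  rintro ⟨E, x⟩
  obtain ⟨M, hM⟩ := ((isCompact_Icc (a := E - 1) (b := E + 1)).prod
    (isCompact_Icc (a := -(|x| + 1)) (b := |x| + 1))).exists_bound_of_continuousOn hG.continuousOn
  refine intervalIntegral.continuousAt_parametric_primitive_of_dominated
    (F := fun E t => f t * G E t) (fun _ => K * M)
    (-(|x| + 1)) (|x| + 1) ?_ ?_ (by simp) ?_ ?_ ?_ (by simp)
  · intro F
    exact (hf.aestronglyMeasurable.mul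
      (hG.comp (Continuous.prodMk_right F)).aestronglyMeasurable).restrict
  · filter_upwards [Icc_mem_nhds (by linarith : E - 1 < E) (by linarith : E < E + 1)] with F hF
    refine (ae_restrict_iff' measurableSet_uIoc).2 (Eventually.of_forall fun t ht => ?_)
    rw [norm_mul, hf.norm_eq]
    rw [uIoc_of_le (by have := abs_nonneg x; linarith)] at ht
    exact mul_le_mul (hK t) (hM (F, t) ⟨hF, Ioc_subset_Icc_self ht⟩) (norm_nonneg _) hK0.le
  · refine Eventually.of_forall fun t => ?_
    exact (continuous_const.mul (hG.comp (by fun_prop : Continuous fun F : ℝ => (F, t)))).continuousAt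
  · constructor <;> linarith [abs_nonneg x]
  · constructor <;> linarith [neg_abs_le x, le_abs_self x]

variable (ε μ) in
/-- The derivative of `ψ_{E,1}` in the energy. -/
def dsol₁ (E x : ℝ) : ℝ := sol₁ ε μ E x * cross₁₂ ε μ E E x - sol₂ ε μ E x * cross₁₁ ε μ E E x

variable (ε μ) in
/-- The derivative of `ψ_{E,2}` in the energy. -/
def dsol₂ (E x : ℝ) : ℝ := sol₁ ε μ E x * cross₂₂ ε μ E E x - sol₂ ε μ E x * cross₁₂ ε μ E E x

lemma continuous_cross₁₁ (h : IsEvenMedium ε μ) (F x : ℝ) :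
    Continuous fun E => cross₁₁ ε μ E F x :=
  h.ε_coef.continuous_param (G := fun E t => sol₁ ε μ E t * sol₁ ε μ F t)
    (h.continuous_sol₁.mul (h.continuous_sol₁.comp (by fun_prop : Continuous
      fun p : ℝ × ℝ => (F, p.2)))) 0 x

lemma continuous_cross₁₂ (h : IsEvenMedium ε μ) (F x : ℝ) :
    Continuous fun E => cross₁₂ ε μ E F x :=
  h.ε_coef.continuous_param (G := fun E t => sol₁ ε μ E t * sol₂ ε μ F t)
    (h.continuous_sol₁.mul (h.continuous_sol₂.comp (by fun_prop : Continuous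
      fun p : ℝ × ℝ => (F, p.2)))) 0 x

lemma continuous_cross₂₁ (h : IsEvenMedium ε μ) (F x : ℝ) :
    Continuous fun E => cross₁₂ ε μ F E x :=
  h.ε_coef.continuous_param (G := fun E t => sol₁ ε μ F t * sol₂ ε μ E t)
    ((h.continuous_sol₁.comp (by fun_prop : Continuous
      fun p : ℝ × ℝ => (F, p.2))).mul h.continuous_sol₂) 0 x

lemma continuous_cross₂₂ (h : IsEvenMedium ε μ) (F x : ℝ) :
    Continuous fun E => cross₂₂ ε μ E F x :=
  h.ε_coef.continuous_param (G := fun E t => sol₂ ε μ E t * sol₂ ε μ F t)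
    (h.continuous_sol₂.mul (h.continuous_sol₂.comp (by fun_prop : Continuous
      fun p : ℝ × ℝ => (F, p.2)))) 0 x

lemma hasDerivAt_sol₁ (h : IsEvenMedium ε μ) (E x : ℝ) :
    HasDerivAt (fun E => sol₁ ε μ E x) (dsol₁ ε μ E x) E :=
  hasDerivAt_of_sub_eq_mul (fun F => h.sol₁_sub F E x) ((continuous_const.mul
    (h.continuous_cross₁₂ E x)).sub (continuous_const.mul (h.continuous_cross₁₁ E x))).continuousAt

lemma hasDerivAt_sol₂ (h : IsEvenMedium ε μ) (E x : ℝ) :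
    HasDerivAt (fun E => sol₂ ε μ E x) (dsol₂ ε μ E x) E :=
  hasDerivAt_of_sub_eq_mul (fun F => h.sol₂_sub F E x) ((continuous_const.mul
    (h.continuous_cross₂₂ E x)).sub (continuous_const.mul (h.continuous_cross₂₁ E x))).continuousAt

lemma hasDerivAt_flux₁ (h : IsEvenMedium ε μ) (E x : ℝ) :
    HasDerivAt (fun E => flux₁ ε μ E x)
      (flux₁ ε μ E x * cross₁₂ ε μ E E x - flux₂ ε μ E x * cross₁₁ ε μ E E x) E :=
  hasDerivAt_of_sub_eq_mul (fun F => h.flux₁_sub F E x) ((continuous_const.mul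
    (h.continuous_cross₁₂ E x)).sub (continuous_const.mul (h.continuous_cross₁₁ E x))).continuousAt

lemma hasDerivAt_flux₂ (h : IsEvenMedium ε μ) (E x : ℝ) :
    HasDerivAt (fun E => flux₂ ε μ E x)
      (flux₁ ε μ E x * cross₂₂ ε μ E E x - flux₂ ε μ E x * cross₁₂ ε μ E E x) E :=
  hasDerivAt_of_sub_eq_mul (fun F => h.flux₂_sub F E x) ((continuous_const.mul
    (h.continuous_cross₂₂ E x)).sub (continuous_const.mul (h.continuous_cross₂₁ E x))).continuousAt

lemma continuous_cross₁₁_diag (h : IsEvenMedium ε μ) :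
    Continuous fun p : ℝ × ℝ => cross₁₁ ε μ p.1 p.1 p.2 :=
  h.ε_coef.continuous_primitive_param (G := fun E t => sol₁ ε μ E t * sol₁ ε μ E t)
    (h.continuous_sol₁.mul h.continuous_sol₁)

lemma continuous_cross₁₂_diag (h : IsEvenMedium ε μ) :
    Continuous fun p : ℝ × ℝ => cross₁₂ ε μ p.1 p.1 p.2 :=
  h.ε_coef.continuous_primitive_param (G := fun E t => sol₁ ε μ E t * sol₂ ε μ E t)
    (h.continuous_sol₁.mul h.continuous_sol₂)

lemma continuous_cross₂₂_diag (h : IsEvenMedium ε μ) :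
    Continuous fun p : ℝ × ℝ => cross₂₂ ε μ p.1 p.1 p.2 :=
  h.ε_coef.continuous_primitive_param (G := fun E t => sol₂ ε μ E t * sol₂ ε μ E t)
    (h.continuous_sol₂.mul h.continuous_sol₂)

lemma continuous_dsol₁ (h : IsEvenMedium ε μ) :
    Continuous fun p : ℝ × ℝ => dsol₁ ε μ p.1 p.2 :=
  (h.continuous_sol₁.mul h.continuous_cross₁₂_diag).sub
    (h.continuous_sol₂.mul h.continuous_cross₁₁_diag)

lemma continuous_dsol₂ (h : IsEvenMedium ε μ) :
    Continuous fun p : ℝ × ℝ => dsol₂ ε μ p.1 p.2 :=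
  (h.continuous_sol₁.mul h.continuous_cross₂₂_diag).sub
    (h.continuous_sol₂.mul h.continuous_cross₁₂_diag)

end Difference

end IsEvenMedium

end Photonic

end

noncomputable section

namespace Photonic

open MeasureTheory Set Real

/-! ### Continuous angles of plane curves. -/

section Angle

/-- A function whose derivative is that of the angle of the plane curve `(u, v)` is a continuous
determination of that angle. -/
lemma polar_of_hasDerivAt {u v u' v' φ : ℝ → ℝ} {s : Set ℝ} (hs : s.Countable)
    (hu : Continuous u) (hv : Continuous v) (hφ : Continuous φ)
    (h0 : ∀ x, 0 < u x ^ 2 + v x ^ 2)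
    (hdu : ∀ x, x ∉ s → HasDerivAt u (u' x) x) (hdv : ∀ x, x ∉ s → HasDerivAt v (v' x) x)
    (hdφ : ∀ x, x ∉ s → HasDerivAt φ ((u x * v' x - u' x * v x) / (u x ^ 2 + v x ^ 2)) x)
    (hu0 : u 0 = √(u 0 ^ 2 + v 0 ^ 2) * cos (φ 0)) (hv0 : v 0 = √(u 0 ^ 2 + v 0 ^ 2) * sin (φ 0))
    (x : ℝ) :
    u x = √(u x ^ 2 + v x ^ 2) * cos (φ x) ∧ v x = √(u x ^ 2 + v x ^ 2) * sin (φ x) := by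
  set r : ℝ → ℝ := fun x => √(u x ^ 2 + v x ^ 2) with hr
  have hrpos : ∀ x, 0 < r x := fun x => Real.sqrt_pos.2 (h0 x)
  have hrsq : ∀ x, r x ^ 2 = u x ^ 2 + v x ^ 2 := fun x => Real.sq_sqrt (h0 x).le
  have hrc : Continuous r := by fun_prop
  have hdr : ∀ x, x ∉ s → HasDerivAt r ((u x * u' x + v x * v' x) / r x) x := fun x hx =>
    ((((hdu x hx).pow 2).add ((hdv x hx).pow 2)).sqrt (h0 x).ne').congr_deriv (by
      have := (hrpos x).ne'
      simp only [Pi.add_apply, Pi.pow_apply]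
      rw [show √(u x ^ 2 + v x ^ 2) = r x from rfl]
      field_simp
      push_cast
      ring)
  -- `hF` and `hG` concern the two coordinates of the unit vector `(u, v) / r` rotated back by `φ`.
  -- Both have derivative 0 off `s`, so the rotated vector keeps its initial value `(1, 0)`.
  have hF : ∀ x y, (u x * cos (φ x) + v x * sin (φ x)) / r x =
      (u y * cos (φ y) + v y * sin (φ y)) / r y := by
    refine eq_of_hasDerivAt_zero_off_countable (s := s)
      (f := fun x => (u x * cos (φ x) + v x * sin (φ x)) / r x) hs
      (by refine Continuous.div (by fun_prop) hrc fun x => (hrpos x).ne') fun x hx => ?_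
    refine ((((hdu x hx).mul (hdφ x hx).cos).add ((hdv x hx).mul (hdφ x hx).sin)).div (hdr x hx)
      (hrpos x).ne').congr_deriv ?_
    have h1 := (hrpos x).ne'
    simp only [Pi.add_apply, Pi.mul_apply]
    rw [← hrsq x, div_eq_zero_iff]
    left
    field_simp
    linear_combination (u' x * cos (φ x) + v' x * sin (φ x)) * r x ^ 0 * hrsq x
  have hG : ∀ x y, (v x * cos (φ x) - u x * sin (φ x)) / r x =
      (v y * cos (φ y) - u y * sin (φ y)) / r y := by
    refine eq_of_hasDerivAt_zero_off_countable (s := s)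
      (f := fun x => (v x * cos (φ x) - u x * sin (φ x)) / r x) hs
      (by refine Continuous.div (by fun_prop) hrc fun x => (hrpos x).ne') fun x hx => ?_
    refine ((((hdv x hx).mul (hdφ x hx).cos).sub ((hdu x hx).mul (hdφ x hx).sin)).div (hdr x hx)
      (hrpos x).ne').congr_deriv ?_
    have h1 := (hrpos x).ne'
    simp only [Pi.sub_apply, Pi.mul_apply]
    rw [← hrsq x, div_eq_zero_iff]
    left
    field_simp
    linear_combination (v' x * cos (φ x) - u' x * sin (φ x)) * r x ^ 0 * hrsq x
  have h1 := hF x 0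
  have h2 := hG x 0
  have hc := Real.sin_sq_add_cos_sq (φ 0)
  have hcx := Real.sin_sq_add_cos_sq (φ x)
  have e1 : (u 0 * cos (φ 0) + v 0 * sin (φ 0)) / r 0 = 1 := by
    rw [div_eq_one_iff_eq (hrpos 0).ne']
    change u 0 = r 0 * _ at hu0
    change v 0 = r 0 * _ at hv0
    linear_combination cos (φ 0) * hu0 + sin (φ 0) * hv0 + r 0 * hc
  have e2 : (v 0 * cos (φ 0) - u 0 * sin (φ 0)) / r 0 = 0 := by
    rw [div_eq_zero_iff]
    left
    change u 0 = r 0 * _ at hu0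
    change v 0 = r 0 * _ at hv0
    linear_combination cos (φ 0) * hv0 - sin (φ 0) * hu0
  rw [e1, div_eq_one_iff_eq (hrpos x).ne'] at h1
  rw [e2, div_eq_zero_iff, or_iff_left (hrpos x).ne'] at h2
  constructor
  · linear_combination cos (φ x) * h1 - sin (φ x) * h2 - u x * hcx
  · linear_combination sin (φ x) * h1 + cos (φ x) * h2 - v x * hcx

/-- To leave the interval, `|δ|` would have to take the value `π/2`, where the cosine vanishes. This
turns a positive inner product of two rotating vectors into a bound between their angles. -/
lemma abs_lt_pi_div_two_of_cos_pos {δ : ℝ → ℝ} (hδ : Continuous δ) (hc : ∀ x, 0 < cos (δ x))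
    (h0 : |δ 0| < π / 2) (x : ℝ) : |δ x| < π / 2 := by
  by_contra! hx
  obtain ⟨y, hy⟩ : ∃ y, |δ y| = π / 2 :=
    mem_range_of_exists_le_of_exists_ge hδ.abs ⟨0, h0.le⟩ ⟨x, hx⟩
  have := hc y
  rw [← Real.cos_abs, hy, Real.cos_pi_div_two] at this
  exact lt_irrefl _ this

lemma neg_one_pow_mul_sin_pos {n : ℕ} {θ : ℝ} (h1 : n * (π / 2) < θ)
    (h2 : θ < (n + 1 : ℕ) * (π / 2)) : 0 < (-1) ^ n * sin (2 * θ) := by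
  rw [← Real.sin_sub_nat_mul_pi]
  push_cast at h2
  exact Real.sin_pos_of_pos_of_lt_pi (by linarith) (by linarith)

end Angle

/-! ### The rotating columns of the half-period transfer matrix. -/

/-- The half-period transfer matrix as a function of the energy, with the Gram matrix which governs
its derivative. -/
structure TransferCurve where
  (a b c d P R Q : ℝ → ℝ)
  det : ∀ E, a E * d E - b E * c E = 1
  deriv_a : ∀ E, HasDerivAt a (a E * R E - b E * P E) E
  deriv_b : ∀ E, HasDerivAt b (a E * Q E - b E * R E) E
  deriv_c : ∀ E, HasDerivAt c (c E * R E - d E * P E) E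
  deriv_d : ∀ E, HasDerivAt d (c E * Q E - d E * R E) E
  P_pos : ∀ E, 0 < P E
  Q_pos : ∀ E, 0 < Q E
  P_cont : Continuous P
  Q_cont : Continuous Q
  a_zero : a 0 = 1
  b_zero : 0 < b 0
  c_zero : c 0 = 0
  d_zero : d 0 = 1
  -- Equivalently `tτ < 0`, so `|A| > 1` and no band reaches a negative energy.
  neg_energy : ∀ E < 0, 0 < a E * b E * c E * d E

namespace TransferCurve

variable (D : TransferCurve)

lemma continuous_a : Continuous D.a := continuous_iff_continuousAt.2 fun E => (D.deriv_a E).continuousAt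
lemma continuous_b : Continuous D.b := continuous_iff_continuousAt.2 fun E => (D.deriv_b E).continuousAt
lemma continuous_c : Continuous D.c := continuous_iff_continuousAt.2 fun E => (D.deriv_c E).continuousAt
lemma continuous_d : Continuous D.d := continuous_iff_continuousAt.2 fun E => (D.deriv_d E).continuousAt

lemma ac_pos (E : ℝ) : 0 < D.a E ^ 2 + (-D.c E) ^ 2 := by
  have := D.det E
  by_contra! h
  have h1 : D.a E = 0 := by nlinarith [sq_nonneg (D.a E), sq_nonneg (D.c E)]
  have h2 : D.c E = 0 := by nlinarith [sq_nonneg (D.a E), sq_nonneg (D.c E)]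
  simp [h1, h2] at this

lemma db_pos (E : ℝ) : 0 < D.d E ^ 2 + D.b E ^ 2 := by
  have := D.det E
  by_contra! h
  have h1 : D.d E = 0 := by nlinarith [sq_nonneg (D.d E), sq_nonneg (D.b E)]
  have h2 : D.b E = 0 := by nlinarith [sq_nonneg (D.d E), sq_nonneg (D.b E)]
  simp [h1, h2] at this

/-- The angle of the column `(a, -c)`. -/
def α (E : ℝ) : ℝ := ∫ s in (0 : ℝ)..E, D.P s / (D.a s ^ 2 + (-D.c s) ^ 2)

/-- The angle of the column `(d, b)`. -/
def β (E : ℝ) : ℝ := arctan (D.b 0) + ∫ s in (0 : ℝ)..E, D.Q s / (D.d s ^ 2 + D.b s ^ 2)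

lemma hasDerivAt_α (E : ℝ) : HasDerivAt D.α (D.P E / (D.a E ^ 2 + (-D.c E) ^ 2)) E := by
  have hc : Continuous fun s => D.P s / (D.a s ^ 2 + (-D.c s) ^ 2) :=
    D.P_cont.div ((D.continuous_a.pow 2).add (D.continuous_c.neg.pow 2)) fun s => (D.ac_pos s).ne'
  exact intervalIntegral.integral_hasDerivAt_right (hc.intervalIntegrable _ _)
    hc.stronglyMeasurable.stronglyMeasurableAtFilter hc.continuousAt

lemma hasDerivAt_β (E : ℝ) : HasDerivAt D.β (D.Q E / (D.d E ^ 2 + D.b E ^ 2)) E := by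
  have hc : Continuous fun s => D.Q s / (D.d s ^ 2 + D.b s ^ 2) :=
    D.Q_cont.div ((D.continuous_d.pow 2).add (D.continuous_b.pow 2)) fun s => (D.db_pos s).ne'
  exact (intervalIntegral.integral_hasDerivAt_right (hc.intervalIntegrable _ _)
    hc.stronglyMeasurable.stronglyMeasurableAtFilter hc.continuousAt).const_add _

lemma continuous_α : Continuous D.α :=
  continuous_iff_continuousAt.2 fun E => (D.hasDerivAt_α E).continuousAt

lemma continuous_β : Continuous D.β :=
  continuous_iff_continuousAt.2 fun E => (D.hasDerivAt_β E).continuousAt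

lemma strictMono_α : StrictMono D.α := by
  refine strictMono_of_deriv_pos fun E => ?_
  rw [(D.hasDerivAt_α E).deriv]
  exact div_pos (D.P_pos E) (D.ac_pos E)

lemma strictMono_β : StrictMono D.β := by
  refine strictMono_of_deriv_pos fun E => ?_
  rw [(D.hasDerivAt_β E).deriv]
  exact div_pos (D.Q_pos E) (D.db_pos E)

lemma α_zero : D.α 0 = 0 := by simp [α]

lemma β_zero : D.β 0 = arctan (D.b 0) := by simp [β]

lemma β_zero_pos : 0 < D.β 0 := by rw [D.β_zero]; exact Real.arctan_pos.2 D.b_zero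

lemma β_zero_lt : D.β 0 < π / 2 := by rw [D.β_zero]; exact Real.arctan_lt_pi_div_two _

/-- The length of the column `(a, -c)`. -/
def r (E : ℝ) : ℝ := √(D.a E ^ 2 + (-D.c E) ^ 2)

/-- The length of the column `(d, b)`. -/
def ρ (E : ℝ) : ℝ := √(D.d E ^ 2 + D.b E ^ 2)

lemma r_pos (E : ℝ) : 0 < D.r E := Real.sqrt_pos.2 (D.ac_pos E)
lemma ρ_pos (E : ℝ) : 0 < D.ρ E := Real.sqrt_pos.2 (D.db_pos E)

lemma polar_ac (E : ℝ) : D.a E = D.r E * cos (D.α E) ∧ -D.c E = D.r E * sin (D.α E) := by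
  refine polar_of_hasDerivAt (s := ∅) (v := fun E => -D.c E) (v' := fun E => _)
    (u' := fun E => _) countable_empty
    D.continuous_a D.continuous_c.neg D.continuous_α D.ac_pos (fun E _ => D.deriv_a E)
    (fun E _ => (D.deriv_c E).neg) (fun E _ => (D.hasDerivAt_α E).congr_deriv ?_) ?_ ?_ E
  · congr 1
    -- The numerator of the angular velocity collapses to `P (ad - bc) = P`; the terms with `R`
    -- cancel.
    linear_combination (-D.P E) * D.det E
  · simp [D.a_zero, D.c_zero, D.α_zero]
  · simp [D.c_zero, D.α_zero]

lemma polar_db (E : ℝ) : D.d E = D.ρ E * cos (D.β E) ∧ D.b E = D.ρ E * sin (D.β E) := by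
  refine polar_of_hasDerivAt (s := ∅) (v' := fun E => _)
    (u' := fun E => _) countable_empty
    D.continuous_d D.continuous_b D.continuous_β D.db_pos (fun E _ => D.deriv_d E)
    (fun E _ => D.deriv_b E) (fun E _ => (D.hasDerivAt_β E).congr_deriv ?_) ?_ ?_ E
  · congr 1
    linear_combination (-D.Q E) * D.det E
  · have := Real.sqrt_pos.2 (by positivity : 0 < 1 + D.b 0 ^ 2)
    rw [D.β_zero, Real.cos_arctan, D.d_zero]
    simp only [one_pow]
    field_simp
  · have := Real.sqrt_pos.2 (by positivity : 0 < 1 + D.b 0 ^ 2)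
    rw [D.β_zero, Real.sin_arctan, D.d_zero]
    simp only [one_pow]
    field_simp

lemma a_eq (E : ℝ) : D.a E = D.r E * cos (D.α E) := (D.polar_ac E).1
lemma c_eq (E : ℝ) : D.c E = -(D.r E * sin (D.α E)) := by rw [← (D.polar_ac E).2, neg_neg]
lemma d_eq (E : ℝ) : D.d E = D.ρ E * cos (D.β E) := (D.polar_db E).1
lemma b_eq (E : ℝ) : D.b E = D.ρ E * sin (D.β E) := (D.polar_db E).2

lemma r_mul_ρ_mul_cos (E : ℝ) : D.r E * D.ρ E * cos (D.α E - D.β E) = 1 := by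
  rw [← D.det E, D.a_eq, D.b_eq, D.c_eq, D.d_eq, Real.cos_sub]
  ring

/-- The columns `(a, -c)` and `(d, b)` have inner product `ad - bc = 1`, so they never become
orthogonal; at `E = 0` the difference is `-arctan (b 0)`. -/
lemma abs_α_sub_β_lt (E : ℝ) : |D.α E - D.β E| < π / 2 := by
  refine abs_lt_pi_div_two_of_cos_pos (δ := fun E => D.α E - D.β E)
    (D.continuous_α.sub D.continuous_β) (fun E => ?_) ?_ E
  · have h1 := D.r_mul_ρ_mul_cos E
    exact pos_of_mul_pos_right (h1 ▸ one_pos)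
      (mul_pos (D.r_pos E) (D.ρ_pos E)).le
  · simp only [D.α_zero, zero_sub, abs_neg, abs_of_pos D.β_zero_pos]
    exact D.β_zero_lt

/-- Half the discriminant. -/
def A (E : ℝ) : ℝ := D.a E * D.d E + D.b E * D.c E

/-- `-ac`. -/
def t (E : ℝ) : ℝ := -(D.a E * D.c E)

/-- `bd`. -/
def τ (E : ℝ) : ℝ := D.b E * D.d E

lemma t_eq (E : ℝ) : D.t E = D.r E ^ 2 / 2 * sin (2 * D.α E) := by
  rw [t, D.a_eq, D.c_eq, Real.sin_two_mul]; ring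

lemma τ_eq (E : ℝ) : D.τ E = D.ρ E ^ 2 / 2 * sin (2 * D.β E) := by
  rw [τ, D.b_eq, D.d_eq, Real.sin_two_mul]; ring

lemma A_sq (E : ℝ) : D.A E ^ 2 = 1 - 4 * (D.t E * D.τ E) := by
  have := D.det E
  unfold A t τ
  linear_combination (D.a E * D.d E - D.b E * D.c E + 1) * this

lemma hasDerivAt_A (E : ℝ) : HasDerivAt D.A (-(2 * (D.t E * D.Q E + D.τ E * D.P E))) E :=
  (((D.deriv_a E).mul (D.deriv_d E)).add ((D.deriv_b E).mul (D.deriv_c E))).congr_deriv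
    (by unfold t τ; ring)

lemma continuous_A : Continuous D.A :=
  continuous_iff_continuousAt.2 fun E => (D.hasDerivAt_A E).continuousAt

lemma A_eq_cos (E : ℝ) : D.A E = D.r E * D.ρ E * cos (D.α E + D.β E) := by
  rw [A, D.a_eq, D.b_eq, D.c_eq, D.d_eq, Real.cos_add]
  ring

/-- At a multiple of `π/2` the sum and the difference of the angles have cosines equal up to the
sign `(-1)^n`, and the difference only sees the determinant. -/
lemma A_eq_of_α {E : ℝ} {n : ℕ} (h : D.α E = n * (π / 2)) : D.A E = (-1) ^ n := by
  have h1 : D.α E + D.β E = n * π - (D.α E - D.β E) := by rw [h]; ring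
  rw [D.A_eq_cos, h1, Real.cos_nat_mul_pi_sub, mul_left_comm, D.r_mul_ρ_mul_cos, mul_one]

lemma A_eq_of_β {E : ℝ} {n : ℕ} (h : D.β E = n * (π / 2)) : D.A E = (-1) ^ n := by
  have h1 : D.α E + D.β E = (D.α E - D.β E) + n * π := by rw [h]; ring
  rw [D.A_eq_cos, h1, Real.cos_add_nat_mul_pi, mul_left_comm, D.r_mul_ρ_mul_cos, mul_one]

lemma t_pos {E : ℝ} {n : ℕ} (h1 : n * (π / 2) < D.α E) (h2 : D.α E < (n + 1 : ℕ) * (π / 2)) :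
    0 < (-1) ^ n * D.t E := by
  rw [D.t_eq, mul_left_comm]
  have := D.r_pos E
  have := neg_one_pow_mul_sin_pos h1 h2
  positivity

lemma τ_pos {E : ℝ} {n : ℕ} (h1 : n * (π / 2) < D.β E) (h2 : D.β E < (n + 1 : ℕ) * (π / 2)) :
    0 < (-1) ^ n * D.τ E := by
  rw [D.τ_eq, mul_left_comm]
  have := D.ρ_pos E
  have := neg_one_pow_mul_sin_pos h1 h2
  positivity

/-- The smaller of the two angles. -/
def lowAngle (E : ℝ) : ℝ := min (D.α E) (D.β E)

/-- The larger of the two angles. -/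
def highAngle (E : ℝ) : ℝ := max (D.α E) (D.β E)

lemma strictMono_lowAngle : StrictMono D.lowAngle :=
  fun _ _ h => min_lt_min (D.strictMono_α h) (D.strictMono_β h)
lemma strictMono_highAngle : StrictMono D.highAngle :=
  fun _ _ h => max_lt_max (D.strictMono_α h) (D.strictMono_β h)
lemma continuous_lowAngle : Continuous D.lowAngle := D.continuous_α.min D.continuous_β
lemma continuous_highAngle : Continuous D.highAngle := D.continuous_α.max D.continuous_β

lemma lowAngle_le_highAngle (E : ℝ) : D.lowAngle E ≤ D.highAngle E := min_le_max

lemma highAngle_lt (E : ℝ) : D.highAngle E < D.lowAngle E + π / 2 := by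
  have := abs_lt.1 (D.abs_α_sub_β_lt E)
  unfold highAngle lowAngle
  rcases le_total (D.α E) (D.β E) with h | h
  · rw [max_eq_right h, min_eq_left h]; linarith
  · rw [max_eq_left h, min_eq_right h]; linarith

lemma lowAngle_zero : D.lowAngle 0 = 0 := by
  rw [lowAngle, D.α_zero, min_eq_left D.β_zero_pos.le]

lemma highAngle_zero : D.highAngle 0 = D.β 0 := by
  rw [highAngle, D.α_zero, max_eq_right D.β_zero_pos.le]

end TransferCurve

/-! ### Band edges and band functions from the two angles. -/

/-- A transfer curve whose columns rotate without bound. -/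
structure RotatingCurve extends TransferCurve where
  unbounded : ∀ K : ℝ, ∃ E, 0 ≤ E ∧ K ≤ toTransferCurve.α E

namespace RotatingCurve

variable (D : RotatingCurve)

lemma exists_lowAngle_eq (n : ℕ) : ∃ E, 0 ≤ E ∧ D.lowAngle E = n * (π / 2) := by
  -- The additional `π / 2` makes up for the smaller angle, which trails the larger one by less than
  -- that.
  obtain ⟨F, hF0, hF⟩ := D.unbounded (n * (π / 2) + π / 2)
  have h1 : n * (π / 2) ≤ D.lowAngle F := by
    have h2 := D.highAngle_lt F
    have h3 : D.α F ≤ D.highAngle F := le_max_left _ _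
    linarith
  have h0 : D.lowAngle 0 ≤ n * (π / 2) := by rw [D.lowAngle_zero]; positivity
  obtain ⟨E, hE, h⟩ := intermediate_value_Icc hF0 D.continuous_lowAngle.continuousOn ⟨h0, h1⟩
  exact ⟨E, hE.1, h⟩

lemma exists_highAngle_eq (n : ℕ) : ∃ E, 0 ≤ E ∧ D.highAngle E = (n + 1 : ℕ) * (π / 2) := by
  obtain ⟨F, hF0, hF⟩ := D.unbounded ((n + 1 : ℕ) * (π / 2))
  have h1 : (n + 1 : ℕ) * (π / 2) ≤ D.highAngle F := hF.trans (le_max_left _ _)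
  have h0 : D.highAngle 0 ≤ (n + 1 : ℕ) * (π / 2) := by
    rw [D.highAngle_zero]
    push_cast
    have := D.β_zero_lt
    have : 0 ≤ (n : ℝ) * (π / 2) := by positivity
    linarith
  obtain ⟨E, hE, h⟩ := intermediate_value_Icc hF0 D.continuous_highAngle.continuousOn ⟨h0, h1⟩
  exact ⟨E, hE.1, h⟩

/-- The lower edge of the band with index `n`, counted from `0`. -/
def bot (n : ℕ) : ℝ := (D.exists_lowAngle_eq n).choose

/-- The upper edge of the band with index `n`, counted from `0`. -/
def top (n : ℕ) : ℝ := (D.exists_highAngle_eq n).choose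

lemma lowAngle_bot (n : ℕ) : D.lowAngle (D.bot n) = n * (π / 2) :=
  (D.exists_lowAngle_eq n).choose_spec.2
lemma highAngle_top (n : ℕ) : D.highAngle (D.top n) = (n + 1 : ℕ) * (π / 2) :=
  (D.exists_highAngle_eq n).choose_spec.2

lemma bot_zero : D.bot 0 = 0 :=
  D.strictMono_lowAngle.injective (by rw [D.lowAngle_bot, D.lowAngle_zero]; simp)

lemma bot_le_iff {n : ℕ} {E : ℝ} : D.bot n ≤ E ↔ n * (π / 2) ≤ D.lowAngle E := by
  rw [← D.lowAngle_bot, D.strictMono_lowAngle.le_iff_le]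

lemma le_top_iff {n : ℕ} {E : ℝ} : E ≤ D.top n ↔ D.highAngle E ≤ (n + 1 : ℕ) * (π / 2) := by
  rw [← D.highAngle_top, D.strictMono_highAngle.le_iff_le]

lemma bot_lt_iff {n : ℕ} {E : ℝ} : D.bot n < E ↔ n * (π / 2) < D.lowAngle E := by
  rw [← D.lowAngle_bot, D.strictMono_lowAngle.lt_iff_lt]

lemma lt_top_iff {n : ℕ} {E : ℝ} : E < D.top n ↔ D.highAngle E < (n + 1 : ℕ) * (π / 2) := by
  rw [← D.highAngle_top, D.strictMono_highAngle.lt_iff_lt]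

lemma bot_lt_top (n : ℕ) : D.bot n < D.top n := by
  rw [D.lt_top_iff]
  have := D.highAngle_lt (D.bot n)
  rw [D.lowAngle_bot] at this
  push_cast
  linarith

lemma top_le_bot_succ (n : ℕ) : D.top n ≤ D.bot (n + 1) := by
  rw [← D.strictMono_lowAngle.le_iff_le, D.lowAngle_bot, ← D.highAngle_top]
  exact D.lowAngle_le_highAngle _

lemma bot_strictMono : StrictMono D.bot :=
  strictMono_nat_of_lt_succ fun n => (D.bot_lt_top n).trans_le (D.top_le_bot_succ n)

lemma top_strictMono : StrictMono D.top :=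
  strictMono_nat_of_lt_succ fun n => (D.top_le_bot_succ n).trans_lt (D.bot_lt_top (n + 1))

lemma top_le_bot {m n : ℕ} (h : m < n) : D.top m ≤ D.bot n :=
  (D.top_le_bot_succ m).trans (D.bot_strictMono.monotone h)

lemma angle_bot (n : ℕ) : D.α (D.bot n) = n * (π / 2) ∨ D.β (D.bot n) = n * (π / 2) := by
  have := D.lowAngle_bot n
  unfold TransferCurve.lowAngle at this
  rcases min_choice (D.α (D.bot n)) (D.β (D.bot n)) with h | h <;> rw [h] at this
  · exact Or.inl this
  · exact Or.inr this

lemma angle_top (n : ℕ) :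
    D.α (D.top n) = (n + 1 : ℕ) * (π / 2) ∨ D.β (D.top n) = (n + 1 : ℕ) * (π / 2) := by
  have := D.highAngle_top n
  unfold TransferCurve.highAngle at this
  rcases max_choice (D.α (D.top n)) (D.β (D.top n)) with h | h <;> rw [h] at this
  · exact Or.inl this
  · exact Or.inr this

lemma A_bot (n : ℕ) : D.A (D.bot n) = (-1) ^ n :=
  (D.angle_bot n).elim D.A_eq_of_α D.A_eq_of_β

lemma A_top (n : ℕ) : D.A (D.top n) = (-1) ^ (n + 1) :=
  (D.angle_top n).elim D.A_eq_of_α D.A_eq_of_β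

lemma t_pos {n : ℕ} {E : ℝ} (h : E ∈ Ioo (D.bot n) (D.top n)) : 0 < (-1) ^ n * D.t E :=
  D.toTransferCurve.t_pos ((D.bot_lt_iff.1 h.1).trans_le (min_le_left _ _))
    ((le_max_left _ _).trans_lt (D.lt_top_iff.1 h.2))

lemma τ_pos {n : ℕ} {E : ℝ} (h : E ∈ Ioo (D.bot n) (D.top n)) : 0 < (-1) ^ n * D.τ E :=
  D.toTransferCurve.τ_pos ((D.bot_lt_iff.1 h.1).trans_le (min_le_right _ _))
    ((le_max_right _ _).trans_lt (D.lt_top_iff.1 h.2))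

/-- Inside the band both angles lie in the same quadrant, so `t` and `τ` have the sign `(-1)^n` and
`A' = -2(tQ + τP)` cannot change sign. -/
lemma strictAntiOn_A (n : ℕ) :
    StrictAntiOn (fun E => (-1) ^ n * D.A E) (Icc (D.bot n) (D.top n)) := by
  refine strictAntiOn_of_deriv_neg (convex_Icc _ _)
    (continuous_const.mul D.continuous_A).continuousOn fun E hE => ?_
  rw [interior_Icc] at hE
  rw [((D.hasDerivAt_A E).const_mul _).deriv]
  have h1 := D.t_pos hE
  have h2 := D.τ_pos hE
  have h3 := D.P_pos E
  have h4 := D.Q_pos E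
  have : 0 < ((-1) ^ n * D.t E) * D.Q E + ((-1) ^ n * D.τ E) * D.P E := by positivity
  linarith

/-- Outside the bands one angle has passed a multiple of `π/2` and the other has not. The angles are
then in adjacent quadrants, `tτ < 0`, and `A² = 1 - 4tτ` exceeds 1. -/
lemma mem_band_of_abs_A_le {E : ℝ} (h : |D.A E| ≤ 1) : ∃ n, E ∈ Icc (D.bot n) (D.top n) := by
  have hsq : 0 ≤ D.t E * D.τ E := by
    have h1 := D.A_sq E
    have h2 : D.A E ^ 2 ≤ 1 := (sq_le_one_iff_abs_le_one _).2 h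
    linarith
  have hE : 0 ≤ E := by
    by_contra! hneg
    have := D.neg_energy E hneg
    unfold TransferCurve.t TransferCurve.τ at hsq
    linarith
  have hl : 0 ≤ D.lowAngle E := by
    rw [← D.lowAngle_zero]
    exact D.strictMono_lowAngle.monotone hE
  have hpi : 0 < π / 2 := by positivity
  set n := ⌊D.lowAngle E / (π / 2)⌋₊ with hn
  have h1 : n * (π / 2) ≤ D.lowAngle E := by
    rw [← le_div_iff₀ hpi]
    exact Nat.floor_le (by positivity)
  have h2 : D.lowAngle E < (n + 1 : ℕ) * (π / 2) := by
    rw [← div_lt_iff₀ hpi]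
    push_cast
    exact Nat.lt_floor_add_one _
  refine ⟨n, D.bot_le_iff.2 h1, D.le_top_iff.2 ?_⟩
  by_contra! h3
  have h4 := D.highAngle_lt E
  have h5 : n * (π / 2) < D.lowAngle E := by push_cast at h3; linarith
  have h6 : D.highAngle E < (n + 1 + 1 : ℕ) * (π / 2) := by push_cast at h2 ⊢; linarith
  -- The smaller angle is strictly inside quadrant `n` and the larger one strictly inside quadrant
  -- `n + 1`, whichever of `α`, `β` is the smaller.
  have key : (0 : ℝ) < ((-1) ^ n * (-1) ^ (n + 1)) * (D.t E * D.τ E) := by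
    unfold TransferCurve.lowAngle at h2 h5
    unfold TransferCurve.highAngle at h3 h6
    rcases le_total (D.α E) (D.β E) with hab | hab
    · rw [min_eq_left hab] at h2 h5
      rw [max_eq_right hab] at h3 h6
      have := mul_pos (D.toTransferCurve.t_pos h5 h2) (D.toTransferCurve.τ_pos h3 h6)
      linarith
    · rw [min_eq_right hab] at h2 h5
      rw [max_eq_left hab] at h3 h6
      have := mul_pos (D.toTransferCurve.t_pos h3 h6) (D.toTransferCurve.τ_pos h5 h2)
      linarith
  have hs : ((-1 : ℝ) ^ n * (-1) ^ (n + 1)) = -1 := by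
    rw [← pow_add, show n + (n + 1) = 2 * n + 1 by ring]
    simp [pow_succ, pow_mul]
  rw [hs] at key
  linarith

lemma exists_energy (n : ℕ) (k : ℝ) : ∃ E ∈ Icc (D.bot n) (D.top n), D.A E = cos k := by
  have h1 := Real.neg_one_le_cos k
  have h2 := Real.cos_le_one k
  have hcs : cos k ∈ uIcc (D.A (D.bot n)) (D.A (D.top n)) := by
    rw [D.A_bot, D.A_top, mem_uIcc, pow_succ]
    rcases neg_one_pow_eq_or ℝ n with h | h <;> rw [h]
    · right; constructor <;> linarith
    · left; constructor <;> linarith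
  have := intermediate_value_uIcc D.continuous_A.continuousOn hcs
  rwa [uIcc_of_le (D.bot_lt_top n).le] at this

/-- The band function with index `n`, counted from `0`. -/
def energy (n : ℕ) (k : ℝ) : ℝ := (D.exists_energy n k).choose

lemma energy_mem (n : ℕ) (k : ℝ) : D.energy n k ∈ Icc (D.bot n) (D.top n) :=
  (D.exists_energy n k).choose_spec.1

lemma A_energy (n : ℕ) (k : ℝ) : D.A (D.energy n k) = cos k :=
  (D.exists_energy n k).choose_spec.2

lemma energy_eq {n : ℕ} {k E : ℝ} (hE : E ∈ Icc (D.bot n) (D.top n)) (h : D.A E = cos k) :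
    D.energy n k = E :=
  (D.strictAntiOn_A n).injOn (D.energy_mem n k) hE (by simp only [h, D.A_energy])

lemma exists_eq_energy {k E : ℝ} (h : D.A E = cos k) : ∃ n, E = D.energy n k := by
  obtain ⟨n, hn⟩ := D.mem_band_of_abs_A_le (E := E) (by rw [h]; exact Real.abs_cos_le_one k)
  exact ⟨n, (D.energy_eq hn h).symm⟩

lemma energy_mono (k : ℝ) : Monotone fun n => D.energy n k :=
  monotone_nat_of_le_succ fun n => ((D.energy_mem n k).2.trans (D.top_le_bot_succ n)).trans
    (D.energy_mem (n + 1) k).1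

lemma energy_eq_bot {n : ℕ} {k : ℝ} (h : cos k = (-1) ^ n) : D.energy n k = D.bot n :=
  D.energy_eq ⟨le_rfl, (D.bot_lt_top n).le⟩ (by rw [D.A_bot, h])

lemma energy_eq_top {n : ℕ} {k : ℝ} (h : cos k = (-1) ^ (n + 1)) : D.energy n k = D.top n :=
  D.energy_eq ⟨(D.bot_lt_top n).le, le_rfl⟩ (by rw [D.A_top, h])

lemma energy_mem_Ioo {n : ℕ} {k : ℝ} (hk : |cos k| < 1) :
    D.energy n k ∈ Ioo (D.bot n) (D.top n) := by
  have h := D.energy_mem n k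
  refine ⟨lt_of_le_of_ne h.1 fun he => ?_, lt_of_le_of_ne h.2 fun he => ?_⟩
  · rw [← D.A_energy n k, ← he, D.A_bot] at hk
    simp at hk
  · rw [← D.A_energy n k, he, D.A_top] at hk
    simp at hk

/-- `A` is injective on the compact band, hence an embedding there, and the band function is its
inverse composed with the cosine. -/
lemma continuous_energy (n : ℕ) : Continuous (D.energy n) := by
  have hinj : InjOn (fun E => (-1) ^ n * D.A E) (Icc (D.bot n) (D.top n)) :=
    (D.strictAntiOn_A n).injOn
  let F : Icc (D.bot n) (D.top n) → ℝ := fun E => D.A E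
  have hF : IsEmbedding F := by
    refine (Continuous.isClosedEmbedding (D.continuous_A.comp continuous_subtype_val) ?_).isEmbedding
    intro x y hxy
    exact Subtype.ext (hinj x.2 y.2 (by simpa [F] using hxy))
  have h1 : Continuous fun k => (⟨D.energy n k, D.energy_mem n k⟩ : Icc (D.bot n) (D.top n)) := by
    rw [hF.continuous_iff]
    have : (F ∘ fun k => (⟨D.energy n k, D.energy_mem n k⟩ : Icc (D.bot n) (D.top n))) = cos :=
      funext fun k => D.A_energy n k
    rw [this]
    exact Real.continuous_cos
  exact continuous_subtype_val.comp h1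

/-- The derivative of `A` does not vanish inside a band. -/
lemma deriv_A_ne_zero {n : ℕ} {E : ℝ} (hE : E ∈ Ioo (D.bot n) (D.top n)) :
    -(2 * (D.t E * D.Q E + D.τ E * D.P E)) ≠ 0 := by
  have h1 := D.t_pos hE
  have h2 := D.τ_pos hE
  have h3 := D.P_pos E
  have h4 := D.Q_pos E
  have : 0 < ((-1) ^ n * D.t E) * D.Q E + ((-1) ^ n * D.τ E) * D.P E := by positivity
  intro h
  have h5 : D.t E * D.Q E + D.τ E * D.P E = 0 := by linarith
  have h6 : (-1) ^ n * (D.t E * D.Q E + D.τ E * D.P E) = 0 := by rw [h5, mul_zero]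
  linarith

lemma differentiableAt_energy (n : ℕ) {k : ℝ} (hk : |cos k| < 1) :
    DifferentiableAt ℝ (D.energy n) k := by
  have hE := D.energy_mem_Ioo (n := n) hk
  have h1 := D.hasDerivAt_A (D.energy n k)
  have hc := D.continuous_energy n
  -- the quotient of increments of `cos` and of `A`
  have hs := (hasDerivAt_iff_tendsto_slope.1 (Real.hasDerivAt_cos k))
  refine HasDerivAt.differentiableAt
    (f' := -sin k / -(2 * (D.t (D.energy n k) * D.Q (D.energy n k) +
      D.τ (D.energy n k) * D.P (D.energy n k)))) ?_
  have h2 : Tendsto (fun k' => dslope D.A (D.energy n k) (D.energy n k')) (𝓝 k)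
      (𝓝 (-(2 * (D.t (D.energy n k) * D.Q (D.energy n k) +
      D.τ (D.energy n k) * D.P (D.energy n k))))) := by
    have := (continuousAt_dslope_same.2 h1.differentiableAt).tendsto.comp hc.continuousAt.tendsto
    rwa [dslope_same, h1.deriv] at this
  rw [hasDerivAt_iff_tendsto_slope]
  refine (hs.div (h2.mono_left nhdsWithin_le_nhds) (D.deriv_A_ne_zero hE)).congr' ?_
  filter_upwards [(h2.mono_left nhdsWithin_le_nhds).eventually_ne (D.deriv_A_ne_zero hE),
    self_mem_nhdsWithin] with k' h3 h4
  have h5 : (D.energy n k' - D.energy n k) * dslope D.A (D.energy n k) (D.energy n k') =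
      cos k' - cos k := by
    have := sub_smul_dslope D.A (D.energy n k) (D.energy n k')
    rw [smul_eq_mul, D.A_energy, D.A_energy] at this
    exact this
  rw [Pi.div_apply, slope_def_field, slope_def_field, ← h5]
  field_simp

/-! ### Degenerate edges -/

lemma α_eq_β_of_top_eq_bot {n : ℕ} (h : D.top n = D.bot (n + 1)) :
    D.α (D.top n) = (n + 1 : ℕ) * (π / 2) ∧ D.β (D.top n) = (n + 1 : ℕ) * (π / 2) := by
  have h1 := D.highAngle_top n
  have h2 := D.lowAngle_bot (n + 1)
  rw [← h] at h2
  have a1 : D.α (D.top n) ≤ D.highAngle (D.top n) := le_max_left _ _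
  have a2 : D.β (D.top n) ≤ D.highAngle (D.top n) := le_max_right _ _
  have a3 : D.lowAngle (D.top n) ≤ D.α (D.top n) := min_le_left _ _
  have a4 : D.lowAngle (D.top n) ≤ D.β (D.top n) := min_le_right _ _
  exact ⟨le_antisymm (a1.trans h1.le) (h2.ge.trans a3), le_antisymm (a2.trans h1.le) (h2.ge.trans a4)⟩

lemma t_eq_zero_iff {E : ℝ} : D.t E = 0 ↔ ∃ p : ℤ, D.α E = p * (π / 2) := by
  have := D.r_pos E
  rw [D.t_eq, mul_eq_zero, or_iff_right (by positivity), Real.sin_eq_zero_iff]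
  constructor <;> rintro ⟨p, hp⟩ <;> exact ⟨p, by linarith⟩

lemma τ_eq_zero_iff {E : ℝ} : D.τ E = 0 ↔ ∃ p : ℤ, D.β E = p * (π / 2) := by
  have := D.ρ_pos E
  rw [D.τ_eq, mul_eq_zero, or_iff_right (by positivity), Real.sin_eq_zero_iff]
  constructor <;> rintro ⟨p, hp⟩ <;> exact ⟨p, by linarith⟩

/-- Both off-diagonal entries of the monodromy vanish only where two bands touch. -/
lemma exists_touching {E : ℝ} (ht : D.t E = 0) (hτ : D.τ E = 0) :
    ∃ n, E = D.top n ∧ D.top n = D.bot (n + 1) := by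
  obtain ⟨p, hp⟩ := D.t_eq_zero_iff.1 ht
  obtain ⟨q, hq⟩ := D.τ_eq_zero_iff.1 hτ
  have hpi := Real.pi_pos
  have hE : 0 ≤ E := by
    by_contra! hneg
    have h1 := D.neg_energy E hneg
    have h2 : D.t E * D.τ E = 0 := by rw [ht, zero_mul]
    unfold TransferCurve.t TransferCurve.τ at h2
    linarith
  -- Multiples of `π/2` at distance less than `π/2` coincide.
  have hpq : p = q := by
    have h1 := D.abs_α_sub_β_lt E
    rw [hp, hq, ← sub_mul, abs_mul, abs_of_pos (by positivity : 0 < π / 2)] at h1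
    have h2 : |(p : ℝ) - q| < 1 := by
      by_contra! h3
      have : 1 * (π / 2) ≤ |(p : ℝ) - q| * (π / 2) := by gcongr
      linarith
    have h3 : |p - q| < 1 := by exact_mod_cast h2
    rw [Int.abs_lt_one_iff] at h3
    omega
  subst hpq
  have hβ : 0 < D.β E := D.β_zero_pos.trans_le (D.strictMono_β.monotone hE)
  have hp1 : 0 < p := by
    rw [hq] at hβ
    have := pos_of_mul_pos_left hβ (by positivity)
    exact_mod_cast this
  obtain ⟨n, rfl⟩ : ∃ n : ℕ, p = (n + 1 : ℕ) := ⟨(p - 1).toNat, by omega⟩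
  have e1 : D.highAngle E = (n + 1 : ℕ) * (π / 2) := by
    unfold TransferCurve.highAngle
    rw [hp, hq, max_self]
    norm_cast
  have e2 : D.lowAngle E = (n + 1 : ℕ) * (π / 2) := by
    unfold TransferCurve.lowAngle
    rw [hp, hq, min_self]
    norm_cast
  have f1 : E = D.top n := D.strictMono_highAngle.injective (by rw [e1, D.highAngle_top])
  have f2 : E = D.bot (n + 1) := D.strictMono_lowAngle.injective (by rw [e2, D.lowAngle_bot])
  exact ⟨n, f1, f1 ▸ f2⟩

lemma t_top_of_touching {n : ℕ} (h : D.top n = D.bot (n + 1)) : D.t (D.top n) = 0 :=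
  D.t_eq_zero_iff.2 ⟨(n + 1 : ℕ), by rw [(D.α_eq_β_of_top_eq_bot h).1]; norm_cast⟩

lemma τ_top_of_touching {n : ℕ} (h : D.top n = D.bot (n + 1)) : D.τ (D.top n) = 0 :=
  D.τ_eq_zero_iff.2 ⟨(n + 1 : ℕ), by rw [(D.α_eq_β_of_top_eq_bot h).2]; norm_cast⟩

/-- The two edges of an open gap are of opposite types. -/
lemma gap_types {n : ℕ} (h : D.top n ≠ D.bot (n + 1)) :
    (D.t (D.top n) = 0 ∧ D.τ (D.top n) ≠ 0 ∧ D.τ (D.bot (n + 1)) = 0 ∧ D.t (D.bot (n + 1)) ≠ 0) ∨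
    (D.τ (D.top n) = 0 ∧ D.t (D.top n) ≠ 0 ∧ D.t (D.bot (n + 1)) = 0 ∧ D.τ (D.bot (n + 1)) ≠ 0) := by
  have key : ∀ E, (E = D.top n ∨ E = D.bot (n + 1)) → ¬ (D.t E = 0 ∧ D.τ E = 0) := by
    rintro E hE ⟨ht, hτ⟩
    obtain ⟨m, hm1, hm2⟩ := D.exists_touching ht hτ
    apply h
    rcases hE with rfl | rfl
    · rw [D.top_strictMono.injective hm1, hm2]
    · rw [hm2] at hm1
      have := D.bot_strictMono.injective hm1
      obtain rfl : n = m := by omega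
      exact hm2
  have kt := key _ (Or.inl rfl)
  have kb := key _ (Or.inr rfl)
  have tα : ∀ {E} {m : ℕ}, D.α E = m * (π / 2) → D.t E = 0 := fun {E m} hh =>
    D.t_eq_zero_iff.2 ⟨m, by rw [hh]; norm_cast⟩
  have τβ : ∀ {E} {m : ℕ}, D.β E = m * (π / 2) → D.τ E = 0 := fun {E m} hh =>
    D.τ_eq_zero_iff.2 ⟨m, by rw [hh]; norm_cast⟩
  rcases D.angle_top n with h1 | h1 <;> rcases D.angle_bot (n + 1) with h2 | h2
  -- A strictly increasing angle takes the value `(n+1)π/2` only once, so in an open gap one edge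
  -- belongs to `α` and the other to `β`.
  · exact absurd (D.strictMono_α.injective (h1.trans h2.symm)) h
  · exact Or.inl ⟨tα h1, fun h0 => kt ⟨tα h1, h0⟩, τβ h2, fun h0 => kb ⟨h0, τβ h2⟩⟩
  · exact Or.inr ⟨τβ h1, fun h0 => kt ⟨h0, τβ h1⟩, tα h2, fun h0 => kb ⟨tα h2, h0⟩⟩
  · exact absurd (D.strictMono_β.injective (h1.trans h2.symm)) h

/-- The lowest edge is the energy 0, where the mode is constant and hence even. This starts the
telescoping product of edge signs. -/
lemma t_bot_zero : D.t (D.bot 0) = 0 := by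
  rw [D.bot_zero, TransferCurve.t, D.c_zero]; simp

end RotatingCurve

/-! ### The transfer matrix of an even medium. -/

lemma IsCoefficient.integral_mul_sq_pos {f u : ℝ → ℝ} (hf : IsCoefficient f) (hu : Continuous u)
    {a b : ℝ} (hab : a < b) (h : ∃ x ∈ Ioo a b, u x ≠ 0) : 0 < ∫ t in a..b, f t * (u t * u t) := by
  obtain ⟨x, hx, hux⟩ := h
  rw [intervalIntegral.integral_pos_iff_support_of_nonneg_ae
    (Eventually.of_forall fun t => mul_nonneg (hf.pos t).le (mul_self_nonneg _))
    (hf.intervalIntegrable_mul (hu.mul hu) a b)]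
  refine ⟨hab, ?_⟩
  have ho : IsOpen ({t | u t ≠ 0} ∩ Ioo a b) :=
    (isOpen_ne_fun hu continuous_const).inter isOpen_Ioo
  refine (ho.measure_pos volume ⟨x, hux, hx⟩).trans_le (measure_mono ?_)
  rintro t ⟨ht, htab⟩
  refine ⟨?_, Ioo_subset_Ioc_self htab⟩
  exact mul_ne_zero (hf.pos t).ne' (mul_ne_zero ht ht)

namespace IsEvenMedium

variable {ε μ : ℝ → ℝ}

/-- If `ψ` vanished on an interval, then at a continuity point of `μ` inside it `μ q = ψ' = 0`, so
solution and flux would vanish together. -/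
lemma exists_ne_zero_of_solution (h : IsEvenMedium ε μ) {E : ℝ} {ψ q : ℝ → ℝ}
    (hψ : IsRealSolution ε μ E ψ q) (h0 : ∀ x, ψ x ≠ 0 ∨ q x ≠ 0) {a b : ℝ} (hab : a < b) :
    ∃ x ∈ Ioo a b, ψ x ≠ 0 := by
  by_contra! hc
  obtain ⟨x, hx, hμ⟩ := h.μ_coef.exists_continuousAt hab
  have h1 := hψ.deriv_sol x hμ
  have h2 : HasDerivAt ψ 0 x := (hasDerivAt_const x (0 : ℝ)).congr_of_eventuallyEq (by
    filter_upwards [Ioo_mem_nhds hx.1 hx.2] with y hy using hc y hy)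
  have h3 := h1.unique h2
  rcases h0 x with h4 | h4
  · exact h4 (hc x hx)
  · exact mul_ne_zero (h.μ_coef.pos x).ne' h4 h3

lemma ne_zero₁ (h : IsEvenMedium ε μ) (E x : ℝ) : sol₁ ε μ E x ≠ 0 ∨ flux₁ ε μ E x ≠ 0 := by
  by_contra! hc
  have := h.det_eq_one E x
  simp [hc.1, hc.2] at this

lemma ne_zero₂ (h : IsEvenMedium ε μ) (E x : ℝ) : sol₂ ε μ E x ≠ 0 ∨ flux₂ ε μ E x ≠ 0 := by
  by_contra! hc
  have := h.det_eq_one E x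
  simp [hc.1, hc.2] at this

lemma cross₁₁_pos (h : IsEvenMedium ε μ) (E : ℝ) {x : ℝ} (hx : 0 < x) :
    0 < cross₁₁ ε μ E E x :=
  h.ε_coef.integral_mul_sq_pos (h.isRealSolution₁ E).continuous_sol hx
    (h.exists_ne_zero_of_solution (h.isRealSolution₁ E) (h.ne_zero₁ E) hx)

lemma cross₂₂_pos (h : IsEvenMedium ε μ) (E : ℝ) {x : ℝ} (hx : 0 < x) :
    0 < cross₂₂ ε μ E E x :=
  h.ε_coef.integral_mul_sq_pos (h.isRealSolution₂ E).continuous_sol hx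
    (h.exists_ne_zero_of_solution (h.isRealSolution₂ E) (h.ne_zero₂ E) hx)

/-- The energy identity `ψ q = ∫ μ q² - E ∫ ε ψ²`. -/
lemma mul_flux_eq (h : IsEvenMedium ε μ) {E : ℝ} {ψ q : ℝ → ℝ}
    (hψ : IsRealSolution ε μ E ψ q) (x : ℝ) :
    ψ x * q x = ψ 0 * q 0 + ((∫ t in (0 : ℝ)..x, μ t * (q t * q t)) -
      E * ∫ t in (0 : ℝ)..x, ε t * (ψ t * ψ t)) := by
  have h1 := hψ.continuous_sol
  have h2 := hψ.continuous_flux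
  have i1 := h.μ_coef.intervalIntegrable_mul (g := fun t => q t * q t) (h2.mul h2) 0 x
  have i2 := (h.ε_coef.intervalIntegrable_mul (g := fun t => ψ t * ψ t) (h1.mul h1) 0 x).const_mul E
  have := integral_eq_of_hasDerivAt_off_countable (fun t => ψ t * q t)
    (fun t => μ t * (q t * q t) - E * (ε t * (ψ t * ψ t))) h.countable_disc (a := 0) (b := x)
    (by fun_prop) (fun t ht => ?_) (i1.sub i2)
  · rw [intervalIntegral.integral_sub i1 i2, intervalIntegral.integral_const_mul] at this
    linarith
  · have hm : ContinuousAt μ t := by by_contra hc; exact ht.2 (Or.inl hc)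
    have he : ContinuousAt ε t := by by_contra hc; exact ht.2 (Or.inr hc)
    exact ((hψ.deriv_sol t hm).mul (hψ.deriv_flux t he)).congr_deriv (by ring)

lemma mul_flux_pos (h : IsEvenMedium ε μ) {E : ℝ} (hE : E < 0) {ψ q : ℝ → ℝ}
    (hψ : IsRealSolution ε μ E ψ q) (h0 : ∀ x, ψ x ≠ 0 ∨ q x ≠ 0) (hi : ψ 0 * q 0 = 0)
    {x : ℝ} (hx : 0 < x) : 0 < ψ x * q x := by
  rw [h.mul_flux_eq hψ x, hi]
  have h1 : 0 ≤ ∫ t in (0 : ℝ)..x, μ t * (q t * q t) :=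
    intervalIntegral.integral_nonneg hx.le fun t _ =>
      mul_nonneg (h.μ_coef.pos t).le (mul_self_nonneg _)
  have h2 := h.ε_coef.integral_mul_sq_pos hψ.continuous_sol hx
    (h.exists_ne_zero_of_solution hψ h0 hx)
  have h3 := mul_pos_of_neg_of_neg hE (neg_lt_zero.2 h2)
  linarith

/-- The half-period transfer matrix of the medium. -/
def transferCurve (h : IsEvenMedium ε μ) : TransferCurve where
  a E := sol₁ ε μ E (1 / 2)
  b E := sol₂ ε μ E (1 / 2)
  c E := flux₁ ε μ E (1 / 2)
  d E := flux₂ ε μ E (1 / 2)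
  P E := cross₁₁ ε μ E E (1 / 2)
  R E := cross₁₂ ε μ E E (1 / 2)
  Q E := cross₂₂ ε μ E E (1 / 2)
  det E := by
    have := h.det_eq_one E (1 / 2)
    linear_combination this
  deriv_a E := h.hasDerivAt_sol₁ E (1 / 2)
  deriv_b E := h.hasDerivAt_sol₂ E (1 / 2)
  deriv_c E := h.hasDerivAt_flux₁ E (1 / 2)
  deriv_d E := h.hasDerivAt_flux₂ E (1 / 2)
  P_pos E := h.cross₁₁_pos E (by norm_num)
  Q_pos E := h.cross₂₂_pos E (by norm_num)
  P_cont := h.continuous_cross₁₁_diag.comp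
    (by fun_prop : Continuous fun E : ℝ => (E, (1 / 2 : ℝ)))
  Q_cont := h.continuous_cross₂₂_diag.comp
    (by fun_prop : Continuous fun E : ℝ => (E, (1 / 2 : ℝ)))
  a_zero := by simp [sol₁, cosSeries_eq h.μ_coef h.ε_coef]
  b_zero := by
    have h1 : ∀ t, cosSeries ε μ 0 t = 1 := fun t => by simp [cosSeries_eq h.ε_coef h.μ_coef]
    simp only [sol₂, sinSeries_eq h.μ_coef h.ε_coef, h1, mul_one]
    exact intervalIntegral.intervalIntegral_pos_of_pos (h.μ_coef.intervalIntegrable _ _)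
      h.μ_coef.pos (by norm_num)
  c_zero := by simp [flux₁]
  d_zero := by simp [flux₂, cosSeries_eq h.ε_coef h.μ_coef]
  neg_energy E hE := by
    have h1 := h.mul_flux_pos hE (h.isRealSolution₁ E) (h.ne_zero₁ E)
      (by simp [h.flux₁_zero]) (x := 1 / 2) (by norm_num)
    have h2 := h.mul_flux_pos hE (h.isRealSolution₂ E) (h.ne_zero₂ E)
      (by simp [h.sol₂_zero]) (x := 1 / 2) (by norm_num)
    have := mul_pos h1 h2
    linarith

/-! ### Unbounded rotation through a modified Prüfer angle. -/

section Prufer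

/-- The scale of the modified Prüfer angle. -/
def pruferScale (E : ℝ) : ℝ := √(1 + |E|)

lemma pruferScale_pos (E : ℝ) : 0 < pruferScale E := Real.sqrt_pos.2 (by positivity)

lemma pruferScale_sq (E : ℝ) : pruferScale E ^ 2 = 1 + |E| := Real.sq_sqrt (by positivity)

lemma continuous_pruferScale : Continuous pruferScale := by unfold pruferScale; fun_prop

lemma prufer_pos (h : IsEvenMedium ε μ) (E x : ℝ) :
    0 < (pruferScale E * sol₁ ε μ E x) ^ 2 + (-flux₁ ε μ E x) ^ 2 := by
  have := pruferScale_pos E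
  rcases h.ne_zero₁ E x with h1 | h1
  · positivity
  · have := neg_ne_zero.2 h1
    positivity

variable (ε μ) in
/-- The factor of `ε` in the derivative of the modified Prüfer angle. -/
def pruferPot (E x : ℝ) : ℝ := pruferScale E * E * sol₁ ε μ E x ^ 2 /
  ((pruferScale E * sol₁ ε μ E x) ^ 2 + (-flux₁ ε μ E x) ^ 2)

variable (ε μ) in
/-- The factor of `μ` in the derivative of the modified Prüfer angle. -/
def pruferKin (E x : ℝ) : ℝ := pruferScale E * flux₁ ε μ E x ^ 2 /
  ((pruferScale E * sol₁ ε μ E x) ^ 2 + (-flux₁ ε μ E x) ^ 2)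

variable (ε μ) in
/-- The modified Prüfer angle of the first solution. -/
def prufer (E x : ℝ) : ℝ := (∫ t in (0 : ℝ)..x, ε t * pruferPot ε μ E t) +
  ∫ t in (0 : ℝ)..x, μ t * pruferKin ε μ E t

lemma continuous_prufer_denom (h : IsEvenMedium ε μ) : Continuous fun p : ℝ × ℝ =>
    (pruferScale p.1 * sol₁ ε μ p.1 p.2) ^ 2 + (-flux₁ ε μ p.1 p.2) ^ 2 :=
  (((continuous_pruferScale.comp continuous_fst).mul h.continuous_sol₁).pow 2).add
    (h.continuous_flux₁.neg.pow 2)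

lemma continuous_pruferPot (h : IsEvenMedium ε μ) :
    Continuous fun p : ℝ × ℝ => pruferPot ε μ p.1 p.2 :=
  (((continuous_pruferScale.comp continuous_fst).mul continuous_fst).mul
    (h.continuous_sol₁.pow 2)).div h.continuous_prufer_denom fun p => (h.prufer_pos p.1 p.2).ne'

lemma continuous_pruferKin (h : IsEvenMedium ε μ) :
    Continuous fun p : ℝ × ℝ => pruferKin ε μ p.1 p.2 :=
  ((continuous_pruferScale.comp continuous_fst).mul
    (h.continuous_flux₁.pow 2)).div h.continuous_prufer_denom fun p => (h.prufer_pos p.1 p.2).ne'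

lemma prufer_polar (h : IsEvenMedium ε μ) (E x : ℝ) :
    pruferScale E * sol₁ ε μ E x = √((pruferScale E * sol₁ ε μ E x) ^ 2 + (-flux₁ ε μ E x) ^ 2) *
      cos (prufer ε μ E x) ∧
    -flux₁ ε μ E x = √((pruferScale E * sol₁ ε μ E x) ^ 2 + (-flux₁ ε μ E x) ^ 2) *
      sin (prufer ε μ E x) := by
  have hs := h.isRealSolution₁ E
  have c1 := h.continuous_pruferPot.comp (Continuous.prodMk_right E)
  have c2 := h.continuous_pruferKin.comp (Continuous.prodMk_right E)
  refine polar_of_hasDerivAt (u := fun x => pruferScale E * sol₁ ε μ E x)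
    (v := fun x => -flux₁ ε μ E x) (u' := fun x => pruferScale E * (μ x * flux₁ ε μ E x))
    (v' := fun x => E * ε x * sol₁ ε μ E x) (φ := prufer ε μ E)
    h.countable_disc (continuous_const.mul hs.continuous_sol)
    hs.continuous_flux.neg ((h.ε_coef.continuous_integral c1).add (h.μ_coef.continuous_integral c2))
    (h.prufer_pos E) (fun x hx => ?_) (fun x hx => ?_) (fun x hx => ?_) ?_ ?_ x
  · have hm : ContinuousAt μ x := by by_contra hc; exact hx (Or.inl hc)
    exact (hs.deriv_sol x hm).const_mul _
  · have he : ContinuousAt ε x := by by_contra hc; exact hx (Or.inr hc)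
    exact (hs.deriv_flux x he).neg.congr_deriv (by ring)
  · have hm : ContinuousAt μ x := by by_contra hc; exact hx (Or.inl hc)
    have he : ContinuousAt ε x := by by_contra hc; exact hx (Or.inr hc)
    refine ((h.ε_coef.hasDerivAt_integral c1 he).add
      (h.μ_coef.hasDerivAt_integral c2 hm)).congr_deriv ?_
    simp only [Function.comp_apply, pruferPot, pruferKin]
    ring
  · simp [prufer, h.flux₁_zero, h.sol₁_zero, Real.sqrt_sq (pruferScale_pos E).le]
  · simp [prufer, h.flux₁_zero]

lemma prufer_zero (x : ℝ) : prufer ε μ 0 x = 0 := by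
  simp [prufer, pruferPot, pruferKin, flux₁]

/-- `α` integrates an angular speed in the energy, the Prüfer angle one in `x`. At `x = 1/2` they
are angles of `(a, -c)` and `(sa, -c)` with `s > 0`, whose inner product `s a² + c²` is positive,
and both start from 0 at `E = 0`. -/
lemma abs_α_sub_prufer_lt (h : IsEvenMedium ε μ) (E : ℝ) :
    |h.transferCurve.α E - prufer ε μ E (1 / 2)| < π / 2 := by
  refine abs_lt_pi_div_two_of_cos_pos
    (δ := fun E => h.transferCurve.α E - prufer ε μ E (1 / 2)) ?_ (fun E => ?_) ?_ E
  · exact h.transferCurve.continuous_α.sub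
      ((h.ε_coef.continuous_param h.continuous_pruferPot 0 (1 / 2)).add
        (h.μ_coef.continuous_param h.continuous_pruferKin 0 (1 / 2)))
  · obtain ⟨h1, h2⟩ := h.prufer_polar E (1 / 2)
    obtain ⟨h3, h4⟩ := h.transferCurve.polar_ac E
    have hr := h.transferCurve.r_pos E
    set r := h.transferCurve.r E
    set s := √((pruferScale E * sol₁ ε μ E (1 / 2)) ^ 2 + (-flux₁ ε μ E (1 / 2)) ^ 2) with hs
    have hs0 : 0 < s := Real.sqrt_pos.2 (h.prufer_pos E (1 / 2))
    change sol₁ ε μ E (1 / 2) = _ at h3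
    change -flux₁ ε μ E (1 / 2) = _ at h4
    have key : r * s * cos (h.transferCurve.α E - prufer ε μ E (1 / 2)) =
        pruferScale E * sol₁ ε μ E (1 / 2) ^ 2 + flux₁ ε μ E (1 / 2) ^ 2 := by
      rw [Real.cos_sub]
      linear_combination (-s * cos (prufer ε μ E (1 / 2))) * h3 - (s * sin (prufer ε μ E (1 / 2))) * h4
        - (sol₁ ε μ E (1 / 2)) * h1 + (flux₁ ε μ E (1 / 2)) * h2
    have hpos : 0 < pruferScale E * sol₁ ε μ E (1 / 2) ^ 2 + flux₁ ε μ E (1 / 2) ^ 2 := by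
      have := pruferScale_pos E
      rcases h.ne_zero₁ E (1 / 2) with h5 | h5 <;> positivity
    exact pos_of_mul_pos_right (key ▸ hpos) (mul_pos hr hs0).le
  · simp only [h.transferCurve.α_zero, prufer_zero, sub_zero, abs_zero]
    positivity

/-- The coefficients need not be bounded away from 0 globally, but near a common continuity point
they are; rotation over this interval alone will suffice. -/
lemma exists_lower_bound (h : IsEvenMedium ε μ) :
    ∃ p q m : ℝ, 0 ≤ p ∧ p < q ∧ q ≤ 1 / 2 ∧ 0 < m ∧ ∀ x ∈ Icc p q, m ≤ ε x ∧ m ≤ μ x := by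
  have hx : ∃ x ∈ Ioo (0 : ℝ) (1 / 2), ContinuousAt μ x ∧ ContinuousAt ε x := by
    by_contra! hc
    have h1 : (Ioo (0 : ℝ) (1 / 2)).Countable := h.countable_disc.mono fun x hx => by
      by_cases hm : ContinuousAt μ x
      · exact Or.inr (hc x hx hm)
      · exact Or.inl hm
    have h2 := h1.measure_zero volume
    simp only [Real.volume_Ioo, ENNReal.ofReal_eq_zero] at h2
    norm_num at h2
  obtain ⟨x, hx, hm, he⟩ := hx
  have h1 := hm.eventually_const_lt (half_lt_self (h.μ_coef.pos x))
  have h2 := he.eventually_const_lt (half_lt_self (h.ε_coef.pos x))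
  obtain ⟨δ, hδ, hb⟩ := Metric.eventually_nhds_iff.1 ((h1.and h2).and (Ioo_mem_nhds hx.1 hx.2))
  refine ⟨x, x + δ / 2, min (μ x / 2) (ε x / 2), hx.1.le, by linarith, ?_, ?_, ?_⟩
  · have := (hb (y := x + δ / 2) (by simp [abs_of_pos hδ]; linarith)).2.2
    exact this.le
  · exact lt_min (half_pos (h.μ_coef.pos x)) (half_pos (h.ε_coef.pos x))
  · intro y hy
    have := hb (y := y) (by rw [Real.dist_eq, abs_of_nonneg (by linarith [hy.1])]; linarith [hy.2])
    exact ⟨(min_le_right _ _).trans this.1.2.le, (min_le_left _ _).trans this.1.1.le⟩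

/-- With the scale `s = √(1 + E)` and `E ≥ 1`, the angular speed is at least `m s / 2` wherever `ε,
μ ≥ m`, and it is nonnegative elsewhere. -/
lemma prufer_unbounded (h : IsEvenMedium ε μ) (K : ℝ) : ∃ E, 0 ≤ E ∧ K ≤ prufer ε μ E (1 / 2) := by
  obtain ⟨p, q, m, hp, hpq, hq, hm, hb⟩ := h.exists_lower_bound
  have hκ : 0 < m / 2 * (q - p) := mul_pos (half_pos hm) (sub_pos.2 hpq)
  -- Chosen so that `E ≥ 1` and the scale `√(1 + E)` is at least `K / (m / 2 * (q - p))`.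
  set E : ℝ := 1 + (K / (m / 2 * (q - p))) ^ 2 with hE
  have hE1 : 1 ≤ E := by rw [hE]; nlinarith [sq_nonneg (K / (m / 2 * (q - p)))]
  have hE0 : 0 ≤ E := by linarith
  refine ⟨E, hE0, ?_⟩
  have hs := pruferScale_sq E
  have hs0 := pruferScale_pos E
  rw [abs_of_nonneg hE0] at hs
  have hsK : K / (m / 2 * (q - p)) ≤ pruferScale E := by
    refine le_of_abs_le (abs_le_of_sq_le_sq ?_ hs0.le)
    rw [hs, hE]
    linarith
  rw [div_le_iff₀ hκ] at hsK
  refine hsK.trans ?_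
  have c1 : Continuous (pruferPot ε μ E) := h.continuous_pruferPot.comp (Continuous.prodMk_right E)
  have c2 : Continuous (pruferKin ε μ E) := h.continuous_pruferKin.comp (Continuous.prodMk_right E)
  have i1 := fun a b => h.ε_coef.intervalIntegrable_mul c1 a b
  have i2 := fun a b => h.μ_coef.intervalIntegrable_mul c2 a b
  have n1 : ∀ x, 0 ≤ pruferPot ε μ E x := fun x => by
    have := h.prufer_pos E x
    unfold pruferPot
    positivity
  have n2 : ∀ x, 0 ≤ pruferKin ε μ E x := fun x => by
    have := h.prufer_pos E x
    unfold pruferKin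
    positivity
  have hle : ∫ t in p..q, (m * (pruferPot ε μ E t + pruferKin ε μ E t)) ≤
      ∫ t in (0 : ℝ)..(1 / 2), (ε t * pruferPot ε μ E t + μ t * pruferKin ε μ E t) := by
    calc _ ≤ ∫ t in p..q, (ε t * pruferPot ε μ E t + μ t * pruferKin ε μ E t) := by
          refine intervalIntegral.integral_mono_on hpq.le
            ((continuous_const.mul (c1.add c2)).intervalIntegrable _ _)
            ((i1 p q).add (i2 p q)) fun t ht => ?_
          rw [mul_add]
          exact add_le_add (mul_le_mul_of_nonneg_right (hb t ht).1 (n1 t))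
            (mul_le_mul_of_nonneg_right (hb t ht).2 (n2 t))
      _ ≤ _ := by
          refine intervalIntegral.integral_mono_interval hp hpq.le hq
            (Eventually.of_forall fun t => ?_) ((i1 _ _).add (i2 _ _))
          exact add_nonneg (mul_nonneg (h.ε_coef.pos t).le (n1 t))
            (mul_nonneg (h.μ_coef.pos t).le (n2 t))
  rw [intervalIntegral.integral_add (i1 _ _) (i2 _ _)] at hle
  refine le_trans ?_ hle
  have hlow : ∫ _ in p..q, (m * (pruferScale E / 2)) ≤
      ∫ t in p..q, (m * (pruferPot ε μ E t + pruferKin ε μ E t)) := by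
    refine intervalIntegral.integral_mono_on hpq.le (by simp)
      ((continuous_const.mul (c1.add c2)).intervalIntegrable _ _) fun t _ => ?_
    refine mul_le_mul_of_nonneg_left ?_ hm.le
    unfold pruferPot pruferKin
    rw [← add_div, div_le_div_iff₀ two_pos (h.prufer_pos E t), mul_pow, hs]
    have e1 : 0 ≤ pruferScale E * sol₁ ε μ E t ^ 2 * (E - 1) :=
      mul_nonneg (by positivity) (by linarith)
    have e2 : 0 ≤ pruferScale E * flux₁ ε μ E t ^ 2 := by positivity
    linarith
  refine le_trans (le_of_eq ?_) hlow
  rw [intervalIntegral.integral_const, smul_eq_mul]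
  ring

end Prufer

/-- The half-period transfer matrix of the medium, with its unbounded rotation. -/
def curve (h : IsEvenMedium ε μ) : RotatingCurve where
  toTransferCurve := h.transferCurve
  unbounded K := by
    obtain ⟨E, hE, hK⟩ := h.prufer_unbounded (K + π / 2)
    refine ⟨E, hE, ?_⟩
    have := (abs_lt.1 (h.abs_α_sub_prufer_lt E)).1
    linarith

/-! ### Monodromy -/

lemma sol₁_add_one' (h : IsEvenMedium ε μ) (E x : ℝ) :
    sol₁ ε μ E (x + 1) = sol₁ ε μ E 1 * sol₁ ε μ E x + flux₁ ε μ E 1 * sol₂ ε μ E x ∧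
    flux₁ ε μ E (x + 1) = sol₁ ε μ E 1 * flux₁ ε μ E x + flux₁ ε μ E 1 * flux₂ ε μ E x := by
  have := h.isSolution_eq (h.isSolution_translate (h.isRealSolution₁ E).isSolution) x
  simp only [zero_add] at this
  exact_mod_cast this

lemma sol₂_add_one' (h : IsEvenMedium ε μ) (E x : ℝ) :
    sol₂ ε μ E (x + 1) = sol₂ ε μ E 1 * sol₁ ε μ E x + flux₂ ε μ E 1 * sol₂ ε μ E x ∧
    flux₂ ε μ E (x + 1) = sol₂ ε μ E 1 * flux₁ ε μ E x + flux₂ ε μ E 1 * flux₂ ε μ E x := by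
  have := h.isSolution_eq (h.isSolution_translate (h.isRealSolution₂ E).isSolution) x
  simp only [zero_add] at this
  exact_mod_cast this

/-- Translation by one period carries `-1/2` to `1/2`, and parity expresses the data at `-1/2` by
those at `1/2`; the resulting linear systems have determinant 1. Evenness is what makes the diagonal
entries equal. -/
lemma monodromy (h : IsEvenMedium ε μ) (E : ℝ) :
    sol₁ ε μ E 1 = h.curve.A E ∧ flux₁ ε μ E 1 = -(2 * h.curve.t E) ∧
    sol₂ ε μ E 1 = 2 * h.curve.τ E ∧ flux₂ ε μ E 1 = h.curve.A E := by
  have hd := h.det_eq_one E (1 / 2)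
  obtain ⟨h1, h2⟩ := h.sol₁_add_one' E (-(1 / 2))
  obtain ⟨h3, h4⟩ := h.sol₂_add_one' E (-(1 / 2))
  rw [show (-(1 / 2) + 1 : ℝ) = 1 / 2 by norm_num] at h1 h2 h3 h4
  simp only [h.sol₁_neg, h.sol₂_neg, h.flux₁_neg, h.flux₂_neg] at h1 h2 h3 h4
  change _ = sol₁ ε μ E (1 / 2) * flux₂ ε μ E (1 / 2) + sol₂ ε μ E (1 / 2) * flux₁ ε μ E (1 / 2) ∧
    _ = -(2 * -(sol₁ ε μ E (1 / 2) * flux₁ ε μ E (1 / 2))) ∧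
    _ = 2 * (sol₂ ε μ E (1 / 2) * flux₂ ε μ E (1 / 2)) ∧
    _ = sol₁ ε μ E (1 / 2) * flux₂ ε μ E (1 / 2) + sol₂ ε μ E (1 / 2) * flux₁ ε μ E (1 / 2)
  refine ⟨?_, ?_, ?_, ?_⟩
  · linear_combination (-sol₁ ε μ E 1) * hd - flux₂ ε μ E (1 / 2) * h1 - sol₂ ε μ E (1 / 2) * h2
  · linear_combination (-flux₁ ε μ E 1) * hd - flux₁ ε μ E (1 / 2) * h1 - sol₁ ε μ E (1 / 2) * h2
  · linear_combination (-sol₂ ε μ E 1) * hd - flux₂ ε μ E (1 / 2) * h3 - sol₂ ε μ E (1 / 2) * h4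
  · linear_combination (-flux₂ ε μ E 1) * hd - flux₁ ε μ E (1 / 2) * h3 - sol₁ ε μ E (1 / 2) * h4

lemma sol₁_add_one (h : IsEvenMedium ε μ) (E x : ℝ) :
    sol₁ ε μ E (x + 1) =
      h.curve.A E * sol₁ ε μ E x - 2 * h.curve.t E * sol₂ ε μ E x := by
  rw [(h.sol₁_add_one' E x).1, (h.monodromy E).1, (h.monodromy E).2.1]
  ring

lemma sol₂_add_one (h : IsEvenMedium ε μ) (E x : ℝ) :
    sol₂ ε μ E (x + 1) =
      2 * h.curve.τ E * sol₁ ε μ E x + h.curve.A E * sol₂ ε μ E x := by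
  rw [(h.sol₂_add_one' E x).1, (h.monodromy E).2.2.1, (h.monodromy E).2.2.2]

/-! ### Bloch spaces -/

variable (ε μ) in
/-- The combination of the fundamental solutions with coefficients `a`, `b`. -/
def comb (E : ℝ) (a b : ℂ) : ℝ → ℂ := fun x => a * sol₁ ε μ E x + b * sol₂ ε μ E x

lemma comb_injective (h : IsEvenMedium ε μ) {E : ℝ} {a b : ℂ}
    (h0 : ∀ x, comb ε μ E a b x = 0) : a = 0 ∧ b = 0 := by
  have ha : a = 0 := by simpa [comb, h.sol₁_zero, h.sol₂_zero] using h0 0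
  obtain ⟨x, -, hx⟩ := h.exists_ne_zero_of_solution (h.isRealSolution₂ E) (h.ne_zero₂ E) one_pos
  refine ⟨ha, ?_⟩
  simpa [comb, ha, hx] using h0 x

lemma comb_add_one (h : IsEvenMedium ε μ) (E : ℝ) (a b : ℂ) (x : ℝ) :
    comb ε μ E a b (x + 1) = comb ε μ E (h.curve.A E * a + 2 * h.curve.τ E * b)
      (-(2 * h.curve.t E * a) + h.curve.A E * b) x := by
  simp only [comb, h.sol₁_add_one, h.sol₂_add_one]
  push_cast
  ring

lemma mem_blochSpace_iff (h : IsEvenMedium ε μ) {k E : ℝ} {ψ : ℝ → ℂ} :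
    ψ ∈ blochSpace ε μ k E ↔ ∃ a b : ℂ, ψ = comb ε μ E a b ∧
      h.curve.A E * a + 2 * h.curve.τ E * b = Complex.exp (Complex.I * k) * a ∧
      -(2 * h.curve.t E * a) + h.curve.A E * b = Complex.exp (Complex.I * k) * b := by
  constructor
  · rintro ⟨⟨q, hq⟩, hB⟩
    refine ⟨ψ 0, q 0, funext fun x => (h.isSolution_eq hq x).1, ?_⟩
    have hψ : ψ = comb ε μ E (ψ 0) (q 0) := funext fun x => (h.isSolution_eq hq x).1
    generalize ψ 0 = a at hψ ⊢
    generalize q 0 = b at hψ ⊢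
    subst hψ
    have := h.comb_injective (E := E)
      (a := h.curve.A E * a + 2 * h.curve.τ E * b - Complex.exp (Complex.I * k) * a)
      (b := -(2 * h.curve.t E * a) + h.curve.A E * b - Complex.exp (Complex.I * k) * b)
      (fun x => by
        have h1 := hB x
        rw [h.comb_add_one] at h1
        simp only [comb] at h1 ⊢
        linear_combination h1)
    exact ⟨sub_eq_zero.1 this.1, sub_eq_zero.1 this.2⟩
  · rintro ⟨a, b, rfl, h1, h2⟩
    refine ⟨⟨_, h.isSolution_comb E a b⟩, fun x => ?_⟩
    rw [h.comb_add_one, h1, h2]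
    simp only [comb]
    ring

lemma exp_mul_I_sub_sq (k : ℝ) :
    (Complex.exp (Complex.I * k) - (cos k : ℝ)) ^ 2 = ((cos k : ℝ) : ℂ) ^ 2 - 1 := by
  rw [mul_comm, Complex.exp_mul_I]
  push_cast
  have := Complex.sin_sq_add_cos_sq (k : ℂ)
  linear_combination Complex.sin k ^ 2 * Complex.I_sq - this

/-- The initial data form an eigenvector of the monodromy matrix for `l = e^{ik}`, hence `l² - 2Al +
1 = 0`, and dividing by `2l` gives `A = cos k`. -/
lemma A_eq_cos_of_mem (h : IsEvenMedium ε μ) {k E : ℝ} {ψ : ℝ → ℂ}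
    (hψ : ψ ∈ blochSpace ε μ k E) (h0 : ψ ≠ 0) : h.curve.A E = cos k := by
  obtain ⟨a, b, rfl, h1, h2⟩ := h.mem_blochSpace_iff.1 hψ
  have hab : a ≠ 0 ∨ b ≠ 0 := by
    by_contra! hc
    exact h0 (funext fun x => by simp [comb, hc.1, hc.2])
  have hsq : (h.curve.A E : ℂ) ^ 2 = 1 - 4 * (h.curve.t E * h.curve.τ E) := by
    exact_mod_cast h.curve.A_sq E
  set l := Complex.exp (Complex.I * k) with hl
  have e1 : (l ^ 2 - 2 * h.curve.A E * l + 1) * a = 0 := by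
    linear_combination (h.curve.A E - l) * h1 - 2 * (h.curve.τ E) * h2 - a * hsq
  have e2 : (l ^ 2 - 2 * h.curve.A E * l + 1) * b = 0 := by
    linear_combination (h.curve.A E - l) * h2 + 2 * (h.curve.t E) * h1 - b * hsq
  have e3 : l ^ 2 - 2 * h.curve.A E * l + 1 = 0 := by
    rcases hab with hab | hab
    · exact (mul_eq_zero.1 e1).resolve_right hab
    · exact (mul_eq_zero.1 e2).resolve_right hab
  have hl0 : l ≠ 0 := Complex.exp_ne_zero _
  have hcos : 2 * Complex.cos k * l = l ^ 2 + 1 := by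
    rw [Complex.cos, mul_div_cancel₀ _ two_ne_zero, add_mul, hl, ← Complex.exp_add,
      ← Complex.exp_add, ← Complex.exp_nat_mul]
    ring_nf
    simp [add_comm]
  have e4 : (h.curve.A E : ℂ) = Complex.cos k := by
    have : (2 * l) * ((h.curve.A E : ℂ) - Complex.cos k) = 0 := by
      linear_combination -e3 - hcos
    exact sub_eq_zero.1 ((mul_eq_zero.1 this).resolve_left (mul_ne_zero two_ne_zero hl0))
  exact_mod_cast e4

/-- Here `A² = 1`, and `(e^{ik} - cos k)² = cos² k - 1` vanishes. -/
lemma exp_eq_A_of_degenerate (h : IsEvenMedium ε μ) {k E : ℝ} (hA : h.curve.A E = cos k)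
    (h0 : h.curve.t E * h.curve.τ E = 0) : Complex.exp (Complex.I * k) = h.curve.A E := by
  have h1 := exp_mul_I_sub_sq k
  have hsq := h.curve.A_sq E
  rw [h0, mul_zero, sub_zero] at hsq
  rw [← hA] at h1
  have h2 : (h.curve.A E : ℂ) ^ 2 = 1 := by exact_mod_cast hsq
  rw [h2, sub_self, sq_eq_zero_iff, sub_eq_zero] at h1
  exact h1

lemma comb_mem_of_touching (h : IsEvenMedium ε μ) {k E : ℝ} (hA : h.curve.A E = cos k)
    (ht : h.curve.t E = 0) (hτ : h.curve.τ E = 0) (a b : ℂ) :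
    comb ε μ E a b ∈ blochSpace ε μ k E := by
  rw [h.mem_blochSpace_iff]
  refine ⟨a, b, rfl, ?_, ?_⟩ <;>
  simp [ht, hτ, h.exp_eq_A_of_degenerate hA (by rw [ht, zero_mul])]

/-- A 2×2 matrix with a nonzero off-diagonal entry is not scalar, so its eigenspaces are lines. -/
lemma exists_span_of_not_touching (h : IsEvenMedium ε μ) {k E : ℝ} (hA : h.curve.A E = cos k)
    (h0 : ¬ (h.curve.t E = 0 ∧ h.curve.τ E = 0)) :
    ∃ g ∈ blochSpace ε μ k E, g ≠ 0 ∧ blochSpace ε μ k E ≤ Submodule.span ℂ {g} := by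
  have hl := exp_mul_I_sub_sq k
  have hsq : (h.curve.A E : ℂ) ^ 2 = 1 - 4 * (h.curve.t E * h.curve.τ E) := by
    exact_mod_cast h.curve.A_sq E
  rw [← hA, hsq] at hl
  by_cases hτ : h.curve.τ E = 0
  · have ht : h.curve.t E ≠ 0 := fun ht => h0 ⟨ht, hτ⟩
    have hexp := h.exp_eq_A_of_degenerate hA (by rw [hτ, mul_zero])
    refine ⟨comb ε μ E 0 1, h.mem_blochSpace_iff.2 ⟨0, 1, rfl, ?_, ?_⟩, fun hz => ?_, ?_⟩
    · simp [hτ]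
    · simp [hexp]
    · exact one_ne_zero (h.comb_injective (fun x => congrFun hz x)).2
    · rintro ψ hψ
      obtain ⟨a, b, rfl, -, h2⟩ := h.mem_blochSpace_iff.1 hψ
      rw [hexp] at h2
      have ha : a = 0 := by
        have : (h.curve.t E : ℂ) * a = 0 := by linear_combination (-1 / 2) * h2
        exact (mul_eq_zero.1 this).resolve_left (by exact_mod_cast ht)
      refine Submodule.mem_span_singleton.2 ⟨b, funext fun x => ?_⟩
      simp [comb, ha]
  · have hτ' : (h.curve.τ E : ℂ) ≠ 0 := by exact_mod_cast hτ
    refine ⟨comb ε μ E (2 * h.curve.τ E) (Complex.exp (Complex.I * k) - h.curve.A E),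
      h.mem_blochSpace_iff.2 ⟨_, _, rfl, ?_, ?_⟩, fun hz => ?_, ?_⟩
    · ring
    · linear_combination -hl
    · have := (h.comb_injective (fun x => congrFun hz x)).1
      exact mul_ne_zero two_ne_zero hτ' this
    · rintro ψ hψ
      obtain ⟨a, b, rfl, h1, -⟩ := h.mem_blochSpace_iff.1 hψ
      refine Submodule.mem_span_singleton.2 ⟨a / (2 * h.curve.τ E), funext fun x => ?_⟩
      simp only [comb, Pi.smul_apply, smul_eq_mul]
      field_simp
      linear_combination (-sol₂ ε μ E x : ℂ) * h1

/-! ### Independence of Bloch modes of different energies -/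

lemma eq_zero_of_off_countable {s : Set ℝ} (hs : s.Countable) {f : ℝ → ℂ} (hf : Continuous f)
    (h : ∀ x, x ∉ s → f x = 0) : ∀ x, f x = 0 :=
  fun x => congrFun (hf.ext_on (hs.dense_compl ℝ) continuous_const fun y hy => h y hy) x

/-- Applying the operator to a vanishing combination multiplies each coefficient by its energy. It
is applied in two halves, through the fluxes, off the discontinuities; continuity then fills in the
missing points. -/
lemma sum_energy_mul_eq_zero (h : IsEvenMedium ε μ) {k : ℝ} {s : Finset ℕ} {c : ℕ → ℂ} {e : ℕ → ℝ}
    {g : ℕ → ℝ → ℂ} (hg : ∀ i, g i ∈ blochSpace ε μ k (e i))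
    (h0 : ∀ x, ∑ i ∈ s, c i * g i x = 0) : ∀ x, ∑ i ∈ s, c i * e i * g i x = 0 := by
  choose q hq using fun i => (hg i).1
  have hqc : Continuous fun x => ∑ i ∈ s, c i * q i x :=
    continuous_finsetSum _ fun i _ => continuous_const.mul (hq i).2.1
  have hgc : Continuous fun x => ∑ i ∈ s, c i * e i * g i x :=
    continuous_finsetSum _ fun i _ => continuous_const.mul (hq i).1
  have h1 : ∀ x, ∑ i ∈ s, c i * q i x = 0 := by
    refine eq_zero_of_off_countable h.μ_coef.countable_disc hqc fun x hx => ?_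
    have hx : ContinuousAt μ x := by by_contra hc; exact hx hc
    have hd : HasDerivAt (fun x => ∑ i ∈ s, c i * g i x) (∑ i ∈ s, c i * (μ x * q i x)) x :=
      HasDerivAt.fun_sum fun i _ => ((hq i).2.2.1 x hx).const_mul (c i)
    rw [funext h0] at hd
    have h2 := hd.unique (hasDerivAt_const x (0 : ℂ))
    have h3 : (μ x : ℂ) * ∑ i ∈ s, c i * q i x = 0 := by
      rw [← h2, Finset.mul_sum]
      exact Finset.sum_congr rfl fun i _ => by ring
    exact (mul_eq_zero.1 h3).resolve_left (by exact_mod_cast (h.μ_coef.pos x).ne')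
  refine eq_zero_of_off_countable h.ε_coef.countable_disc hgc fun x hx => ?_
  have hx : ContinuousAt ε x := by by_contra hc; exact hx hc
  have hd : HasDerivAt (fun x => ∑ i ∈ s, c i * q i x) (∑ i ∈ s, c i * -(e i * ε x * g i x)) x :=
    HasDerivAt.fun_sum fun i _ => ((hq i).2.2.2 x hx).const_mul (c i)
  rw [funext h1] at hd
  have h2 := hd.unique (hasDerivAt_const x (0 : ℂ))
  have h3 : (ε x : ℂ) * ∑ i ∈ s, c i * e i * g i x = 0 := by
    rw [Finset.mul_sum, ← neg_eq_zero, ← h2, ← Finset.sum_neg_distrib]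
    exact Finset.sum_congr rfl fun i _ => by ring
  exact (mul_eq_zero.1 h3).resolve_left (by exact_mod_cast (h.ε_coef.pos x).ne')

lemma sum_prod_mul_eq_zero (h : IsEvenMedium ε μ) {k : ℝ} {s : Finset ℕ} {c : ℕ → ℂ} {e : ℕ → ℝ}
    {g : ℕ → ℝ → ℂ} (hg : ∀ i, g i ∈ blochSpace ε μ k (e i))
    (h0 : ∀ x, ∑ i ∈ s, c i * g i x = 0) (T : Finset ℝ) :
    ∀ x, ∑ i ∈ s, c i * (∏ v ∈ T, ((e i : ℂ) - v)) * g i x = 0 := by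
  induction T using Finset.induction_on with
  | empty => simpa using h0
  | insert v T hv ih =>
    intro x
    have h1 := h.sum_energy_mul_eq_zero hg ih x
    have h2 := ih x
    have : ∑ i ∈ s, c i * (∏ v ∈ insert v T, ((e i : ℂ) - v)) * g i x =
        (∑ i ∈ s, c i * (∏ v ∈ T, ((e i : ℂ) - v)) * e i * g i x) -
          v * ∑ i ∈ s, c i * (∏ v ∈ T, ((e i : ℂ) - v)) * g i x := by
      rw [Finset.mul_sum, ← Finset.sum_sub_distrib]
      refine Finset.sum_congr rfl fun i _ => ?_
      rw [Finset.prod_insert hv]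
      ring
    rw [this, h1, h2, mul_zero, sub_zero]

/-- A polynomial in the operator that vanishes at all the other energies isolates the modes of
energy `E`. -/
lemma sum_filter_energy_eq_zero (h : IsEvenMedium ε μ) {k : ℝ} {s : Finset ℕ} {c : ℕ → ℂ}
    {e : ℕ → ℝ} {g : ℕ → ℝ → ℂ} (hg : ∀ i, g i ∈ blochSpace ε μ k (e i))
    (h0 : ∀ x, ∑ i ∈ s, c i * g i x = 0) (E : ℝ) (x : ℝ) :
    ∑ i ∈ s with e i = E, c i * g i x = 0 := by
  have h1 := h.sum_prod_mul_eq_zero hg h0 ((s.image e).erase E) x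
  have h2 : ∑ i ∈ s, c i * (∏ v ∈ (s.image e).erase E, ((e i : ℂ) - v)) * g i x =
      (∏ v ∈ (s.image e).erase E, ((E : ℂ) - v)) * ∑ i ∈ s with e i = E, c i * g i x := by
    rw [Finset.sum_filter, Finset.mul_sum]
    refine Finset.sum_congr rfl fun i hi => ?_
    split_ifs with hE
    · rw [hE]; ring
    · have : ∏ v ∈ (s.image e).erase E, ((e i : ℂ) - v) = 0 := Finset.prod_eq_zero (i := e i)
        (Finset.mem_erase.2 ⟨hE, Finset.mem_image_of_mem e hi⟩) (sub_self _)
      rw [this]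
      ring
  rw [h2] at h1
  refine (mul_eq_zero.1 h1).resolve_left (Finset.prod_ne_zero_iff.2 fun v hv => ?_)
  rw [sub_ne_zero]
  exact_mod_cast (Finset.ne_of_mem_erase hv).symm

/-! ### Identification of the band functions -/

lemma _root_.Photonic.RotatingCurve.mem_band_of_touching (D : RotatingCurve) {p j : ℕ}
    (hp : D.top p = D.bot (p + 1)) (hj : D.top p ∈ Icc (D.bot j) (D.top j)) :
    j = p ∨ j = p + 1 := by
  have h1 := D.top_strictMono.le_iff_le.1 hj.2
  have h2 := hj.1
  rw [hp, D.bot_strictMono.le_iff_le] at h2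
  omega

lemma _root_.Photonic.RotatingCurve.eq_of_energy_eq (D : RotatingCurve) {i j : ℕ} {k : ℝ}
    (hij : D.energy i k = D.energy j k)
    (h0 : ¬ (D.t (D.energy i k) = 0 ∧ D.τ (D.energy i k) = 0)) : i = j := by
  have key : ∀ {i j : ℕ}, D.energy i k = D.energy j k → i < j →
      D.energy i k = D.top i ∧ D.top i = D.bot (i + 1) := fun {i j} he hlt => by
    have h1 := (D.energy_mem i k).2
    have h2 := (D.energy_mem j k).1
    have h3 := D.top_le_bot_succ i
    have h4 : D.bot (i + 1) ≤ D.bot j := D.bot_strictMono.monotone hlt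
    constructor <;> linarith
  by_contra hne
  rcases lt_or_gt_of_ne hne with hlt | hlt
  · obtain ⟨h1, h2⟩ := key hij hlt
    exact h0 (h1 ▸ ⟨D.t_top_of_touching h2, D.τ_top_of_touching h2⟩)
  · obtain ⟨h1, h2⟩ := key hij.symm hlt
    rw [hij, h1] at h0
    exact h0 ⟨D.t_top_of_touching h2, D.τ_top_of_touching h2⟩

/-- One mode per band. Where two bands share an energy, the lower one is given the even solution and
the upper one the odd solution; this keeps the family independent and still spanning each Bloch
space. -/
lemma exists_modes (h : IsEvenMedium ε μ) (k : ℝ) : ∃ g : ℕ → ℝ → ℂ,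
    (∀ n, g n ∈ blochSpace ε μ k (h.curve.energy n k)) ∧ LinearIndependent ℂ g ∧
    ∀ n, blochSpace ε μ k (h.curve.energy n k) ≤
      Submodule.span ℂ (g '' {i | h.curve.energy i k = h.curve.energy n k}) := by
  set D := h.curve with hD
  have hex : ∀ n, ∃ g ∈ blochSpace ε μ k (D.energy n k), g ≠ 0 ∧
      (¬ (D.t (D.energy n k) = 0 ∧ D.τ (D.energy n k) = 0) →
        blochSpace ε μ k (D.energy n k) ≤ Submodule.span ℂ {g}) ∧
      (D.t (D.energy n k) = 0 ∧ D.τ (D.energy n k) = 0 →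
        g = if D.energy n k = D.top n then comb ε μ (D.energy n k) 1 0
          else comb ε μ (D.energy n k) 0 1) := by
    intro n
    have hA := D.A_energy n k
    by_cases h0 : D.t (D.energy n k) = 0 ∧ D.τ (D.energy n k) = 0
    · refine ⟨if D.energy n k = D.top n then comb ε μ (D.energy n k) 1 0
          else comb ε μ (D.energy n k) 0 1, ?_, ?_, fun h1 => absurd h0 h1, fun _ => rfl⟩
      · split_ifs <;> exact h.comb_mem_of_touching hA h0.1 h0.2 _ _
      · split_ifs <;> intro hz
        · exact one_ne_zero (h.comb_injective (fun x => congrFun hz x)).1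
        · exact one_ne_zero (h.comb_injective (fun x => congrFun hz x)).2
    · obtain ⟨g, hg, hg0, hs⟩ := h.exists_span_of_not_touching hA h0
      exact ⟨g, hg, hg0, fun _ => hs, fun h1 => absurd h1 h0⟩
  choose g hg hg0 hspan hdeg using hex
  have hpair : ∀ n, D.t (D.energy n k) = 0 ∧ D.τ (D.energy n k) = 0 → ∃ p,
      D.energy p k = D.energy n k ∧ D.energy (p + 1) k = D.energy n k ∧
      (∀ j, D.energy j k = D.energy n k ↔ j = p ∨ j = p + 1) ∧
      g p = comb ε μ (D.energy n k) 1 0 ∧ g (p + 1) = comb ε μ (D.energy n k) 0 1 := by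
    intro n h0
    obtain ⟨p, hE, hp⟩ := D.exists_touching h0.1 h0.2
    have hA := D.A_energy n k
    have e1 : D.energy p k = D.energy n k :=
      D.energy_eq (by rw [hE]; exact ⟨(D.bot_lt_top p).le, le_rfl⟩) hA
    have e2 : D.energy (p + 1) k = D.energy n k :=
      D.energy_eq (by rw [hE, hp]; exact ⟨le_rfl, (D.bot_lt_top _).le⟩) hA
    refine ⟨p, e1, e2, fun j => ⟨fun hj => ?_, ?_⟩, ?_, ?_⟩
    · refine D.mem_band_of_touching hp ?_
      rw [← hE, ← hj]
      exact D.energy_mem j k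
    · rintro (rfl | rfl)
      · exact e1
      · exact e2
    · rw [hdeg p (by rwa [e1]), e1, if_pos hE]
    · rw [hdeg (p + 1) (by rwa [e2]), e2, if_neg]
      rw [hE, hp]
      exact (D.bot_lt_top _).ne
  refine ⟨g, hg, ?_, fun n => ?_⟩
  · rw [linearIndependent_iff']
    intro s c hc i hi
    have h0 : ∀ x, ∑ j ∈ s, c j * g j x = 0 := fun x => by
      have := congrFun hc x
      simpa [Finset.sum_apply] using this
    have h1 := h.sum_filter_energy_eq_zero hg h0 (D.energy i k)
    by_cases hd : D.t (D.energy i k) = 0 ∧ D.τ (D.energy i k) = 0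
    · obtain ⟨p, -, -, hp, gp, gp1⟩ := hpair i hd
      have h2 := h.comb_injective (E := D.energy i k) (a := if p ∈ s then c p else 0)
        (b := if p + 1 ∈ s then c (p + 1) else 0) (fun x => by
          refine Eq.trans ?_ (h1 x)
          have hf : (s.filter fun j => D.energy j k = D.energy i k) = s ∩ {p, p + 1} := by
            ext j
            simp [hp]
          rw [hf, Finset.inter_comm, ← Finset.sum_ite_mem, Finset.sum_pair (by omega), gp, gp1]
          simp only [comb]
          split_ifs <;> ring)
      rcases (hp i).1 rfl with rfl | rfl
      · simpa [hi] using h2.1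
      · simpa [hi] using h2.2
    · have hf : (s.filter fun j => D.energy j k = D.energy i k) = {i} := by
        ext j
        simp only [Finset.mem_filter, Finset.mem_singleton]
        constructor
        · rintro ⟨-, hj⟩
          exact (D.eq_of_energy_eq hj.symm hd).symm
        · rintro rfl
          exact ⟨hi, rfl⟩
      simp only [hf, Finset.sum_singleton] at h1
      by_contra hci
      exact hg0 i (funext fun x => (mul_eq_zero.1 (h1 x)).resolve_left hci)
  · by_cases hd : D.t (D.energy n k) = 0 ∧ D.τ (D.energy n k) = 0
    · obtain ⟨p, e1, e2, hp, gp, gp1⟩ := hpair n hd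
      intro ψ hψ
      obtain ⟨a, b, rfl, -, -⟩ := h.mem_blochSpace_iff.1 hψ
      have : comb ε μ (D.energy n k) a b = a • g p + b • g (p + 1) := by
        rw [gp, gp1]
        funext x
        simp [comb]
      rw [this]
      exact add_mem (Submodule.smul_mem _ _ (Submodule.subset_span ⟨p, e1, rfl⟩))
        (Submodule.smul_mem _ _ (Submodule.subset_span ⟨p + 1, e2, rfl⟩))
    · refine (hspan n hd).trans (Submodule.span_mono ?_)
      rintro _ rfl
      exact ⟨n, rfl, rfl⟩

/-- The first `n + 1` modes of `exists_modes` show that the value is admissible. Below it, every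
Bloch mode lies in the span of the first `n`, which has no room for `n + 1` independent ones. -/
lemma bandFn_succ (h : IsEvenMedium ε μ) (n : ℕ) (k : ℝ) :
    bandFn ε μ (n + 1) k = h.curve.energy n k := by
  classical
  obtain ⟨g, hg, hli, hspan⟩ := h.exists_modes k
  refine IsLeast.csInf_eq ⟨?_, ?_⟩
  · refine ⟨fun i => g i, hli.comp _ Fin.val_injective, fun i => ⟨_, ?_, hg i⟩⟩
    exact h.curve.energy_mono k (by omega)
  · rintro E ⟨f, hf, hE⟩
    by_contra! hlt
    have hsub : range f ⊆ Submodule.span ℂ (((Finset.range n).image g : Finset (ℝ → ℂ)) : Set (ℝ → ℂ)) := by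
      rintro _ ⟨i, rfl⟩
      obtain ⟨E', hE', hfi⟩ := hE i
      obtain ⟨m, rfl⟩ := h.curve.exists_eq_energy (h.A_eq_cos_of_mem hfi (hf.ne_zero i))
      refine Submodule.span_mono ?_ (hspan m hfi)
      rintro _ ⟨l, hl, rfl⟩
      simp only [Finset.coe_image, Finset.coe_range]
      refine ⟨l, ?_, rfl⟩
      simp only [mem_ofPred_eq] at hl
      by_contra hln
      have := h.curve.energy_mono k (not_lt.1 hln)
      simp only at this
      linarith
    have hcard := linearIndependent_le_span_aux' f hf _ hsub
    have h1 : (Finset.image g (Finset.range n)).card ≤ n := by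
      simpa using Finset.card_image_le (s := Finset.range n) (f := g)
    simp only [Fintype.card_fin, Finset.coe_sort_coe, Fintype.card_coe] at hcard
    omega

lemma finrank_blochSpace_eq_two_iff (h : IsEvenMedium ε μ) {k E : ℝ} :
    Module.finrank ℂ (blochSpace ε μ k E) = 2 ↔
      h.curve.A E = cos k ∧ h.curve.t E = 0 ∧ h.curve.τ E = 0 := by
  constructor
  · intro hf
    have hA : h.curve.A E = cos k := by
      by_contra hA
      have : blochSpace ε μ k E = ⊥ := by
        rw [Submodule.eq_bot_iff]
        intro ψ hψ
        by_contra h0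
        exact hA (h.A_eq_cos_of_mem hψ h0)
      rw [this, finrank_bot] at hf
      omega
    refine ⟨hA, ?_⟩
    by_contra h0
    obtain ⟨g, -, -, hs⟩ := h.exists_span_of_not_touching hA h0
    have h1 := Submodule.finrank_mono hs
    have h2 := finrank_span_le_card (R := ℂ) ({g} : Set (ℝ → ℂ))
    simp at h2
    omega
  · rintro ⟨hA, ht, hτ⟩
    have hli : LinearIndependent ℂ ![comb ε μ E 1 0, comb ε μ E 0 1] := by
      rw [LinearIndependent.pair_iff]
      intro a b hab
      refine h.comb_injective (E := E) fun x => ?_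
      have := congrFun hab x
      simpa [comb] using this
    have hs : blochSpace ε μ k E = Submodule.span ℂ (range ![comb ε μ E 1 0, comb ε μ E 0 1]) := by
      apply le_antisymm
      · intro ψ hψ
        obtain ⟨a, b, rfl, -, -⟩ := h.mem_blochSpace_iff.1 hψ
        rw [Matrix.range_cons_cons_empty, Submodule.mem_span_pair]
        exact ⟨a, b, funext fun x => by simp [comb]⟩
      · rw [Submodule.span_le]
        rintro _ ⟨i, rfl⟩
        fin_cases i
        · exact h.comb_mem_of_touching hA ht hτ 1 0
        · exact h.comb_mem_of_touching hA ht hτ 0 1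
    rw [hs, finrank_span_eq_card hli, Fintype.card_fin]

lemma exists_cos_eq (n : ℕ) : ∃ k : ℝ, (k = 0 ∨ k = π) ∧ cos k = (-1) ^ n := by
  rcases neg_one_pow_eq_or ℝ n with h | h
  · exact ⟨0, Or.inl rfl, by rw [h, Real.cos_zero]⟩
  · exact ⟨π, Or.inr rfl, by rw [h, Real.cos_pi]⟩

lemma mem_Icc_of_edge {k : ℝ} (hk : k = 0 ∨ k = π) : k ∈ Icc (-π) π := by
  have := Real.pi_pos
  rcases hk with rfl | rfl <;> constructor <;> linarith

lemma bandBottom_succ (h : IsEvenMedium ε μ) (n : ℕ) :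
    bandBottom ε μ (n + 1) = h.curve.bot n := by
  obtain ⟨k, hk, hc⟩ := exists_cos_eq n
  refine IsLeast.csInf_eq ⟨⟨k, mem_Icc_of_edge hk, ?_⟩, ?_⟩
  · rw [h.bandFn_succ, h.curve.energy_eq_bot hc]
  · rintro _ ⟨k', -, rfl⟩
    rw [h.bandFn_succ]
    exact (h.curve.energy_mem n k').1

lemma bandTop_succ (h : IsEvenMedium ε μ) (n : ℕ) :
    bandTop ε μ (n + 1) = h.curve.top n := by
  obtain ⟨k, hk, hc⟩ := exists_cos_eq (n + 1)
  refine IsGreatest.csSup_eq ⟨⟨k, mem_Icc_of_edge hk, ?_⟩, ?_⟩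
  · rw [h.bandFn_succ, h.curve.energy_eq_top hc]
  · rintro _ ⟨k', -, rfl⟩
    rw [h.bandFn_succ]
    exact (h.curve.energy_mem n k').2

end IsEvenMedium

/-! ### Closed gaps are exactly the Dirac points. -/

lemma abs_sin_sub_isBigO : (fun x : ℝ => |sin x| - |x|) =O[𝓝 0] fun x => x ^ 2 := by
  refine Asymptotics.IsBigO.of_bound 1 ?_
  filter_upwards [Metric.ball_mem_nhds (0 : ℝ) one_pos] with x hx
  have hx1 : |x| ≤ 1 := by simpa using (Metric.mem_ball.1 hx).le
  rw [one_mul, Real.norm_eq_abs, Real.norm_eq_abs, abs_of_nonneg (sq_nonneg x)]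
  refine (abs_abs_sub_abs_le_abs_sub _ _).trans ?_
  have h1 := Real.sin_bound hx1
  have h2 : |sin x - x| ≤ |sin x - (x - x ^ 3 / 6)| + |x ^ 3 / 6| := by
    have := abs_sub (sin x - (x - x ^ 3 / 6)) (x ^ 3 / 6)
    rwa [show sin x - (x - x ^ 3 / 6) - x ^ 3 / 6 = sin x - x by ring] at this
  have h3 : |x ^ 3 / 6| = |x| ^ 3 / 6 := by rw [abs_div, abs_pow, abs_of_pos (by norm_num : (0:ℝ) < 6)]
  have h4 : |x| ^ 3 ≤ |x| ^ 2 := pow_le_pow_of_le_one (abs_nonneg x) hx1 (by norm_num)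
  have h5 : |x| ^ 5 ≤ |x| ^ 2 := pow_le_pow_of_le_one (abs_nonneg x) hx1 (by norm_num)
  rw [← sq_abs x]
  have h6 := sq_nonneg |x|
  linarith

/-- Conical behaviour of a solution `e` of `sin² ((k - k₀) / 2) = (e k - E₀)² J (e k)`. -/
lemma conical_asymptotics {J e : ℝ → ℝ} {k₀ E₀ : ℝ} (hJ : DifferentiableAt ℝ J E₀) (hJ0 : 0 < J E₀)
    (he : ContinuousAt e k₀) (he0 : e k₀ = E₀)
    (h : ∀ k, sin ((k - k₀) / 2) ^ 2 = (e k - E₀) ^ 2 * J (e k)) :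
    (fun k => |e k - E₀| - 1 / (2 * √(J E₀)) * |k - k₀|) =O[𝓝 k₀] fun k => (k - k₀) ^ 2 := by
  set g : ℝ → ℝ := fun E => √(J E) with hg
  have hg0 : 0 < g E₀ := Real.sqrt_pos.2 hJ0
  have hgd : DifferentiableAt ℝ g E₀ := hJ.sqrt hJ0.ne'
  have htend : Tendsto e (𝓝 k₀) (𝓝 E₀) := he0 ▸ he.tendsto
  have heq : ∀ᶠ k in 𝓝 k₀, |sin ((k - k₀) / 2)| = |e k - E₀| * g (e k) := by
    filter_upwards [htend.eventually (hJ.continuousAt.eventually_const_lt hJ0)] with k hk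
    rw [← Real.sqrt_sq_eq_abs, ← Real.sqrt_sq_eq_abs, h k, Real.sqrt_mul (sq_nonneg _)]
  have hhalf : Tendsto (fun k : ℝ => (k - k₀) / 2) (𝓝 k₀) (𝓝 0) := by
    have : Continuous fun k : ℝ => (k - k₀) / 2 := by fun_prop
    simpa using this.tendsto k₀
  have h1 : (fun k => |sin ((k - k₀) / 2)| - |(k - k₀) / 2|) =O[𝓝 k₀] fun k => (k - k₀) ^ 2 := by
    refine (abs_sin_sub_isBigO.comp_tendsto hhalf).trans ?_
    refine Asymptotics.IsBigO.of_bound 1 (Eventually.of_forall fun k => ?_)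
    simp only [Function.comp_apply, div_pow, norm_div, norm_pow, one_mul]
    have := sq_nonneg (k - k₀)
    norm_num
    linarith
  have h2 : (fun k => e k - E₀) =O[𝓝 k₀] fun k => k - k₀ := by
    refine Asymptotics.IsBigO.of_bound (1 / g E₀) ?_
    filter_upwards [heq, htend.eventually (hgd.continuousAt.eventually_const_lt (half_lt_self hg0))]
      with k hk hk2
    rw [Real.norm_eq_abs, Real.norm_eq_abs, one_div, inv_mul_eq_div, le_div_iff₀ hg0]
    have h3 : |sin ((k - k₀) / 2)| ≤ |k - k₀| / 2 := by
      have := Real.abs_sin_le_abs (x := (k - k₀) / 2)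
      rwa [abs_div, abs_two] at this
    have h4 : |e k - E₀| * (g E₀ / 2) ≤ |e k - E₀| * g (e k) := by gcongr
    linarith
  -- Differentiability of `J`, not mere continuity, makes the error of the cone quadratic.
  have h3 : (fun k => g (e k) - g E₀) =O[𝓝 k₀] fun k => k - k₀ :=
    (hgd.isBigO_sub.comp_tendsto htend).trans h2
  have h4 : (fun k => |e k - E₀| * (g (e k) - g E₀)) =O[𝓝 k₀] fun k => (k - k₀) ^ 2 := by
    have := h2.abs_left.mul h3
    simpa only [sq] using this
  refine ((h1.sub h4).const_mul_left (1 / g E₀)).congr' ?_ EventuallyEq.rfl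
  filter_upwards [heq] with k hk
  rw [hk, abs_div, abs_two]
  field_simp
  ring

namespace IsEvenMedium

variable {ε μ : ℝ → ℝ}

lemma cross₁₁_differentiable (h : IsEvenMedium ε μ) (F : ℝ) :
    Differentiable ℝ fun E => cross₁₁ ε μ E F (1 / 2) := fun E =>
  (h.ε_coef.hasDerivAt_param (G := fun E t => sol₁ ε μ E t * sol₁ ε μ F t)
    (G' := fun E t => dsol₁ ε μ E t * sol₁ ε μ F t)
    (h.continuous_sol₁.mul (h.continuous_sol₁.comp (by fun_prop : Continuous
      fun p : ℝ × ℝ => (F, p.2))))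
    (h.continuous_dsol₁.mul (h.continuous_sol₁.comp (by fun_prop : Continuous
      fun p : ℝ × ℝ => (F, p.2))))
    (fun E x => (h.hasDerivAt_sol₁ E x).mul_const _) 0 (1 / 2) E).differentiableAt

lemma cross₂₂_differentiable (h : IsEvenMedium ε μ) (F : ℝ) :
    Differentiable ℝ fun E => cross₂₂ ε μ E F (1 / 2) := fun E =>
  (h.ε_coef.hasDerivAt_param (G := fun E t => sol₂ ε μ E t * sol₂ ε μ F t)
    (G' := fun E t => dsol₂ ε μ E t * sol₂ ε μ F t)
    (h.continuous_sol₂.mul (h.continuous_sol₂.comp (by fun_prop : Continuous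
      fun p : ℝ × ℝ => (F, p.2))))
    (h.continuous_dsol₂.mul (h.continuous_sol₂.comp (by fun_prop : Continuous
      fun p : ℝ × ℝ => (F, p.2))))
    (fun E x => (h.hasDerivAt_sol₂ E x).mul_const _) 0 (1 / 2) E).differentiableAt

/-- With determinant 1, `t = τ = 0` forces the half-period matrix at `F` to be diagonal or
antidiagonal. Then each difference formula for the two vanishing entries keeps a single integral,
and their product is quadratic in `E - F`. -/
lemma A_eq_of_touching (h : IsEvenMedium ε μ) {F : ℝ} (ht : h.curve.t F = 0)
    (hτ : h.curve.τ F = 0) (E : ℝ) :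
    h.curve.A E = h.curve.A F *
      (1 - 2 * ((E - F) ^ 2 * (cross₁₁ ε μ E F (1 / 2) * cross₂₂ ε μ E F (1 / 2)))) := by
  have ha := h.sol₁_sub E F (1 / 2)
  have hb := h.sol₂_sub E F (1 / 2)
  have hc := h.flux₁_sub E F (1 / 2)
  have hd := h.flux₂_sub E F (1 / 2)
  have hdet := h.det_eq_one F (1 / 2)
  have hdetE := h.det_eq_one E (1 / 2)
  change -(sol₁ ε μ F (1 / 2) * flux₁ ε μ F (1 / 2)) = 0 at ht
  change sol₂ ε μ F (1 / 2) * flux₂ ε μ F (1 / 2) = 0 at hτ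
  change sol₁ ε μ E (1 / 2) * flux₂ ε μ E (1 / 2) + sol₂ ε μ E (1 / 2) * flux₁ ε μ E (1 / 2) =
    (sol₁ ε μ F (1 / 2) * flux₂ ε μ F (1 / 2) + sol₂ ε μ F (1 / 2) * flux₁ ε μ F (1 / 2)) * _
  generalize cross₁₁ ε μ E F (1 / 2) = I11 at *
  generalize cross₁₂ ε μ E F (1 / 2) = I12 at *
  generalize cross₁₂ ε μ F E (1 / 2) = I21 at *
  generalize cross₂₂ ε μ E F (1 / 2) = I22 at *
  generalize sol₁ ε μ E (1 / 2) = a at *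
  generalize sol₂ ε μ E (1 / 2) = b at *
  generalize flux₁ ε μ E (1 / 2) = c at *
  generalize flux₂ ε μ E (1 / 2) = d at *
  generalize sol₁ ε μ F (1 / 2) = a' at *
  generalize sol₂ ε μ F (1 / 2) = b' at *
  generalize flux₁ ε μ F (1 / 2) = c' at *
  generalize flux₂ ε μ F (1 / 2) = d' at *
  rcases mul_eq_zero.1 (neg_eq_zero.1 ht) with h1 | h1
  · rcases mul_eq_zero.1 hτ with h2 | h2
    · simp [h1, h2] at hdet
    · subst h1 h2
      have e1 : a = -((E - F) * (b' * I11)) := by linear_combination ha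
      have e2 : d = (E - F) * (c' * I22) := by linear_combination hd
      have hbc : b' * c' = -1 := by linear_combination -hdet
      have e3 : a * d = (E - F) ^ 2 * (I11 * I22) := by
        rw [e1, e2]
        linear_combination (-(E - F) ^ 2 * (I11 * I22)) * hbc
      linear_combination 2 * e3 - hdetE - (1 - 2 * ((E - F) ^ 2 * (I11 * I22))) * hbc
  · rcases mul_eq_zero.1 hτ with h2 | h2
    · subst h1 h2
      have e1 : c = -((E - F) * (d' * I11)) := by linear_combination hc
      have e2 : b = (E - F) * (a' * I22) := by linear_combination hb
      have had : a' * d' = 1 := by linear_combination hdet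
      have e3 : b * c = -((E - F) ^ 2 * (I11 * I22)) := by
        rw [e1, e2]
        linear_combination (-(E - F) ^ 2 * (I11 * I22)) * had
      linear_combination 2 * e3 + hdetE - (1 - 2 * ((E - F) ^ 2 * (I11 * I22))) * had
    · simp [h1, h2] at hdet

/-- The wavenumber in `(-π, π]` at which gap number `p` closes or opens. -/
def edgeWavenumber (p : ℕ) : ℝ := if Even p then 0 else π

lemma cos_edgeWavenumber (p : ℕ) : cos (edgeWavenumber p) = (-1) ^ p := by
  unfold edgeWavenumber
  split_ifs with hp
  · rw [Real.cos_zero, hp.neg_one_pow]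
  · rw [Real.cos_pi, (Nat.not_even_iff_odd.1 hp).neg_one_pow]

lemma edgeWavenumber_mem (p : ℕ) : edgeWavenumber p ∈ Ioc (-π) π := by
  have := Real.pi_pos
  unfold edgeWavenumber
  split_ifs <;> constructor <;> linarith

lemma eq_edgeWavenumber {p : ℕ} {k : ℝ} (hk : k ∈ Ioc (-π) π) (hc : cos k = (-1) ^ p) :
    k = edgeWavenumber p := by
  have hpi := Real.pi_pos
  unfold edgeWavenumber
  split_ifs with hp
  · rw [hp.neg_one_pow] at hc
    exact (Real.cos_eq_one_iff_of_lt_of_lt (by linarith [hk.1]) (by linarith [hk.2])).1 hc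
  · rw [(Nat.not_even_iff_odd.1 hp).neg_one_pow, Real.cos_eq_neg_one_iff] at hc
    obtain ⟨m, rfl⟩ := hc
    have h1 : (m : ℝ) ≤ 0 := by
      by_contra! h
      have : (1 : ℝ) ≤ m := by exact_mod_cast h
      nlinarith [hk.2]
    have h2 : (-1 : ℝ) < m := by
      by_contra! h
      nlinarith [hk.1]
    have h3 : m = 0 := by
      have h1' : m ≤ 0 := by exact_mod_cast h1
      have h2' : -1 < m := by exact_mod_cast h2
      omega
    simp [h3]

/-- As `A = cos k` along each band and `cos k₀ = ±1`, `A_eq_of_touching` becomes `sin²((k - k₀)/2) =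
(E - E₀)² J(E)` with `J > 0`. The two branches are told apart by their side of the common edge. -/
lemma isDiracPoint_of_touching (h : IsEvenMedium ε μ) {i : ℕ}
    (hi : h.curve.top i = h.curve.bot (i + 1)) :
    IsDiracPoint ε μ (edgeWavenumber (i + 1)) (h.curve.top i) := by
  set D := h.curve with hD
  set k₀ := edgeWavenumber (i + 1) with hk₀
  have hcos : cos k₀ = (-1) ^ (i + 1) := cos_edgeWavenumber (i + 1)
  have ht := D.t_top_of_touching hi
  have hτ := D.τ_top_of_touching hi
  have e1 : D.energy i k₀ = D.top i := D.energy_eq_top hcos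
  have e2 : D.energy (i + 1) k₀ = D.top i := by rw [D.energy_eq_bot hcos, hi]
  have hA : D.A (D.top i) = cos k₀ := by rw [D.A_top, hcos]
  set J : ℝ → ℝ := fun E => cross₁₁ ε μ E (D.top i) (1 / 2) * cross₂₂ ε μ E (D.top i) (1 / 2) with hJ
  have hJd : DifferentiableAt ℝ J (D.top i) :=
    (h.cross₁₁_differentiable _ _).mul (h.cross₂₂_differentiable _ _)
  have hJ0 : 0 < J (D.top i) := mul_pos (h.cross₁₁_pos _ (by norm_num)) (h.cross₂₂_pos _ (by norm_num))
  have hsq : cos k₀ ^ 2 = 1 := by rw [hcos, ← pow_mul, mul_comm, pow_mul]; simp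
  have hsin : sin k₀ = 0 := by
    have := Real.sin_sq_add_cos_sq k₀
    rw [hsq] at this
    exact pow_eq_zero_iff two_ne_zero |>.1 (by linarith)
  have key : ∀ n k, sin ((k - k₀) / 2) ^ 2 = (D.energy n k - D.top i) ^ 2 * J (D.energy n k) := by
    intro n k
    have h1 := h.A_eq_of_touching ht hτ (D.energy n k)
    rw [← hD, D.A_energy, hA] at h1
    have h2 : cos (k - k₀) = cos k * cos k₀ := by rw [Real.cos_sub, hsin, mul_zero, add_zero]
    have h3 : cos (k - k₀) = 1 - 2 * sin ((k - k₀) / 2) ^ 2 := by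
      have h4 := Real.cos_two_mul ((k - k₀) / 2)
      have h5 := Real.sin_sq_add_cos_sq ((k - k₀) / 2)
      rw [mul_div_cancel₀ _ two_ne_zero] at h4
      linarith
    simp only [hJ]
    have h6 : cos k * cos k₀ = cos k₀ ^ 2 * (1 - 2 * ((D.energy n k - D.top i) ^ 2 *
      (cross₁₁ ε μ (D.energy n k) (D.top i) (1 / 2) * cross₂₂ ε μ (D.energy n k) (D.top i) (1 / 2)))) := by
      rw [h1]; ring
    rw [hsq] at h6
    linarith
  refine ⟨⟨i + 1, by omega, ?_, ?_, 1 / (2 * √(J (D.top i))), ?_, ?_, ?_⟩, ?_⟩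
  · rw [h.bandFn_succ, e1]
  · rw [h.bandFn_succ, e2]
  · have := Real.sqrt_pos.2 hJ0
    positivity
  · refine (conical_asymptotics hJd hJ0 (D.continuous_energy i).continuousAt e1
      (key i)).neg_left.congr_left fun k => ?_
    rw [h.bandFn_succ, abs_of_nonpos (sub_nonpos.2 (D.energy_mem i k).2)]
    ring
  · refine (conical_asymptotics hJd hJ0 (D.continuous_energy (i + 1)).continuousAt e2
      (key (i + 1))).congr_left fun k => ?_
    rw [h.bandFn_succ, abs_of_nonneg]
    · ring
    · rw [hi]
      exact sub_nonneg.2 (D.energy_mem (i + 1) k).1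
  · exact h.finrank_blochSpace_eq_two_iff.2 ⟨hA, ht, hτ⟩

/-- The indices of the closed gaps below the band with index `n`. -/
def closedGaps (h : IsEvenMedium ε μ) (n : ℕ) : Finset ℕ :=
  open scoped Classical in
  (Finset.range n).filter fun i => h.curve.top i = h.curve.bot (i + 1)

/-- Multiplicity two alone forces `t = τ = 0`, hence a closed gap, and the parity of the gap number
fixes the wavenumber. The converse is the cone. -/
lemma diracBelow_eq (h : IsEvenMedium ε μ) (n : ℕ) : diracBelow ε μ (n + 1) =
    (fun i => (edgeWavenumber (i + 1), h.curve.top i)) '' (h.closedGaps n : Set ℕ) := by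
  ext ⟨k, E⟩
  constructor
  · rintro ⟨hk, ⟨-, hf⟩, hE⟩
    obtain ⟨hA, ht, hτ⟩ := h.finrank_blochSpace_eq_two_iff.1 hf
    obtain ⟨i, hi, htouch⟩ := h.curve.exists_touching ht hτ
    refine ⟨i, ?_, ?_⟩
    · simp only [closedGaps, Finset.coe_filter, Finset.mem_range, mem_ofPred_eq]
      refine ⟨?_, htouch⟩
      simp only at hE hi
      -- `i + 1 ≤ n`, with equality for a Dirac point at the lower edge of the band.
      rw [h.bandBottom_succ, hi, htouch, h.curve.bot_strictMono.le_iff_le] at hE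
      omega
    · simp only at hi hA hk
      rw [hi, h.curve.A_top] at hA
      rw [Prod.mk.injEq]
      exact ⟨(eq_edgeWavenumber hk hA.symm).symm, hi.symm⟩
  · rintro ⟨i, hi, hik⟩
    simp only [closedGaps, Finset.coe_filter, Finset.mem_range, mem_ofPred_eq] at hi
    rw [← hik]
    refine ⟨edgeWavenumber_mem _, h.isDiracPoint_of_touching hi.2, ?_⟩
    rw [h.bandBottom_succ]
    exact h.curve.top_le_bot hi.1

lemma finite_diracBelow (h : IsEvenMedium ε μ) (n : ℕ) : (diracBelow ε μ (n + 1)).Finite := by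
  rw [h.diracBelow_eq]
  exact (Finset.finite_toSet _).image _

lemma ncard_diracBelow (h : IsEvenMedium ε μ) (n : ℕ) :
    (diracBelow ε μ (n + 1)).ncard = (h.closedGaps n).card := by
  rw [h.diracBelow_eq, Set.ncard_image_of_injective, Set.ncard_coe_finset]
  intro i j hij
  exact h.curve.top_strictMono.injective (Prod.mk.inj hij).2

end IsEvenMedium

/-! ### Weights of the even and odd parts of a mode, and their limits at band edges. -/

namespace TransferCurve

variable (D : TransferCurve)

/-- Minus half the derivative of `A`. -/
def Δ (E : ℝ) : ℝ := D.t E * D.Q E + D.τ E * D.P E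

/-- The squared coefficient of the even solution in the normalized Bloch mode. -/
def evenWeight (E : ℝ) : ℝ := D.τ E / (2 * D.Δ E)

/-- The squared coefficient of the odd solution in the normalized Bloch mode. -/
def oddWeight (E : ℝ) : ℝ := D.t E / (2 * D.Δ E)

lemma hasDerivAt_t (E : ℝ) : HasDerivAt D.t (2 * D.t E * D.R E + D.A E * D.P E) E :=
  ((D.deriv_a E).mul (D.deriv_c E)).neg.congr_deriv (by unfold t A; ring)

lemma hasDerivAt_τ (E : ℝ) : HasDerivAt D.τ (D.A E * D.Q E - 2 * D.τ E * D.R E) E :=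
  ((D.deriv_b E).mul (D.deriv_d E)).congr_deriv (by unfold τ A; ring)

lemma weights_normalized {E : ℝ} (h : D.Δ E ≠ 0) :
    D.evenWeight E * D.P E + D.oddWeight E * D.Q E = 1 / 2 := by
  unfold evenWeight oddWeight
  field_simp
  unfold Δ
  ring

end TransferCurve

namespace RotatingCurve

variable (D : RotatingCurve)

lemma Δ_pos {n : ℕ} {E : ℝ} (hE : E ∈ Ioo (D.bot n) (D.top n)) : 0 < (-1) ^ n * D.Δ E := by
  have h1 := D.t_pos hE
  have h2 := D.τ_pos hE
  have h3 := D.P_pos E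
  have h4 := D.Q_pos E
  have : 0 < ((-1) ^ n * D.t E) * D.Q E + ((-1) ^ n * D.τ E) * D.P E := by positivity
  unfold TransferCurve.Δ
  linarith

lemma Δ_ne_zero {n : ℕ} {E : ℝ} (hE : E ∈ Ioo (D.bot n) (D.top n)) : D.Δ E ≠ 0 := by
  intro h
  have := D.Δ_pos hE
  rw [h, mul_zero] at this
  exact lt_irrefl _ this

lemma evenWeight_eq (n : ℕ) (E : ℝ) :
    D.evenWeight E = ((-1) ^ n * D.τ E) / (2 * ((-1) ^ n * D.Δ E)) := by
  unfold TransferCurve.evenWeight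
  rw [mul_left_comm, mul_div_mul_left _ _ (pow_ne_zero n (by norm_num))]

lemma oddWeight_eq (n : ℕ) (E : ℝ) :
    D.oddWeight E = ((-1) ^ n * D.t E) / (2 * ((-1) ^ n * D.Δ E)) := by
  unfold TransferCurve.oddWeight
  rw [mul_left_comm, mul_div_mul_left _ _ (pow_ne_zero n (by norm_num))]

lemma evenWeight_pos {n : ℕ} {E : ℝ} (hE : E ∈ Ioo (D.bot n) (D.top n)) : 0 < D.evenWeight E := by
  rw [D.evenWeight_eq n]
  have := D.Δ_pos hE
  have := D.τ_pos hE
  positivity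

lemma oddWeight_pos {n : ℕ} {E : ℝ} (hE : E ∈ Ioo (D.bot n) (D.top n)) : 0 < D.oddWeight E := by
  rw [D.oddWeight_eq n]
  have := D.Δ_pos hE
  have := D.t_pos hE
  positivity

/-- The type of a band edge: `1` at an even mode, `-1` at an odd mode, `0` at a Dirac point. -/
def edgeOverlap (E : ℝ) : ℝ := if D.t E = 0 then (if D.τ E = 0 then 0 else 1) else -1

/-- The limits of the weights at a band edge. -/
lemma exists_weight_limits {n : ℕ} {F : ℝ} (hF : F = D.bot n ∨ F = D.top n) :
    ∃ u v : ℝ, 0 ≤ u ∧ 0 ≤ v ∧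
      Tendsto D.evenWeight (𝓝[Ioo (D.bot n) (D.top n)] F) (𝓝 u) ∧
      Tendsto D.oddWeight (𝓝[Ioo (D.bot n) (D.top n)] F) (𝓝 v) ∧
      2 * (u * D.P F - v * D.Q F) = D.edgeOverlap F := by
  have hne : (𝓝[Ioo (D.bot n) (D.top n)] F).NeBot := by
    rw [← mem_closure_iff_nhdsWithin_neBot, closure_Ioo (D.bot_lt_top n).ne]
    rcases hF with rfl | rfl
    · exact left_mem_Icc.2 (D.bot_lt_top n).le
    · exact right_mem_Icc.2 (D.bot_lt_top n).le
  have hFn : F ∉ Ioo (D.bot n) (D.top n) := by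
    rcases hF with rfl | rfl
    · exact left_notMem_Ioo
    · exact right_notMem_Ioo
  have htτ : D.t F * D.τ F = 0 := by
    have h1 := D.A_sq F
    have h2 : D.A F ^ 2 = 1 := by
      rcases hF with rfl | rfl
      · rw [D.A_bot, ← pow_mul, mul_comm, pow_mul]; simp
      · rw [D.A_top, ← pow_mul, mul_comm, pow_mul]; simp
    linarith
  have hP := D.P_pos F
  have hQ := D.Q_pos F
  have ct : Tendsto D.t (𝓝[Ioo (D.bot n) (D.top n)] F) (𝓝 (D.t F)) :=
    (D.hasDerivAt_t F).continuousAt.tendsto.mono_left nhdsWithin_le_nhds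
  have cτ : Tendsto D.τ (𝓝[Ioo (D.bot n) (D.top n)] F) (𝓝 (D.τ F)) :=
    (D.hasDerivAt_τ F).continuousAt.tendsto.mono_left nhdsWithin_le_nhds
  have cP : Tendsto D.P (𝓝[Ioo (D.bot n) (D.top n)] F) (𝓝 (D.P F)) :=
    D.P_cont.continuousAt.tendsto.mono_left nhdsWithin_le_nhds
  have cQ : Tendsto D.Q (𝓝[Ioo (D.bot n) (D.top n)] F) (𝓝 (D.Q F)) :=
    D.Q_cont.continuousAt.tendsto.mono_left nhdsWithin_le_nhds
  have cΔ : Tendsto D.Δ (𝓝[Ioo (D.bot n) (D.top n)] F) (𝓝 (D.Δ F)) := (ct.mul cQ).add (cτ.mul cP)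
  suffices hlim : ∃ u v : ℝ,
      Tendsto D.evenWeight (𝓝[Ioo (D.bot n) (D.top n)] F) (𝓝 u) ∧
      Tendsto D.oddWeight (𝓝[Ioo (D.bot n) (D.top n)] F) (𝓝 v) ∧
      2 * (u * D.P F - v * D.Q F) = D.edgeOverlap F by
    obtain ⟨u, v, hu, hv, he⟩ := hlim
    refine ⟨u, v, ge_of_tendsto hu ?_, ge_of_tendsto hv ?_, hu, hv, he⟩
    · filter_upwards [self_mem_nhdsWithin] with E hE using (D.evenWeight_pos hE).le
    · filter_upwards [self_mem_nhdsWithin] with E hE using (D.oddWeight_pos hE).le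
  by_cases ht : D.t F = 0
  · by_cases hτ : D.τ F = 0
    -- At a closed gap the weights are `0/0`. There `t' = AP` and `τ' = AQ`, so `Δ` has slope
    -- `2APQ`; the even and odd parts get equal norms and the overlap is 0.
    · refine ⟨1 / (4 * D.P F), 1 / (4 * D.Q F), ?_, ?_, ?_⟩
      pick_goal 3
      · rw [edgeOverlap, if_pos ht, if_pos hτ]
        field_simp
        ring
      all_goals
        have hle : 𝓝[Ioo (D.bot n) (D.top n)] F ≤ 𝓝[≠] F :=
          nhdsWithin_mono _ fun x hx => ne_of_mem_of_not_mem hx hFn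
        have hA : D.A F ≠ 0 := by
          intro h
          have h1 := D.A_sq F
          rw [h, htτ] at h1
          norm_num at h1
        have st : Tendsto (fun E => D.t E / (E - F)) (𝓝[Ioo (D.bot n) (D.top n)] F)
            (𝓝 (D.A F * D.P F)) := by
          have := (hasDerivAt_iff_tendsto_slope.1 (D.hasDerivAt_t F)).mono_left hle
          simpa [slope_fun_def_field, ht] using this
        have sτ : Tendsto (fun E => D.τ E / (E - F)) (𝓝[Ioo (D.bot n) (D.top n)] F)
            (𝓝 (D.A F * D.Q F)) := by
          have := (hasDerivAt_iff_tendsto_slope.1 (D.hasDerivAt_τ F)).mono_left hle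
          simpa [slope_fun_def_field, hτ] using this
        have sΔ : Tendsto (fun E => 2 * (D.t E / (E - F) * D.Q E + D.τ E / (E - F) * D.P E))
            (𝓝[Ioo (D.bot n) (D.top n)] F)
            (𝓝 (2 * (D.A F * D.P F * D.Q F + D.A F * D.Q F * D.P F))) :=
          ((st.mul cQ).add (sτ.mul cP)).const_mul 2
        have hne0 : 2 * (D.A F * D.P F * D.Q F + D.A F * D.Q F * D.P F) ≠ 0 := by
          rw [show 2 * (D.A F * D.P F * D.Q F + D.A F * D.Q F * D.P F) =
            4 * (D.A F * (D.P F * D.Q F)) by ring]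
          have := (mul_pos hP hQ).ne'
          positivity
      · have := sτ.div sΔ hne0
        rw [show D.A F * D.Q F / (2 * (D.A F * D.P F * D.Q F + D.A F * D.Q F * D.P F)) =
          1 / (4 * D.P F) by field_simp; norm_num] at this
        refine this.congr' ?_
        filter_upwards [self_mem_nhdsWithin] with E hE
        have hEF : E - F ≠ 0 := sub_ne_zero.2 (ne_of_mem_of_not_mem hE hFn)
        have := D.Δ_ne_zero hE
        simp only [Pi.div_apply, TransferCurve.evenWeight]
        rw [show 2 * (D.t E / (E - F) * D.Q E + D.τ E / (E - F) * D.P E) =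
          2 * D.Δ E / (E - F) by unfold TransferCurve.Δ; ring]
        field_simp
      · have := st.div sΔ hne0
        rw [show D.A F * D.P F / (2 * (D.A F * D.P F * D.Q F + D.A F * D.Q F * D.P F)) =
          1 / (4 * D.Q F) by field_simp; norm_num] at this
        refine this.congr' ?_
        filter_upwards [self_mem_nhdsWithin] with E hE
        have hEF : E - F ≠ 0 := sub_ne_zero.2 (ne_of_mem_of_not_mem hE hFn)
        have := D.Δ_ne_zero hE
        simp only [Pi.div_apply, TransferCurve.oddWeight]
        rw [show 2 * (D.t E / (E - F) * D.Q E + D.τ E / (E - F) * D.P E) =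
          2 * D.Δ E / (E - F) by unfold TransferCurve.Δ; ring]
        field_simp
    · have hΔ : D.Δ F ≠ 0 := by
        unfold TransferCurve.Δ
        rw [ht, zero_mul, zero_add]
        exact mul_ne_zero hτ hP.ne'
      refine ⟨_, _, cτ.div (cΔ.const_mul 2) (mul_ne_zero two_ne_zero hΔ),
        ct.div (cΔ.const_mul 2) (mul_ne_zero two_ne_zero hΔ), ?_⟩
      rw [edgeOverlap, if_pos ht, if_neg hτ]
      field_simp
      unfold TransferCurve.Δ
      rw [ht]
      ring
  · have hτ : D.τ F = 0 := (mul_eq_zero.1 htτ).resolve_left ht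
    have hΔ : D.Δ F ≠ 0 := by
      unfold TransferCurve.Δ
      rw [hτ, zero_mul, add_zero]
      exact mul_ne_zero ht hQ.ne'
    refine ⟨_, _, cτ.div (cΔ.const_mul 2) (mul_ne_zero two_ne_zero hΔ),
      ct.div (cΔ.const_mul 2) (mul_ne_zero two_ne_zero hΔ), ?_⟩
    rw [edgeOverlap, if_neg ht]
    field_simp
    unfold TransferCurve.Δ
    rw [hτ]
    ring

end RotatingCurve

/-! ### Normalized Bloch modes. -/

namespace IsEvenMedium

variable {ε μ : ℝ → ℝ}

lemma integral_symm_interval {f : ℝ → ℝ} (hf : ∀ a b, IntervalIntegrable f volume a b) (c : ℝ) :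
    ∫ x in (-c)..c, f x = ∫ x in (0 : ℝ)..c, (f (-x) + f x) := by
  have h1 : IntervalIntegrable (fun x => f (-x)) volume 0 c := by
    have := IntervalIntegrable.comp_sub_left (hf 0 (-c)) 0
    simpa using this
  rw [intervalIntegral.integral_add h1 (hf _ _), intervalIntegral.integral_comp_neg,
    neg_zero, intervalIntegral.integral_add_adjacent_intervals (hf _ _) (hf _ _)]

/-- Integral over a period of a periodic function with even real and odd imaginary part. -/
lemma integral_period (h : IsEvenMedium ε μ) {g : ℝ → ℂ} {U V : ℝ → ℝ}
    (hp : ∀ x, g (x + 1) = g x) (hU : Continuous U) (hV : Continuous V)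
    (hUe : ∀ x, U (-x) = U x) (hVo : ∀ x, V (-x) = -V x)
    (hg : ∀ x, g x = U x + Complex.I * V x) :
    ∫ x in (0 : ℝ)..1, (ε x : ℂ) * g x = ((2 * ∫ x in (0 : ℝ)..(1 / 2), ε x * U x : ℝ) : ℂ) := by
  have hper : Function.Periodic (fun x => (ε x : ℂ) * g x) 1 := fun x => by
    simp only [hp x, h.ε_coef.periodic x]
  -- The shift to a symmetric interval precedes the splitting because only `g` is periodic: in the
  -- Berry connection `V` contains a factor `x`.
  have h1 := hper.intervalIntegral_add_eq 0 (-(1 / 2))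
  rw [zero_add, show (-(1 / 2) + 1 : ℝ) = 1 / 2 by norm_num] at h1
  rw [h1]
  have iU := fun a b => h.ε_coef.intervalIntegrable_mul hU a b
  have iV := fun a b => h.ε_coef.intervalIntegrable_mul hV a b
  have h2 : ∫ x in (-(1 / 2) : ℝ)..(1 / 2), (ε x : ℂ) * g x =
      ((∫ x in (-(1 / 2) : ℝ)..(1 / 2), ε x * U x : ℝ) : ℂ) +
      Complex.I * ((∫ x in (-(1 / 2) : ℝ)..(1 / 2), ε x * V x : ℝ) : ℂ) := by
    rw [← intervalIntegral.integral_ofReal, ← intervalIntegral.integral_ofReal,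
      ← intervalIntegral.integral_const_mul, ← intervalIntegral.integral_add]
    · refine intervalIntegral.integral_congr fun x _ => ?_
      simp only [hg x]
      push_cast
      ring
    · exact ⟨(iU _ _).1.ofReal, (iU _ _).2.ofReal⟩
    · exact IntervalIntegrable.const_mul ⟨(iV _ _).1.ofReal, (iV _ _).2.ofReal⟩ _
  rw [h2, integral_symm_interval iU, integral_symm_interval iV]
  have h3 : ∫ x in (0 : ℝ)..(1 / 2), (ε (-x) * V (-x) + ε x * V x) = 0 := by
    rw [intervalIntegral.integral_congr (g := fun _ => (0 : ℝ)) fun x _ => by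
      simp only [h.ε_even, hVo]; ring]
    simp
  have h4 : ∫ x in (0 : ℝ)..(1 / 2), (ε (-x) * U (-x) + ε x * U x) =
      2 * ∫ x in (0 : ℝ)..(1 / 2), ε x * U x := by
    rw [← intervalIntegral.integral_const_mul]
    refine intervalIntegral.integral_congr fun x _ => ?_
    simp only [h.ε_even, hUe]
    ring
  rw [h3, h4]
  simp

lemma integral_comb_sq (h : IsEvenMedium ε μ) (E p q : ℝ) :
    ∫ x in (0 : ℝ)..(1 / 2), ε x * (p * sol₁ ε μ E x ^ 2 + q * sol₂ ε μ E x ^ 2) =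
      p * h.curve.P E + q * h.curve.Q E := by
  have c1 := (h.isRealSolution₁ E).continuous_sol
  have c2 := (h.isRealSolution₂ E).continuous_sol
  have i1 := (h.ε_coef.intervalIntegrable_mul
    (g := fun x => sol₁ ε μ E x * sol₁ ε μ E x) (c1.mul c1) 0 (1 / 2)).const_mul p
  have i2 := (h.ε_coef.intervalIntegrable_mul
    (g := fun x => sol₂ ε μ E x * sol₂ ε μ E x) (c2.mul c2) 0 (1 / 2)).const_mul q
  change _ = p * (∫ x in (0 : ℝ)..(1 / 2), ε x * (sol₁ ε μ E x * sol₁ ε μ E x)) +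
    q * (∫ x in (0 : ℝ)..(1 / 2), ε x * (sol₂ ε μ E x * sol₂ ε μ E x))
  rw [← intervalIntegral.integral_const_mul, ← intervalIntegral.integral_const_mul,
    ← intervalIntegral.integral_add i1 i2]
  refine intervalIntegral.integral_congr fun x _ => ?_
  ring

lemma norm_comb_sq (E p q x : ℝ) :
    ‖comb ε μ E p (Complex.I * q) x‖ ^ 2 = p ^ 2 * sol₁ ε μ E x ^ 2 + q ^ 2 * sol₂ ε μ E x ^ 2 := by
  rw [← Complex.normSq_eq_norm_sq, Complex.normSq_apply]
  simp [comb]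
  ring

lemma integral_norm_comb (h : IsEvenMedium ε μ) {k E p q : ℝ}
    (hB : comb ε μ E p (Complex.I * q) ∈ blochSpace ε μ k E) :
    ∫ x in (0 : ℝ)..1, ε x * ‖comb ε μ E p (Complex.I * q) x‖ ^ 2 =
      2 * (p ^ 2 * h.curve.P E + q ^ 2 * h.curve.Q E) := by
  have c1 := (h.isRealSolution₁ E).continuous_sol
  have c2 := (h.isRealSolution₂ E).continuous_sol
  have h1 := h.integral_period
    (g := fun x => ((‖comb ε μ E p (Complex.I * q) x‖ ^ 2 : ℝ) : ℂ))
    (U := fun x => p ^ 2 * sol₁ ε μ E x ^ 2 + q ^ 2 * sol₂ ε μ E x ^ 2) (V := fun _ => 0)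
    (fun x => by
      rw [hB.2 x, norm_mul, mul_comm Complex.I (k : ℂ), Complex.norm_exp_ofReal_mul_I, one_mul])
    (by fun_prop) continuous_const (fun x => by rw [h.sol₁_neg, h.sol₂_neg]; ring) (by simp)
    (fun x => by rw [norm_comb_sq]; simp)
  rw [h.integral_comb_sq] at h1
  rw [← Complex.ofReal_inj, ← h1, ← intervalIntegral.integral_ofReal]
  refine intervalIntegral.integral_congr fun x _ => ?_
  push_cast
  ring

/-- The amplitude of the even solution in the normalized Bloch mode. -/
def evenAmp (h : IsEvenMedium ε μ) (n : ℕ) (E : ℝ) : ℝ := (-1) ^ n * √(h.curve.evenWeight E)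

/-- The amplitude of the odd solution in the normalized Bloch mode. -/
def oddAmp (h : IsEvenMedium ε μ) (E : ℝ) : ℝ := √(h.curve.oddWeight E)

lemma abs_cos_lt_one {k : ℝ} (hk : k ∈ Ioo 0 π) : |cos k| < 1 := by
  have h1 := Real.sin_pos_of_mem_Ioo hk
  have h2 := Real.sin_sq_add_cos_sq k
  rw [← sq_lt_one_iff_abs_lt_one]
  have : 0 < sin k ^ 2 := by positivity
  linarith

/-- On the band `ψ_{E,1}(1) = A = cos k`, so `e^{ik} - ψ_{E,1}(1)` is purely imaginary. The mode has
a real even part and an imaginary odd part. -/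
lemma rawMode_eq (h : IsEvenMedium ε μ) (n : ℕ) (k : ℝ) :
    rawMode ε μ (n + 1) k = comb ε μ (h.curve.energy n k)
      ((2 * h.curve.τ (h.curve.energy n k) : ℝ) : ℂ) (Complex.I * (sin k : ℝ)) := by
  funext x
  have hm := h.monodromy (h.curve.energy n k)
  simp only [rawMode, h.bandFn_succ, h.fundSol₁_eq, h.fundSol₂_eq, comb, hm.1, hm.2.2.1,
    h.curve.A_energy]
  rw [mul_comm Complex.I (k : ℂ), Complex.exp_mul_I]
  push_cast
  ring

lemma rawMode_mem (h : IsEvenMedium ε μ) (n : ℕ) (k : ℝ) :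
    rawMode ε μ (n + 1) k ∈ blochSpace ε μ k (h.curve.energy n k) := by
  rw [h.rawMode_eq, h.mem_blochSpace_iff]
  have hA := h.curve.A_energy n k
  have hsq := h.curve.A_sq (h.curve.energy n k)
  rw [hA] at hsq
  have hs : sin k ^ 2 = 4 * (h.curve.t (h.curve.energy n k) * h.curve.τ (h.curve.energy n k)) := by
    have := Real.sin_sq_add_cos_sq k
    linarith
  have hs' : (sin k : ℂ) ^ 2 =
      4 * (h.curve.t (h.curve.energy n k) * h.curve.τ (h.curve.energy n k)) := by exact_mod_cast hs
  have hexp : Complex.exp (Complex.I * k) = (cos k : ℝ) + Complex.I * (sin k : ℝ) := by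
    rw [mul_comm Complex.I (k : ℂ), Complex.exp_mul_I]
    push_cast
    ring
  refine ⟨_, _, rfl, ?_, ?_⟩
  · rw [hexp, hA]
    push_cast
    ring
  · rw [hexp, hA]
    push_cast at hs' ⊢
    linear_combination hs' - (Complex.sin k) ^ 2 * Complex.I_sq

/-- Since `sin² k = 4tτ`, the raw mode has squared norm `8τΔ`, and dividing leaves the squared
coefficients `τ/(2Δ)` and `t/(2Δ)`. The signs are those of `τ`, namely `(-1)^n`, and of `sin k > 0`.
-/
lemma blochMode_eq (h : IsEvenMedium ε μ) (n : ℕ) {k : ℝ} (hk : k ∈ Ioo 0 π) (x : ℝ) :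
    blochMode ε μ (n + 1) k x = comb ε μ (h.curve.energy n k)
      (h.evenAmp n (h.curve.energy n k)) (Complex.I * h.oddAmp (h.curve.energy n k)) x := by
  have hE := h.curve.energy_mem_Ioo (n := n) (abs_cos_lt_one hk)
  have hsin := Real.sin_pos_of_mem_Ioo hk
  have hA := h.curve.A_energy n k
  have hsq := h.curve.A_sq (h.curve.energy n k)
  rw [hA] at hsq
  have hmem := h.rawMode_mem n k
  have hnorm : normX ε (rawMode ε μ (n + 1) k) =
      √(8 * (h.curve.τ (h.curve.energy n k) * h.curve.Δ (h.curve.energy n k))) := by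
    unfold normX
    rw [h.rawMode_eq] at hmem ⊢
    rw [h.integral_norm_comb hmem]
    congr 1
    have := Real.sin_sq_add_cos_sq k
    have hs : sin k ^ 2 = 4 * (h.curve.t (h.curve.energy n k) * h.curve.τ (h.curve.energy n k)) := by
      linarith
    rw [hs]
    unfold TransferCurve.Δ
    ring
  rw [blochMode, if_pos hk.1.le, hnorm, h.rawMode_eq]
  generalize h.curve.energy n k = E at *
  have hτ := h.curve.τ_pos hE
  have ht := h.curve.t_pos hE
  have hΔ := h.curve.Δ_pos hE
  have hΔ0 := h.curve.Δ_ne_zero hE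
  have hev := h.curve.evenWeight_eq n E
  have hodd := h.curve.oddWeight_eq n E
  have hσ : ((-1 : ℝ) ^ n) * (-1) ^ n = 1 := by rw [← mul_pow]; simp
  set σ : ℝ := (-1) ^ n
  have hN : 8 * (h.curve.τ E * h.curve.Δ E) = 8 * ((σ * h.curve.τ E) * (σ * h.curve.Δ E)) := by
    linear_combination (-8 * (h.curve.τ E * h.curve.Δ E)) * hσ
  rw [hN]
  set N := √(8 * ((σ * h.curve.τ E) * (σ * h.curve.Δ E))) with hNdef
  have hN0 : 0 < N := Real.sqrt_pos.2 (by positivity)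
  have e1 : 2 * h.curve.τ E = N * h.evenAmp n E := by
    have h1 : N * √(h.curve.evenWeight E) = 2 * (σ * h.curve.τ E) := by
      rw [hNdef, ← Real.sqrt_mul (by positivity), hev]
      rw [show 8 * ((σ * h.curve.τ E) * (σ * h.curve.Δ E)) *
        ((σ * h.curve.τ E) / (2 * (σ * h.curve.Δ E))) = (2 * (σ * h.curve.τ E)) ^ 2 by
          field_simp; ring]
      exact Real.sqrt_sq (by positivity)
    unfold evenAmp
    linear_combination (-σ) * h1 - 2 * h.curve.τ E * hσ
  have e2 : sin k = N * h.oddAmp E := by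
    unfold oddAmp
    rw [hNdef, ← Real.sqrt_mul (by positivity), hodd]
    rw [show 8 * ((σ * h.curve.τ E) * (σ * h.curve.Δ E)) *
      ((σ * h.curve.t E) / (2 * (σ * h.curve.Δ E))) = 4 * ((σ * h.curve.t E) * (σ * h.curve.τ E)) by
        field_simp; ring]
    have := Real.sin_sq_add_cos_sq k
    rw [show 4 * ((σ * h.curve.t E) * (σ * h.curve.τ E)) = sin k ^ 2 by
      linear_combination hsq - this + (4 * h.curve.t E * h.curve.τ E) * hσ]
    exact (Real.sqrt_sq hsin.le).symm
  rw [e1, e2]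
  have hNc : (N : ℂ) ≠ 0 := by exact_mod_cast hN0.ne'
  simp only [comb]
  push_cast
  field_simp

lemma comb_mem (h : IsEvenMedium ε μ) (n : ℕ) {k : ℝ} (hk : k ∈ Ioo 0 π) :
    comb ε μ (h.curve.energy n k) (h.evenAmp n (h.curve.energy n k))
      (Complex.I * h.oddAmp (h.curve.energy n k)) ∈ blochSpace ε μ k (h.curve.energy n k) := by
  have h1 : comb ε μ (h.curve.energy n k) (h.evenAmp n (h.curve.energy n k))
      (Complex.I * h.oddAmp (h.curve.energy n k)) =
      (normX ε (rawMode ε μ (n + 1) k) : ℂ)⁻¹ • rawMode ε μ (n + 1) k := by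
    funext x
    rw [← h.blochMode_eq n hk, blochMode, if_pos hk.1.le, Pi.smul_apply, smul_eq_mul]
    ring
  rw [h1]
  exact Submodule.smul_mem _ _ (h.rawMode_mem n k)

/-! ### The Berry connection vanishes -/

lemma dsol₁_neg (h : IsEvenMedium ε μ) (E x : ℝ) : dsol₁ ε μ E (-x) = dsol₁ ε μ E x := by
  have h1 := h.hasDerivAt_sol₁ E (-x)
  simp only [h.sol₁_neg] at h1
  exact h1.unique (h.hasDerivAt_sol₁ E x)

lemma dsol₂_neg (h : IsEvenMedium ε μ) (E x : ℝ) : dsol₂ ε μ E (-x) = -dsol₂ ε μ E x := by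
  have h1 := h.hasDerivAt_sol₂ E (-x)
  simp only [h.sol₂_neg] at h1
  exact h1.unique (h.hasDerivAt_sol₂ E x).neg

lemma hasDerivAt_P (h : IsEvenMedium ε μ) (E : ℝ) : HasDerivAt h.curve.P
    (2 * ∫ x in (0 : ℝ)..(1 / 2), ε x * (sol₁ ε μ E x * dsol₁ ε μ E x)) E := by
  refine (h.ε_coef.hasDerivAt_param (G := fun E t => sol₁ ε μ E t * sol₁ ε μ E t)
    (G' := fun E t => dsol₁ ε μ E t * sol₁ ε μ E t + sol₁ ε μ E t * dsol₁ ε μ E t)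
    (h.continuous_sol₁.mul h.continuous_sol₁)
    ((h.continuous_dsol₁.mul h.continuous_sol₁).add (h.continuous_sol₁.mul h.continuous_dsol₁))
    (fun E x => (h.hasDerivAt_sol₁ E x).mul (h.hasDerivAt_sol₁ E x)) 0 (1 / 2) E).congr_deriv ?_
  rw [← intervalIntegral.integral_const_mul]
  exact intervalIntegral.integral_congr fun x _ => by ring

lemma hasDerivAt_Q (h : IsEvenMedium ε μ) (E : ℝ) : HasDerivAt h.curve.Q
    (2 * ∫ x in (0 : ℝ)..(1 / 2), ε x * (sol₂ ε μ E x * dsol₂ ε μ E x)) E := by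
  refine (h.ε_coef.hasDerivAt_param (G := fun E t => sol₂ ε μ E t * sol₂ ε μ E t)
    (G' := fun E t => dsol₂ ε μ E t * sol₂ ε μ E t + sol₂ ε μ E t * dsol₂ ε μ E t)
    (h.continuous_sol₂.mul h.continuous_sol₂)
    ((h.continuous_dsol₂.mul h.continuous_sol₂).add (h.continuous_sol₂.mul h.continuous_dsol₂))
    (fun E x => (h.hasDerivAt_sol₂ E x).mul (h.hasDerivAt_sol₂ E x)) 0 (1 / 2) E).congr_deriv ?_
  rw [← intervalIntegral.integral_const_mul]
  exact intervalIntegral.integral_congr fun x _ => by ring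

lemma hasDerivAt_periodicPart (h : IsEvenMedium ε μ) {j : ℕ} {k : ℝ} {e f g : ℝ → ℝ}
    {e' f' g' : ℝ} (he : HasDerivAt e e' k) (hf : HasDerivAt f f' k) (hg : HasDerivAt g g' k)
    (hm : ∀ᶠ k' in 𝓝 k, ∀ x, blochMode ε μ j k' x =
      comb ε μ (e k') (f k') (Complex.I * g k') x) (x : ℝ) :
    HasDerivAt (fun k' : ℝ => periodicPart ε μ j k' x)
      (Complex.exp (-(Complex.I * k * x)) * (-(Complex.I * x) *
        (f k * sol₁ ε μ (e k) x + Complex.I * (g k * sol₂ ε μ (e k) x)) +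
        ((f' * sol₁ ε μ (e k) x + f k * (dsol₁ ε μ (e k) x * e')) +
        Complex.I * (g' * sol₂ ε μ (e k) x + g k * (dsol₂ ε μ (e k) x * e'))))) k := by
  have d1 : HasDerivAt (fun k' => f k' * sol₁ ε μ (e k') x)
      (f' * sol₁ ε μ (e k) x + f k * (dsol₁ ε μ (e k) x * e')) k :=
    hf.mul ((h.hasDerivAt_sol₁ (e k) x).comp k he)
  have d2 : HasDerivAt (fun k' => g k' * sol₂ ε μ (e k') x)
      (g' * sol₂ ε μ (e k) x + g k * (dsol₂ ε μ (e k) x * e')) k :=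
    hg.mul ((h.hasDerivAt_sol₂ (e k) x).comp k he)
  have d3 : HasDerivAt (fun k' : ℝ => Complex.exp (-(Complex.I * k' * x)))
      (Complex.exp (-(Complex.I * k * x)) * (-(Complex.I * x))) k := by
    have h0 : HasDerivAt (fun k' : ℝ => -(Complex.I * (k' : ℂ) * x)) (-(Complex.I * x)) k := by
      have := (((hasDerivAt_id k).ofReal_comp.const_mul Complex.I).mul_const (x : ℂ)).neg
      exact this.congr_deriv (by simp)
    exact h0.cexp
  refine ((d3.mul (d1.ofReal_comp.add (d2.ofReal_comp.const_mul Complex.I))).congr_deriv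
    ?_).congr_of_eventuallyEq ?_
  · simp only [Pi.add_apply]
    push_cast
    ring
  · filter_upwards [hm] with k' hk'
    simp only [periodicPart, hk' x, comb, Pi.mul_apply, Pi.add_apply]
    push_cast
    ring

lemma periodicPart_add_one {k E : ℝ} {j : ℕ} {ψ : ℝ → ℂ}
    (hψ : ψ ∈ blochSpace ε μ k E) (hm : ∀ x, blochMode ε μ j k x = ψ x) (x : ℝ) :
    periodicPart ε μ j k (x + 1) = periodicPart ε μ j k x := by
  simp only [periodicPart, hm, hψ.2 x]
  rw [← mul_assoc, ← Complex.exp_add]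
  congr 2
  push_cast
  ring

/-- The integrand is `U + iV` with `U` even and `V` odd, so `V` drops out, and twice the half-period
integral of `εU` is the `k`-derivative of `f²P + g²Q`, which normalization keeps equal to `1/2`. -/
lemma integral_berry_eq_zero (h : IsEvenMedium ε μ) {j : ℕ} {k : ℝ} {e f g : ℝ → ℝ}
    {e' f' g' : ℝ} (he : HasDerivAt e e' k) (hf : HasDerivAt f f' k) (hg : HasDerivAt g g' k)
    (hm : ∀ᶠ k' in 𝓝 k, ∀ x, blochMode ε μ j k' x =
      comb ε μ (e k') (f k') (Complex.I * g k') x)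
    (hB : ∀ᶠ k' in 𝓝 k, comb ε μ (e k') (f k') (Complex.I * g k') ∈ blochSpace ε μ k' (e k'))
    (hn : ∀ᶠ k' in 𝓝 k, f k' ^ 2 * h.curve.P (e k') + g k' ^ 2 * h.curve.Q (e k') = 1 / 2) :
    (∀ x, deriv (fun k' : ℝ => periodicPart ε μ j k' (x + 1)) k *
      (starRingEnd ℂ) (periodicPart ε μ j k (x + 1)) =
      deriv (fun k' : ℝ => periodicPart ε μ j k' x) k *
      (starRingEnd ℂ) (periodicPart ε μ j k x)) ∧
    ∫ x in (0 : ℝ)..1, (ε x : ℂ) * (deriv (fun k' : ℝ => periodicPart ε μ j k' x) k *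
      (starRingEnd ℂ) (periodicPart ε μ j k x)) = 0 := by
  have c1 := (h.isRealSolution₁ (e k)).continuous_sol
  have c2 := (h.isRealSolution₂ (e k)).continuous_sol
  have c3 : Continuous (dsol₁ ε μ (e k)) := h.continuous_dsol₁.comp (Continuous.prodMk_right _)
  have c4 : Continuous (dsol₂ ε μ (e k)) := h.continuous_dsol₂.comp (Continuous.prodMk_right _)
  have hper : ∀ x, deriv (fun k' : ℝ => periodicPart ε μ j k' (x + 1)) k *
      (starRingEnd ℂ) (periodicPart ε μ j k (x + 1)) =
      deriv (fun k' : ℝ => periodicPart ε μ j k' x) k *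
      (starRingEnd ℂ) (periodicPart ε μ j k x) := by
    intro x
    have hev : ∀ᶠ k' in 𝓝 k, periodicPart ε μ j k' (x + 1) = periodicPart ε μ j k' x := by
      filter_upwards [hm, hB] with k' h1 h2 using periodicPart_add_one h2 h1 x
    rw [hev.self_of_nhds]
    congr 1
    exact EventuallyEq.deriv_eq hev
  refine ⟨hper, ?_⟩
  rw [h.integral_period
    (U := fun x => (f k * f' * sol₁ ε μ (e k) x ^ 2 + g k * g' * sol₂ ε μ (e k) x ^ 2) +
      e' * (f k ^ 2 * (sol₁ ε μ (e k) x * dsol₁ ε μ (e k) x) +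
        g k ^ 2 * (sol₂ ε μ (e k) x * dsol₂ ε μ (e k) x)))
    (V := fun x => f k * sol₁ ε μ (e k) x *
        (g' * sol₂ ε μ (e k) x + g k * (dsol₂ ε μ (e k) x * e')) -
      g k * sol₂ ε μ (e k) x * (f' * sol₁ ε μ (e k) x + f k * (dsol₁ ε μ (e k) x * e')) -
      x * ((f k * sol₁ ε μ (e k) x) ^ 2 + (g k * sol₂ ε μ (e k) x) ^ 2))
    hper (by fun_prop) (by fun_prop)
    (fun x => by simp only [h.sol₁_neg, h.sol₂_neg, h.dsol₁_neg, h.dsol₂_neg]; ring)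
    (fun x => by simp only [h.sol₁_neg, h.sol₂_neg, h.dsol₁_neg, h.dsol₂_neg]; ring)
    (fun x => ?_)]
  · rw [Complex.ofReal_eq_zero]
    have hd := ((hf.pow 2).mul ((h.hasDerivAt_P (e k)).comp k he)).add
      ((hg.pow 2).mul ((h.hasDerivAt_Q (e k)).comp k he))
    have h0 := hd.unique ((hasDerivAt_const k (1 / 2 : ℝ)).congr_of_eventuallyEq hn)
    have i1 := h.ε_coef.intervalIntegrable_mul (g := fun x => f k * f' * sol₁ ε μ (e k) x ^ 2 +
      g k * g' * sol₂ ε μ (e k) x ^ 2) (by fun_prop) 0 (1 / 2)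
    have i2 := h.ε_coef.intervalIntegrable_mul (g := fun x => sol₁ ε μ (e k) x * dsol₁ ε μ (e k) x)
      (by fun_prop) 0 (1 / 2)
    have i3 := h.ε_coef.intervalIntegrable_mul (g := fun x => sol₂ ε μ (e k) x * dsol₂ ε μ (e k) x)
      (by fun_prop) 0 (1 / 2)
    have hsplit : ∫ x in (0 : ℝ)..(1 / 2), ε x *
        ((f k * f' * sol₁ ε μ (e k) x ^ 2 + g k * g' * sol₂ ε μ (e k) x ^ 2) +
        e' * (f k ^ 2 * (sol₁ ε μ (e k) x * dsol₁ ε μ (e k) x) +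
        g k ^ 2 * (sol₂ ε μ (e k) x * dsol₂ ε μ (e k) x))) =
        (f k * f' * h.curve.P (e k) + g k * g' * h.curve.Q (e k)) +
        (e' * f k ^ 2 * (∫ x in (0 : ℝ)..(1 / 2), ε x * (sol₁ ε μ (e k) x * dsol₁ ε μ (e k) x)) +
        e' * g k ^ 2 * ∫ x in (0 : ℝ)..(1 / 2), ε x * (sol₂ ε μ (e k) x * dsol₂ ε μ (e k) x)) := by
      rw [← h.integral_comb_sq, ← intervalIntegral.integral_const_mul,
        ← intervalIntegral.integral_const_mul,
        ← intervalIntegral.integral_add (i2.const_mul _) (i3.const_mul _),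
        ← intervalIntegral.integral_add i1 ((i2.const_mul _).add (i3.const_mul _))]
      refine intervalIntegral.integral_congr fun x _ => ?_
      ring
    rw [hsplit]
    simp only [Function.comp_apply, Pi.pow_apply] at h0
    push_cast at h0
    linear_combination h0
  · have hexp : Complex.exp (-(Complex.I * k * x)) *
        (starRingEnd ℂ) (Complex.exp (-(Complex.I * k * x))) = 1 := by
      rw [← Complex.exp_conj, ← Complex.exp_add]
      simp
    rw [(h.hasDerivAt_periodicPart he hf hg hm x).deriv]
    simp only [periodicPart, hm.self_of_nhds x, comb, map_mul, map_add, Complex.conj_I,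
      Complex.conj_ofReal]
    generalize hc : (starRingEnd ℂ) (Complex.exp (-(Complex.I * k * x))) = c at hexp
    generalize Complex.exp (-(Complex.I * k * x)) = d at hexp
    push_cast
    linear_combination ((-(Complex.I * x) * (f k * sol₁ ε μ (e k) x +
        Complex.I * (g k * sol₂ ε μ (e k) x)) +
        ((f' * sol₁ ε μ (e k) x + f k * (dsol₁ ε μ (e k) x * e')) +
        Complex.I * (g' * sol₂ ε μ (e k) x + g k * (dsol₂ ε μ (e k) x * e')))) *
        (f k * sol₁ ε μ (e k) x - Complex.I * (g k * sol₂ ε μ (e k) x))) * hexp +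
      (Complex.I * x * (g k * sol₂ ε μ (e k) x) ^ 2 - (g k * sol₂ ε μ (e k) x) *
        (g' * sol₂ ε μ (e k) x + g k * (dsol₂ ε μ (e k) x * e'))) * Complex.I_sq

lemma differentiableAt_evenWeight (h : IsEvenMedium ε μ) {n : ℕ} {E : ℝ}
    (hE : E ∈ Ioo (h.curve.bot n) (h.curve.top n)) :
    DifferentiableAt ℝ h.curve.evenWeight E :=
  (h.curve.hasDerivAt_τ E).differentiableAt.div
    ((((h.curve.hasDerivAt_t E).differentiableAt.mul (h.hasDerivAt_Q E).differentiableAt).add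
      ((h.curve.hasDerivAt_τ E).differentiableAt.mul
        (h.hasDerivAt_P E).differentiableAt)).const_mul 2)
    (mul_ne_zero two_ne_zero (h.curve.Δ_ne_zero hE))

lemma differentiableAt_oddWeight (h : IsEvenMedium ε μ) {n : ℕ} {E : ℝ}
    (hE : E ∈ Ioo (h.curve.bot n) (h.curve.top n)) :
    DifferentiableAt ℝ h.curve.oddWeight E :=
  (h.curve.hasDerivAt_t E).differentiableAt.div
    ((((h.curve.hasDerivAt_t E).differentiableAt.mul (h.hasDerivAt_Q E).differentiableAt).add
      ((h.curve.hasDerivAt_τ E).differentiableAt.mul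
        (h.hasDerivAt_P E).differentiableAt)).const_mul 2)
    (mul_ne_zero two_ne_zero (h.curve.Δ_ne_zero hE))

lemma amp_normalized (h : IsEvenMedium ε μ) {n : ℕ} {E : ℝ}
    (hE : E ∈ Ioo (h.curve.bot n) (h.curve.top n)) :
    h.evenAmp n E ^ 2 * h.curve.P E + h.oddAmp E ^ 2 * h.curve.Q E = 1 / 2 := by
  rw [evenAmp, oddAmp, mul_pow, Real.sq_sqrt (h.curve.evenWeight_pos hE).le,
    Real.sq_sqrt (h.curve.oddWeight_pos hE).le, ← pow_mul, mul_comm n, pow_mul]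
  simpa using h.curve.weights_normalized (h.curve.Δ_ne_zero hE)

/-- On the right half-zone the periodic part is differentiable in the wavenumber, and the Berry
connection vanishes. -/
lemma berry_right (h : IsEvenMedium ε μ) (n : ℕ) {k : ℝ} (hk : k ∈ Ioo 0 π) :
    (∀ x, DifferentiableAt ℝ (fun k' : ℝ => periodicPart ε μ (n + 1) k' x) k) ∧
    (∀ x, deriv (fun k' : ℝ => periodicPart ε μ (n + 1) k' (x + 1)) k *
      (starRingEnd ℂ) (periodicPart ε μ (n + 1) k (x + 1)) =
      deriv (fun k' : ℝ => periodicPart ε μ (n + 1) k' x) k *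
      (starRingEnd ℂ) (periodicPart ε μ (n + 1) k x)) ∧
    ∫ x in (0 : ℝ)..1, (ε x : ℂ) * (deriv (fun k' : ℝ => periodicPart ε μ (n + 1) k' x) k *
      (starRingEnd ℂ) (periodicPart ε μ (n + 1) k x)) = 0 := by
  have hev : ∀ᶠ k' in 𝓝 k, k' ∈ Ioo 0 π := isOpen_Ioo.mem_nhds hk
  have hE := h.curve.energy_mem_Ioo (n := n) (abs_cos_lt_one hk)
  have he := (h.curve.differentiableAt_energy (n := n) (abs_cos_lt_one hk)).hasDerivAt
  have hf : DifferentiableAt ℝ (fun k => h.evenAmp n (h.curve.energy n k)) k :=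
    ((((h.differentiableAt_evenWeight hE).sqrt (h.curve.evenWeight_pos hE).ne').const_mul
      ((-1) ^ n)).hasDerivAt.comp k he).differentiableAt
  have hg : DifferentiableAt ℝ (fun k => h.oddAmp (h.curve.energy n k)) k :=
    (((h.differentiableAt_oddWeight hE).sqrt
      (h.curve.oddWeight_pos hE).ne').hasDerivAt.comp k he).differentiableAt
  have hm : ∀ᶠ k' in 𝓝 k, ∀ x, blochMode ε μ (n + 1) k' x = comb ε μ (h.curve.energy n k')
      (h.evenAmp n (h.curve.energy n k')) (Complex.I * h.oddAmp (h.curve.energy n k')) x :=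
    hev.mono fun k' hk' x => h.blochMode_eq n hk' x
  exact ⟨fun x => (h.hasDerivAt_periodicPart he hf.hasDerivAt hg.hasDerivAt hm x).differentiableAt,
    h.integral_berry_eq_zero he hf.hasDerivAt hg.hasDerivAt hm
      (hev.mono fun k' hk' => h.comb_mem n hk')
      (hev.mono fun k' hk' => h.amp_normalized (h.curve.energy_mem_Ioo (abs_cos_lt_one hk')))⟩

lemma blochMode_neg {j : ℕ} {k : ℝ} (hk : k < 0) (x : ℝ) :
    blochMode ε μ j k x = blochMode ε μ j (-k) (-x) := by
  rw [blochMode, blochMode, if_neg hk.not_ge, if_pos (by linarith)]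

lemma periodicPart_neg {j : ℕ} {k : ℝ} (hk : k < 0) (x : ℝ) :
    periodicPart ε μ j k x = periodicPart ε μ j (-k) (-x) := by
  rw [periodicPart, periodicPart, blochMode_neg hk]
  congr 2
  push_cast
  ring

lemma differentiableAt_periodicPart (h : IsEvenMedium ε μ) (n : ℕ) {k : ℝ}
    (hk : k ∈ Ioo (-π) 0 ∪ Ioo 0 π) (x : ℝ) :
    DifferentiableAt ℝ (fun k' : ℝ => periodicPart ε μ (n + 1) k' x) k := by
  rcases hk with hk | hk
  · have h1 := (h.berry_right n (k := -k) ⟨by linarith [hk.2], by linarith [hk.1]⟩).1 (-x)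
    refine DifferentiableAt.congr_of_eventuallyEq
      (f := fun k' => periodicPart ε μ (n + 1) (-k') (-x)) ?_ ?_
    · exact DifferentiableAt.comp k h1 differentiableAt_id.neg
    · filter_upwards [isOpen_Iio.mem_nhds hk.2] with k' hk' using periodicPart_neg hk' x
  · exact (h.berry_right n hk).1 x

lemma deriv_periodicPart_neg {j : ℕ} {k : ℝ} (hk : k < 0) (x : ℝ) :
    deriv (fun k' : ℝ => periodicPart ε μ j k' x) k =
      -deriv (fun k' : ℝ => periodicPart ε μ j k' (-x)) (-k) := by
  rw [← deriv_comp_neg]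
  refine EventuallyEq.deriv_eq ?_
  filter_upwards [isOpen_Iio.mem_nhds hk] with k' hk' using periodicPart_neg hk' x

/-- The left half-zone is the image of the right one under `(k, x) ↦ (-k, -x)`, which changes the
sign of the connection and moves the period to `[-1, 0]`. -/
lemma berryConnection_eq_zero (h : IsEvenMedium ε μ) (n : ℕ) {k : ℝ}
    (hk : k ∈ Ioo (-π) 0 ∪ Ioo 0 π) : berryConnection ε μ (n + 1) k = 0 := by
  rcases hk with hk | hk
  · obtain ⟨-, hper, h0⟩ := h.berry_right n (k := -k) ⟨by linarith [hk.2], by linarith [hk.1]⟩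
    set G : ℝ → ℂ := fun x => (ε x : ℂ) *
      (deriv (fun k' : ℝ => periodicPart ε μ (n + 1) k' x) (-k) *
      (starRingEnd ℂ) (periodicPart ε μ (n + 1) (-k) x)) with hG
    have hp : Function.Periodic G 1 := fun x => by
      simp only [hG, hper x, h.ε_coef.periodic x]
    have h1 := hp.intervalIntegral_add_eq (-1) 0
    rw [neg_add_cancel, zero_add, h0] at h1
    have h2 := intervalIntegral.integral_comp_neg (a := 0) (b := 1) G
    rw [neg_zero, h1] at h2
    rw [berryConnection, innerX, ← neg_eq_zero, ← intervalIntegral.integral_neg, ← h2]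
    refine intervalIntegral.integral_congr fun x _ => ?_
    simp only [hG, deriv_periodicPart_neg hk.2, periodicPart_neg hk.2, h.ε_even]
    ring
  · rw [← (h.berry_right n hk).2.2, berryConnection, innerX]
    exact intervalIntegral.integral_congr fun x _ => by ring

/-! ### Band-edge limits of the Bloch modes and the Zak phase -/

lemma comb_neg (h : IsEvenMedium ε μ) (E : ℝ) (a b : ℂ) (x : ℝ) :
    comb ε μ E a b (-x) = comb ε μ E a (-b) x := by
  simp only [comb, h.sol₁_neg, h.sol₂_neg]
  push_cast
  ring

/-- Overlaps of a (quasi-)periodic mode with its reflection. -/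
lemma innerX_reflect (h : IsEvenMedium ε μ) {E p q : ℝ} {c : ℂ} (hc : c ^ 2 = 1)
    (hB : ∀ x, comb ε μ E p (Complex.I * q) (x + 1) = c * comb ε μ E p (Complex.I * q) x) :
    innerX ε (comb ε μ E p (Complex.I * q)) (fun x => comb ε μ E p (Complex.I * q) (-x)) =
      ((2 * (p ^ 2 * h.curve.P E - q ^ 2 * h.curve.Q E) : ℝ) : ℂ) ∧
    innerX ε (fun x => comb ε μ E p (Complex.I * q) (-x)) (comb ε μ E p (Complex.I * q)) =
      ((2 * (p ^ 2 * h.curve.P E - q ^ 2 * h.curve.Q E) : ℝ) : ℂ) := by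
  have c1 := (h.isRealSolution₁ E).continuous_sol
  have c2 := (h.isRealSolution₂ E).continuous_sol
  have hconj : ∀ x, (starRingEnd ℂ) (comb ε μ E p (Complex.I * q) x) =
      comb ε μ E p (Complex.I * q) (-x) := fun x => by
    rw [h.comb_neg]
    simp [comb]
  have hB' : ∀ x, comb ε μ E p (Complex.I * q) (-(x + 1)) =
      c * comb ε μ E p (Complex.I * q) (-x) := fun x => by
    have h1 := hB (-(x + 1))
    rw [show -(x + 1) + 1 = -x by ring] at h1
    linear_combination (-c) * h1 - comb ε μ E p (Complex.I * q) (-(x + 1)) * hc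
  have hQ : p ^ 2 * h.curve.P E - q ^ 2 * h.curve.Q E =
      p ^ 2 * h.curve.P E + (-q ^ 2) * h.curve.Q E := by ring
  rw [hQ, ← h.integral_comb_sq]
  constructor
  · rw [← h.integral_period (g := fun x => comb ε μ E p (Complex.I * q) x ^ 2)
      (V := fun x => 2 * p * q * (sol₁ ε μ E x * sol₂ ε μ E x))
      (fun x => by rw [hB, mul_pow, hc, one_mul]) (by fun_prop) (by fun_prop)
      (fun x => by rw [h.sol₁_neg, h.sol₂_neg]; ring)
      (fun x => by rw [h.sol₁_neg, h.sol₂_neg]; ring)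
      (fun x => by
        simp only [comb]
        push_cast
        linear_combination ((q : ℂ) * sol₂ ε μ E x) ^ 2 * Complex.I_sq)]
    refine intervalIntegral.integral_congr fun x _ => ?_
    simp only [hconj, neg_neg]
    ring
  · rw [← h.integral_period (g := fun x => comb ε μ E p (Complex.I * q) (-x) ^ 2)
      (V := fun x => -(2 * p * q * (sol₁ ε μ E x * sol₂ ε μ E x)))
      (fun x => by rw [hB', mul_pow, hc, one_mul]) (by fun_prop) (by fun_prop)
      (fun x => by rw [h.sol₁_neg, h.sol₂_neg]; ring)
      (fun x => by rw [h.sol₁_neg, h.sol₂_neg]; ring)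
      (fun x => by
        rw [h.comb_neg]
        simp only [comb]
        push_cast
        linear_combination ((q : ℂ) * sol₂ ε μ E x) ^ 2 * Complex.I_sq)]
    refine intervalIntegral.integral_congr fun x _ => ?_
    simp only [hconj]
    ring

/-- The energy tends to a band edge from inside the band, so the limit mode has the limiting weights
`u`, `v`, and its overlap with its reflection is `2(uP - vQ)`. -/
lemma exists_edge_mode (h : IsEvenMedium ε μ) (n : ℕ) {k₀ : ℝ} (hk₀ : k₀ = 0 ∨ k₀ = π) :
    ∃ p : ℝ → ℂ,
      (∀ x, Tendsto (fun k => blochMode ε μ (n + 1) k x) (𝓝[Ioo 0 π] k₀) (𝓝 (p x))) ∧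
      innerX ε p (fun x => p (-x)) = (h.curve.edgeOverlap (h.curve.energy n k₀) : ℂ) ∧
      innerX ε (fun x => p (-x)) p = (h.curve.edgeOverlap (h.curve.energy n k₀) : ℂ) := by
  have hF : h.curve.energy n k₀ = h.curve.bot n ∨ h.curve.energy n k₀ = h.curve.top n := by
    have hc : cos k₀ = 1 ∨ cos k₀ = -1 := by
      rcases hk₀ with rfl | rfl
      · exact Or.inl Real.cos_zero
      · exact Or.inr Real.cos_pi
    rcases neg_one_pow_eq_or ℝ n with hn | hn <;> rcases hc with hc | hc
    · exact Or.inl (h.curve.energy_eq_bot (by rw [hc, hn]))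
    · exact Or.inr (h.curve.energy_eq_top (by rw [pow_succ, hc, hn]; ring))
    · exact Or.inr (h.curve.energy_eq_top (by rw [pow_succ, hc, hn]; ring))
    · exact Or.inl (h.curve.energy_eq_bot (by rw [hc, hn]))
  have hne : (𝓝[Ioo 0 π] k₀).NeBot := by
    rw [← mem_closure_iff_nhdsWithin_neBot, closure_Ioo Real.pi_pos.ne]
    rcases hk₀ with rfl | rfl
    · exact left_mem_Icc.2 Real.pi_pos.le
    · exact right_mem_Icc.2 Real.pi_pos.le
  have hexp : Complex.exp (Complex.I * k₀) ^ 2 = 1 := by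
    rw [← Complex.exp_nat_mul]
    rcases hk₀ with rfl | rfl
    · simp
    · rw [show ((2 : ℕ) : ℂ) * (Complex.I * π) = 2 * π * Complex.I by push_cast; ring]
      exact Complex.exp_two_pi_mul_I
  have hcont : Tendsto (h.curve.energy n) (𝓝[Ioo 0 π] k₀) (𝓝 (h.curve.energy n k₀)) :=
    (h.curve.continuous_energy n).continuousAt.tendsto.mono_left nhdsWithin_le_nhds
  have hlim : Tendsto (h.curve.energy n) (𝓝[Ioo 0 π] k₀)
      (𝓝[Ioo (h.curve.bot n) (h.curve.top n)] h.curve.energy n k₀) := by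
    refine tendsto_nhdsWithin_iff.2 ⟨hcont, ?_⟩
    filter_upwards [self_mem_nhdsWithin] with k hk
    exact h.curve.energy_mem_Ioo (abs_cos_lt_one hk)
  obtain ⟨u, v, hu, hv, tu, tv, huv⟩ := h.curve.exists_weight_limits hF
  generalize h.curve.energy n k₀ = F at *
  set p : ℝ → ℂ := comb ε μ F (((-1) ^ n * √u : ℝ) : ℂ) (Complex.I * (√v : ℝ)) with hp
  have hT : ∀ x, Tendsto (fun k => blochMode ε μ (n + 1) k x) (𝓝[Ioo 0 π] k₀) (𝓝 (p x)) := by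
    intro x
    have s1 : Tendsto (fun k => sol₁ ε μ (h.curve.energy n k) x) (𝓝[Ioo 0 π] k₀)
        (𝓝 (sol₁ ε μ F x)) :=
      ((h.continuous_sol₁.comp (Continuous.prodMk_left x)).tendsto F).comp hcont
    have s2 : Tendsto (fun k => sol₂ ε μ (h.curve.energy n k) x) (𝓝[Ioo 0 π] k₀)
        (𝓝 (sol₂ ε μ F x)) :=
      ((h.continuous_sol₂.comp (Continuous.prodMk_left x)).tendsto F).comp hcont
    have a1 : Tendsto (fun k => h.evenAmp n (h.curve.energy n k)) (𝓝[Ioo 0 π] k₀)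
        (𝓝 ((-1) ^ n * √u)) := ((tu.comp hlim).sqrt).const_mul _
    have a2 : Tendsto (fun k => h.oddAmp (h.curve.energy n k)) (𝓝[Ioo 0 π] k₀) (𝓝 (√v)) :=
      (tv.comp hlim).sqrt
    have := (a1.ofReal.mul s1.ofReal).add ((a2.ofReal.const_mul Complex.I).mul s2.ofReal)
    refine this.congr' ?_
    filter_upwards [self_mem_nhdsWithin] with k hk
    rw [h.blochMode_eq n hk, comb]
  -- Quasi-periodicity passes to the limit; as `e^{ik₀} = ±1`, the square of `p` is periodic, which
  -- the overlap integral needs.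
  have hB : ∀ x, p (x + 1) = Complex.exp (Complex.I * k₀) * p x := by
    intro x
    have e1 : Tendsto (fun k : ℝ => Complex.exp (Complex.I * k)) (𝓝[Ioo 0 π] k₀)
        (𝓝 (Complex.exp (Complex.I * k₀))) := by
      have : Continuous fun k : ℝ => Complex.exp (Complex.I * k) := by fun_prop
      exact (this.tendsto k₀).mono_left nhdsWithin_le_nhds
    refine tendsto_nhds_unique (hT (x + 1)) ((e1.mul (hT x)).congr' ?_)
    filter_upwards [self_mem_nhdsWithin] with k hk
    rw [h.blochMode_eq n hk, h.blochMode_eq n hk, (h.comb_mem n hk).2 x]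
  refine ⟨p, hT, ?_⟩
  have := h.innerX_reflect hexp hB
  rw [mul_pow, Real.sq_sqrt hu, Real.sq_sqrt hv, ← pow_mul, mul_comm n, pow_mul, neg_one_sq,
    one_pow, one_mul, huv] at this
  exact this

/-- The limits of the Bloch modes at the ends of the half-zones. -/
lemma exists_limits (h : IsEvenMedium ε μ) (n : ℕ) : ∃ p₀ m₀ pπ mπ : ℝ → ℂ,
    (∀ x, Tendsto (fun k => blochMode ε μ (n + 1) k x) (𝓝[>] 0) (𝓝 (p₀ x))) ∧
    (∀ x, Tendsto (fun k => blochMode ε μ (n + 1) k x) (𝓝[<] 0) (𝓝 (m₀ x))) ∧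
    (∀ x, Tendsto (fun k => blochMode ε μ (n + 1) k x) (𝓝[<] π) (𝓝 (pπ x))) ∧
    (∀ x, Tendsto (fun k => blochMode ε μ (n + 1) k x) (𝓝[>] (-π)) (𝓝 (mπ x))) ∧
    innerX ε p₀ m₀ = (h.curve.edgeOverlap (h.curve.energy n 0) : ℂ) ∧
    innerX ε mπ pπ = (h.curve.edgeOverlap (h.curve.energy n π) : ℂ) := by
  obtain ⟨p₀, h1, h2, -⟩ := h.exists_edge_mode n (Or.inl rfl)
  obtain ⟨pπ, h3, -, h4⟩ := h.exists_edge_mode n (Or.inr rfl)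
  rw [nhdsWithin_Ioo_eq_nhdsGT Real.pi_pos] at h1
  rw [nhdsWithin_Ioo_eq_nhdsLT Real.pi_pos] at h3
  refine ⟨p₀, fun x => p₀ (-x), pπ, fun x => pπ (-x), h1, fun x => ?_, h3, fun x => ?_, h2, h4⟩
  · have hn : Tendsto (fun k : ℝ => -k) (𝓝[<] 0) (𝓝[>] 0) := by
      simpa using tendsto_neg_nhdsLT (a := (0 : ℝ))
    refine ((h1 (-x)).comp hn).congr' ?_
    filter_upwards [self_mem_nhdsWithin] with k hk
    exact (blochMode_neg hk x).symm
  · have hn : Tendsto (fun k : ℝ => -k) (𝓝[>] (-π)) (𝓝[<] π) := by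
      simpa using tendsto_neg_nhdsGT (a := (-π : ℝ))
    refine ((h3 (-x)).comp hn).congr' ?_
    have : Iio (0 : ℝ) ∈ 𝓝[>] (-π) :=
      mem_nhdsWithin_of_mem_nhds (isOpen_Iio.mem_nhds (by simpa using Real.pi_pos))
    filter_upwards [this] with k hk
    exact (blochMode_neg hk x).symm

/-- The factor that a band edge contributes to the exponential of the Zak phase. -/
def edgeSign (h : IsEvenMedium ε μ) (E : ℝ) : ℝ := if h.curve.t E = 0 then 1 else -1

/-- With `log 0 = 0`, a Dirac point contributes the factor 1, just like an even edge. -/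
lemma exp_log_edgeOverlap (h : IsEvenMedium ε μ) (E : ℝ) :
    Complex.exp (Complex.I * (-((Complex.log (h.curve.edgeOverlap E : ℂ)).im : ℂ))) =
      h.edgeSign E := by
  unfold RotatingCurve.edgeOverlap edgeSign
  split_ifs
  · simp
  · simp
  · simp only [Complex.ofReal_neg, Complex.ofReal_one, Complex.log_neg_one]
    rw [show Complex.I * -(((π : ℂ) * Complex.I).im : ℂ) = -(π * Complex.I) by simp; ring,
      Complex.exp_neg, Complex.exp_pi_mul_I]
    norm_num

lemma berry_intervalIntegrable (h : IsEvenMedium ε μ) (n : ℕ) {a b : ℝ} (hab : a ≤ b)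
    (hs : Ioo a b ⊆ Ioo (-π) 0 ∪ Ioo 0 π) :
    IntervalIntegrable (berryConnection ε μ (n + 1)) volume a b ∧
    ∫ k in a..b, berryConnection ε μ (n + 1) k = 0 := by
  have h0 : ∀ k ∈ uIoo a b, (0 : ℂ) = berryConnection ε μ (n + 1) k := fun k hk =>
    (h.berryConnection_eq_zero n (hs (by rwa [uIoo_of_le hab] at hk))).symm
  refine ⟨intervalIntegrable_const.congr_uIoo h0, ?_⟩
  rw [← intervalIntegral.integral_congr_uIoo h0]
  simp

lemma exists_isZakPhase (h : IsEvenMedium ε μ) (n : ℕ) : ∃ θ, IsZakPhase ε μ (n + 1) θ := by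
  obtain ⟨p₀, m₀, pπ, mπ, h1, h2, h3, h4, h5, h6⟩ := h.exists_limits n
  have i1 := h.berry_intervalIntegrable n (neg_nonpos.2 Real.pi_pos.le) subset_union_left
  have i2 := h.berry_intervalIntegrable n Real.pi_pos.le subset_union_right
  refine ⟨-(Complex.log (innerX ε p₀ m₀)).im - (Complex.log (innerX ε mπ pπ)).im,
    fun x k hk => h.differentiableAt_periodicPart n hk x, i1.1, i2.1,
    p₀, m₀, pπ, mπ, h1, h2, h3, h4, 0, ?_⟩
  rw [i1.2, i2.2]
  push_cast
  ring

/-- Limits are unique, so any Zak phase is fixed modulo `2π` by the two overlaps. The parity of `n`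
decides which of `k = 0, π` is the lower edge, but the product is symmetric. -/
lemma exp_of_isZakPhase (h : IsEvenMedium ε μ) (n : ℕ) {θ : ℝ} (hθ : IsZakPhase ε μ (n + 1) θ) :
    Complex.exp (Complex.I * θ) =
      ((h.edgeSign (h.curve.bot n) * h.edgeSign (h.curve.top n) : ℝ) : ℂ) := by
  obtain ⟨-, -, -, p₀, m₀, pπ, mπ, h1, h2, h3, h4, N, hN⟩ := hθ
  obtain ⟨p₀', m₀', pπ', mπ', h1', h2', h3', h4', h5, h6⟩ := h.exists_limits n
  obtain rfl : p₀ = p₀' := funext fun x => tendsto_nhds_unique (h1 x) (h1' x)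
  obtain rfl : m₀ = m₀' := funext fun x => tendsto_nhds_unique (h2 x) (h2' x)
  obtain rfl : pπ = pπ' := funext fun x => tendsto_nhds_unique (h3 x) (h3' x)
  obtain rfl : mπ = mπ' := funext fun x => tendsto_nhds_unique (h4 x) (h4' x)
  have i1 := h.berry_intervalIntegrable n (neg_nonpos.2 Real.pi_pos.le) subset_union_left
  have i2 := h.berry_intervalIntegrable n Real.pi_pos.le subset_union_right
  rw [h5, h6, i1.2, i2.2] at hN
  have hprod : Complex.exp (Complex.I * θ) = ((h.edgeSign (h.curve.energy n 0) *
      h.edgeSign (h.curve.energy n π) : ℝ) : ℂ) := by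
    rw [Complex.ofReal_mul, ← h.exp_log_edgeOverlap, ← h.exp_log_edgeOverlap, ← Complex.exp_add,
      Complex.exp_eq_exp_iff_exists_int]
    exact ⟨N, by rw [hN]; ring⟩
  rw [hprod]
  rcases neg_one_pow_eq_or ℝ n with hn | hn
  · rw [h.curve.energy_eq_bot (by rw [Real.cos_zero, hn]),
      h.curve.energy_eq_top (by rw [Real.cos_pi, pow_succ, hn]; ring)]
  · rw [h.curve.energy_eq_bot (n := n) (k := π) (by rw [Real.cos_pi, hn]),
      h.curve.energy_eq_top (by rw [Real.cos_zero, pow_succ, hn]; ring), mul_comm]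

/-! ### The bulk index and the parity of the band-edge modes -/

lemma card_closedGaps_succ (h : IsEvenMedium ε μ) (n : ℕ) [Decidable (h.curve.top n = h.curve.bot (n + 1))] :
    (h.closedGaps (n + 1)).card =
      (h.closedGaps n).card + if h.curve.top n = h.curve.bot (n + 1) then 1 else 0 := by
  classical
  unfold closedGaps
  rw [Finset.range_add_one, Finset.filter_insert]
  split_ifs with hc
  · rw [Finset.card_insert_of_notMem (by simp)]
  · rfl

/-- The edge signs telescope across gaps: an open gap gives `-1` by `gap_types`, a closed one `1`.
The number of open gaps among the first `n` has the parity of `n` plus the number of closed ones. -/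
lemma exp_sum_zak (h : IsEvenMedium ε μ) {θ : ℕ → ℝ} (n : ℕ)
    (hθ : ∀ m ∈ Finset.Icc 1 (n + 1), IsZakPhase ε μ m (θ m)) :
    Complex.exp (Complex.I * ((∑ m ∈ Finset.Icc 1 (n + 1), θ m : ℝ) : ℂ)) =
      ((h.edgeSign (h.curve.top n) * (-1) ^ (n + (h.closedGaps n).card) : ℝ) : ℂ) := by
  classical
  induction n with
  | zero =>
    have h0 := h.exp_of_isZakPhase 0 (hθ 1 (by simp))
    have h1 : h.edgeSign (h.curve.bot 0) = 1 := if_pos h.curve.t_bot_zero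
    rw [h1, one_mul] at h0
    simpa [closedGaps] using h0
  | succ n ih =>
    have h0 := h.exp_of_isZakPhase (n + 1) (hθ (n + 2) (by simp))
    rw [Finset.sum_Icc_succ_top (by omega), Complex.ofReal_add, mul_add, Complex.exp_add, h0,
      ih fun m hm => hθ m (Finset.Icc_subset_Icc_right (by omega) hm), ← Complex.ofReal_mul,
      Complex.ofReal_inj, h.card_closedGaps_succ]
    split_ifs with hc
    · have h1 : h.edgeSign (h.curve.top n) = 1 := if_pos (h.curve.t_top_of_touching hc)
      rw [← hc, h1]
      ring
    · have h1 : h.edgeSign (h.curve.top n) * h.edgeSign (h.curve.bot (n + 1)) = -1 := by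
        rcases h.curve.gap_types hc with h2 | h2 <;> simp [edgeSign, h2]
      rw [show n + 1 + ((h.closedGaps n).card + 0) = n + (h.closedGaps n).card + 1 by ring, pow_succ]
      linear_combination (h.edgeSign (h.curve.top (n + 1)) *
        (-1) ^ (n + (h.closedGaps n).card)) * h1

/-- For `j = n + 1` the exponent `j + ℓ - 1` is `n + ℓ`, without truncation, so the prefactor
squares away the sign in `exp_sum_zak`. -/
lemma bulkIndex_eq (h : IsEvenMedium ε μ) {θ : ℕ → ℝ} (n : ℕ)
    (hθ : ∀ m ∈ Finset.Icc 1 (n + 1), IsZakPhase ε μ m (θ m)) :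
    bulkIndex ε μ (n + 1) θ = (h.edgeSign (h.curve.top n) : ℂ) := by
  rw [bulkIndex, h.exp_sum_zak n hθ, h.ncard_diracBelow, Nat.add_right_comm, Nat.add_sub_cancel]
  push_cast
  rw [mul_left_comm, ← mul_pow]
  simp

lemma even_of_mem (h : IsEvenMedium ε μ) {k E : ℝ} {ψ : ℝ → ℂ} (hψ : ψ ∈ blochSpace ε μ k E)
    (hA : h.curve.A E = cos k) (ht : h.curve.t E = 0) (hτ : h.curve.τ E ≠ 0) (x : ℝ) :
    ψ (-x) = ψ x := by
  obtain ⟨a, b, rfl, h1, -⟩ := h.mem_blochSpace_iff.1 hψ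
  rw [h.exp_eq_A_of_degenerate hA (by rw [ht, zero_mul])] at h1
  have hb : b = 0 := by simpa [hτ] using h1
  rw [h.comb_neg, hb, neg_zero]

lemma odd_of_mem (h : IsEvenMedium ε μ) {k E : ℝ} {ψ : ℝ → ℂ} (hψ : ψ ∈ blochSpace ε μ k E)
    (hA : h.curve.A E = cos k) (hτ : h.curve.τ E = 0) (ht : h.curve.t E ≠ 0) (x : ℝ) :
    ψ (-x) = -ψ x := by
  obtain ⟨a, b, rfl, -, h2⟩ := h.mem_blochSpace_iff.1 hψ
  rw [h.exp_eq_A_of_degenerate hA (by rw [hτ, mul_zero])] at h2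
  have ha : a = 0 := by simpa [ht] using h2
  rw [h.comb_neg, ha]
  simp only [comb]
  ring

lemma not_even_and_odd {ψ : ℝ → ℂ} (h0 : ψ ≠ 0) (he : ∀ x, ψ (-x) = ψ x)
    (ho : ∀ x, ψ (-x) = -ψ x) : False :=
  h0 (funext fun x => self_eq_neg.1 ((he x).symm.trans (ho x)))

lemma bulkIndex_parity (h : IsEvenMedium ε μ) {n : ℕ}
    (hgap : h.curve.top n ≠ h.curve.bot (n + 1)) {θ : ℕ → ℝ}
    (hθ : ∀ m ∈ Finset.Icc 1 (n + 1), IsZakPhase ε μ m (θ m)) {k : ℝ}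
    {ψ : ℝ → ℂ} (hψ : ψ ∈ blochSpace ε μ k (h.curve.top n)) (h0 : ψ ≠ 0) :
    (bulkIndex ε μ (n + 1) θ = 1 ↔ ∀ x, ψ (-x) = ψ x) ∧
      (bulkIndex ε μ (n + 1) θ = -1 ↔ ∀ x, ψ (-x) = -ψ x) := by
  rw [h.bulkIndex_eq n hθ]
  have hA := h.A_eq_cos_of_mem hψ h0
  have h11 : (1 : ℂ) ≠ -1 := by norm_num
  rcases h.curve.gap_types hgap with ⟨ht, hτ, -⟩ | ⟨hτ, ht, -⟩
  · have he := h.even_of_mem hψ hA ht hτ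
    rw [edgeSign, if_pos ht, Complex.ofReal_one]
    exact ⟨iff_of_true rfl he, iff_of_false h11 (not_even_and_odd h0 he)⟩
  · have ho := h.odd_of_mem hψ hA hτ ht
    rw [edgeSign, if_neg ht, Complex.ofReal_neg, Complex.ofReal_one]
    exact ⟨iff_of_false h11.symm fun he => not_even_and_odd h0 he ho, iff_of_true rfl ho⟩

end IsEvenMedium

end Photonic

end

theorem mainTheorem3 (ε μ : ℝ → ℝ)
    (hε : Photonic.IsCoefficient ε) (hμ : Photonic.IsCoefficient μ)
    (hε_even : ∀ x, ε (-x) = ε x) (hμ_even : ∀ x, μ (-x) = μ x)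
    (j : ℕ) (hj : 1 ≤ j)
    (hgap : ∀ k ∈ Set.Icc (-Real.pi) Real.pi,
      Photonic.bandFn ε μ j k ≠ Photonic.bandFn ε μ (j + 1) k) :
    (∀ m ∈ Finset.Icc 1 j, ∃ θ : ℝ, Photonic.IsZakPhase ε μ m θ) ∧
    (Photonic.diracBelow ε μ j).Finite ∧
    (∃ k : ℝ, (k = 0 ∨ k = Real.pi) ∧ Photonic.bandFn ε μ j k = Photonic.bandTop ε μ j ∧
      ∃ ψ ∈ Photonic.blochSpace ε μ k (Photonic.bandTop ε μ j), ψ ≠ 0) ∧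
    ∀ θ : ℕ → ℝ, (∀ m ∈ Finset.Icc 1 j, Photonic.IsZakPhase ε μ m (θ m)) →
      (Photonic.bulkIndex ε μ j θ = 1 ∨ Photonic.bulkIndex ε μ j θ = -1) ∧
      ∀ k ∈ Set.Icc (-Real.pi) Real.pi,
        Photonic.bandFn ε μ j k = Photonic.bandTop ε μ j →
        ∀ ψ ∈ Photonic.blochSpace ε μ k (Photonic.bandTop ε μ j), ψ ≠ 0 →
          (Photonic.bulkIndex ε μ j θ = 1 ↔ ∀ x, ψ (-x) = ψ x) ∧
          (Photonic.bulkIndex ε μ j θ = -1 ↔ ∀ x, ψ (-x) = -ψ x) := by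
  have h : Photonic.IsEvenMedium ε μ := ⟨hε, hμ, hε_even, hμ_even⟩
  obtain ⟨n, rfl⟩ : ∃ n, j = n + 1 := ⟨j - 1, by omega⟩
  obtain ⟨k₀, hk₀, hc⟩ := Photonic.IsEvenMedium.exists_cos_eq (n + 1)
  have htop := h.curve.energy_eq_top (n := n) hc
  -- At the wavenumber with `cos k₀ = (-1)^(n+1)` the band is at its top and the next one at its
  -- bottom, so the absence of a crossing there is an open gap.
  have hgap' : h.curve.top n ≠ h.curve.bot (n + 1) := by
    have := hgap k₀ (Photonic.IsEvenMedium.mem_Icc_of_edge hk₀)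
    rwa [h.bandFn_succ, h.bandFn_succ, htop, h.curve.energy_eq_bot hc] at this
  rw [h.bandTop_succ]
  refine ⟨fun m hm => ?_, h.finite_diracBelow n, ⟨k₀, hk₀, by rw [h.bandFn_succ, htop], ?_⟩,
    fun θ hθ => ⟨?_, fun k _ _ ψ hψ h0 => h.bulkIndex_parity hgap' hθ hψ h0⟩⟩
  · obtain ⟨i, rfl⟩ : ∃ i, m = i + 1 := ⟨m - 1, by have := (Finset.mem_Icc.1 hm).1; omega⟩
    exact h.exists_isZakPhase i
  · obtain ⟨g, hg, hli, -⟩ := h.exists_modes k₀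
    exact ⟨g n, htop ▸ hg n, hli.ne_zero n⟩
  · rw [h.bulkIndex_eq n hθ, Photonic.IsEvenMedium.edgeSign]
    split_ifs
    · exact Or.inl Complex.ofReal_one
    · exact Or.inr (by push_cast; rfl)
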